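/- Let $n\ge 1$, $s\in(0,1)$, $p:=\max\{2,n/(2s)\}$, and let $\Omega\subset\mathbb R^n$ be a bounded open set. All function spaces consist of complex-valued functions, and $a\cdot b=\sum_j a_jb_j$ and all pairings $\langle\cdot,\cdot\rangle$ are bilinear (no conjugation). $H^s=H^s(\mathbb R^n)$ has the norm $\|\mathcal F^{-1}((1+|\xi|^2)^{s/2}\hat u)\|_{L^2}$, $\tilde H^s(\Omega)$ is the closure of $C_c^\infty(\Omega)$ in $H^s$, and $X:=H^s/\tilde H^s(\Omega)$ carries the quotient norm; $X^*$ is its normed dual. Put $\alpha(x,y)=\frac{\mathcal C_{n,s}^{1/2}}{\sqrt2}\frac{y-x}{|y-x|^{n/2+s+1}}$ with $\mathcal C_{n,s}=\frac{4^s\Gamma(n/2+s)}{\pi^{n/2}|\Gamma(-s)|}$, $\nabla^su(x,y)=(u(x)-u(y))\alpha(x,y)$, and, for $A:\mathbb R^{2n}\to\mathbb C^n$, $\nabla^s_Au(x,y)=\nabla^su(x,y)+A(x,y)u(x)$. Let $A_s(x,y)=\frac12(A(x,y)+A(y,x))$, $A_a=A-A_s$, and let $A_\parallel(x,y)=\frac{A(x,y)\cdot(x-y)}{|x-y|^2}(x-y)$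 for $x\ne y$ (and $A_\parallel(x,x)=A(x,x)$); $A_{s\parallel}=(A_s)_\parallel$, $A_{a\parallel}=(A_a)_\parallel$. Let $\mathcal J_1A(x)=\|A(\cdot,x)\|_{L^2}$ and $\mathcal J_2A(x)=\|A(x,\cdot)\|_{L^2}$. $\mathcal P_0$ is the set of pairs $(A,q)$, $A:\mathbb R^{2n}\to\mathbb C^n$ measurable, $q:\mathbb R^n\to\mathbb R$, such that $\mathcal J_1A,\mathcal J_2A\in L^{2p}(\mathbb R^n)$, $A_{s\parallel}\in H^{sp-s}(\mathbb R^{2n},\mathbb C^n)$, $A_{a\parallel}(x,y)\cdot(y-x)\ge0$ a.e. (in particular it is real), and $q\in L^p(\mathbb R^n)$ (a function in $L^p(\Omega)$ being extended by zero). $\mathcal P$ is the set of $(A,q)\in\mathcal P_0$ with moreover $A\in L^2(\mathbb R^{2n})$ and $A=0$ a.e. outside $\Omega\times\Omega$. Define $$B^s_{A,q}[u,v]=\int_{\mathbb R^{2n}}\nabla^s_Au\cdot\nabla^s_Av\,dx\,dy+\int_{\mathbb R^n}q\,u\,v\,dx,\qquad u,v\in H^s.$$ We say that $u\in H^s$ solves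 $(-\Delta)^s_Au+qu=0$ in $\Omega$ with exterior value $f\in H^s$ if $u-f\in\tilde H^s(\Omega)$ and $B^s_{A,q}[u,v]=0$ for all $v\in\tilde H^s(\Omega)$. We say that $0$ is not an eigenvalue for $(A,q)$ if the only $w\in\tilde H^s(\Omega)$ with $B^s_{A,q}[w,v]=0$ for all $v\in\tilde H^s(\Omega)$ is $w=0$. (1) Let $(A,q)\in\mathcal P_0$ and suppose that $0$ is not an eigenvalue for $(A,q)$. Then for every $f\in H^s$ there is a unique solution $u_f\in H^s$ with exterior value $f$, and there is a unique bounded linear map $\Lambda^s_{A,q}:X\to X^*$ such that $$\langle\Lambda^s_{A,q}[f],[g]\rangle=B^s_{A,q}[u_f,g]\qquad\text{for all }f,g\in H^s.$$ It is self-adjoint: $\langle\Lambda^s_{A,q}[f],[g]\rangle=\langle\Lambda^s_{A,q}[g],[f]\rangle$ for all $f,g\in H^s$. (2) Let $(A_1,q_1),(A_2,q_2)\in\mathcal P$ and suppose that $0$ is not an eigenvalue for either pair. Then the distributions $(\nabla\cdot)^s(A_i)_{s\parallel}$, defined by $\langle(\nabla\cdot)^s(A_i)_{s\parallel},\varphi\rangle=\int_{\mathbb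 R^{2n}}(A_i)_{s\parallel}\cdot\nabla^s\varphi\,dx\,dy$ for $\varphi\in C_c^\infty(\mathbb R^n)$, are locally integrable functions, and $$Q_i:=q_i+\int_{\mathbb R^n}A_i(\cdot,y)\cdot A_i(\cdot,y)\,dy+(\nabla\cdot)^s(A_i)_{s\parallel}\in L^p(\mathbb R^n)$$ (the second term is $\int|A_i|^2dy$ when $A_i$ is real). For $f_1,f_2\in H^s$, let $u_i\in H^s$ be the solution for $(A_i,q_i)$ with exterior value $f_i$. Then $$\langle(\Lambda^s_{A_1,q_1}-\Lambda^s_{A_2,q_2})[f_1],[f_2]\rangle=2\Big\langle\int_{\mathbb R^n}\big((A_1)_{a\parallel}-(A_2)_{a\parallel}\big)\cdot\nabla^su_1\,dy,\;u_2\Big\rangle+\langle(Q_1-Q_2)u_1,u_2\rangle,$$ where the pairings on the right-hand side are absolutely convergent integrals over $\mathbb R^n$. -/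

import Mathlib

open MeasureTheory Filter FourierTransform
open scoped ENNReal ContDiff

namespace FracMag

/-- `ℝⁿ`. -/
abbrev Rn (n : ℕ) : Type := EuclideanSpace ℝ (Fin n)

/-- `ℂⁿ`. -/
abbrev Cn (n : ℕ) : Type := EuclideanSpace ℂ (Fin n)

/-- The Hilbert space `ℝ²ⁿ = ℝⁿ × ℝⁿ` (with its Euclidean norm). -/
abbrev R2n (n : ℕ) : Type := WithLp 2 (Rn n × Rn n)

noncomputable section

section Sobolev

variable {V F : Type*} [NormedAddCommGroup V] [InnerProductSpace ℝ V] [FiniteDimensional ℝ V]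
  [MeasurableSpace V] [BorelSpace V] [NormedAddCommGroup F] [InnerProductSpace ℂ F]
  [CompleteSpace F]

/-- The function `ξ ↦ (1 + |2πξ|²)^{t/2} 𝓕u(ξ)`. As Mathlib's Fourier transform has the kernel
`e^{-2πi⟨x,ξ⟩}`, its `L²` norm is the `L²` norm of `⟨D⟩ᵗ u`, where `⟨D⟩ᵗ` is the Fourier
multiplier with symbol `(1 + |ξ|²)^{t/2}` for the kernel `e^{-i⟨x,ξ⟩}`. -/
def bessel (t : ℝ) (u : Lp F 2 (volume : Measure V)) : V → F := fun ξ =>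
  (((1 + (2 * Real.pi * ‖ξ‖) ^ 2) ^ (t / 2) : ℝ) : ℂ) • ((𝓕 u : Lp F 2 (volume : Measure V)) ξ)

/-- The `L²` function `f` belongs to `Hᵗ(V; F)` (used for `t ≥ 0`). -/
def MemH (t : ℝ) (f : V → F) : Prop :=
  ∃ h : MemLp f 2 volume, MemLp (bessel t (h.toLp f)) 2 volume

lemma bessel_add (t : ℝ) (u v : Lp F 2 (volume : Measure V)) :
    bessel t (u + v) =ᵐ[volume] bessel t u + bessel t v := by
  have h : (𝓕 (u + v) : Lp F 2 (volume : Measure V)) = 𝓕 u + 𝓕 v := FourierTransform.fourier_add u v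
  filter_upwards [Lp.coeFn_add (𝓕 u : Lp F 2 (volume : Measure V)) (𝓕 v)] with ξ hξ
  simp only [bessel, h, hξ, Pi.add_apply, smul_add]

lemma bessel_smul (t : ℝ) (c : ℂ) (u : Lp F 2 (volume : Measure V)) :
    bessel t (c • u) =ᵐ[volume] c • bessel t u := by
  have h : (𝓕 (c • u) : Lp F 2 (volume : Measure V)) = c • 𝓕 u := FourierTransform.fourier_smul c u
  filter_upwards [Lp.coeFn_smul c (𝓕 u : Lp F 2 (volume : Measure V))] with ξ hξ
  simp only [bessel, h, hξ, Pi.smul_apply, smul_comm c]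

lemma bessel_zero (t : ℝ) : bessel t (0 : Lp F 2 (volume : Measure V)) =ᵐ[volume] 0 := by
  have := bessel_smul t 0 (0 : Lp F 2 (volume : Measure V))
  simpa using this

end Sobolev

/-- `Hˢ(ℝⁿ)` (for `s ≥ 0`) as a subspace of `L²(ℝⁿ; ℂ)`. -/
def hsSubmodule (n : ℕ) (s : ℝ) : Submodule ℂ (Lp ℂ 2 (volume : Measure (Rn n))) where
  carrier := {u | MemLp (bessel s u) 2 volume}
  add_mem' {u v} hu hv := (memLp_congr_ae (bessel_add s u v)).2 (MemLp.add hu hv)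
  zero_mem' := (memLp_congr_ae (bessel_zero s)).2 MemLp.zero
  smul_mem' c u hu := (memLp_congr_ae (bessel_smul s c u)).2 (MemLp.const_smul hu c)

/-- The Sobolev space `Hˢ(ℝⁿ)`; its norm is that of `⟨D⟩ˢ u` in `L²` (see below). -/
def Hs (n : ℕ) (s : ℝ) : Type := hsSubmodule n s

instance (n : ℕ) (s : ℝ) : AddCommGroup (Hs n s) :=
  inferInstanceAs (AddCommGroup (hsSubmodule n s))

instance (n : ℕ) (s : ℝ) : Module ℂ (Hs n s) :=
  inferInstanceAs (Module ℂ (hsSubmodule n s))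

/-- The inclusion `Hˢ(ℝⁿ) → L²(ℝⁿ)`. -/
def Hs.incl (n : ℕ) (s : ℝ) : Hs n s →ₗ[ℂ] Lp ℂ 2 (volume : Measure (Rn n)) :=
  (hsSubmodule n s).subtype

/-- A representative of `u ∈ Hˢ(ℝⁿ)` as a function. -/
def Hs.fn {n : ℕ} {s : ℝ} (u : Hs n s) : Rn n → ℂ := Hs.incl n s u

lemma Hs.memLp_bessel {n : ℕ} {s : ℝ} (u : Hs n s) :
    MemLp (bessel s (Hs.incl n s u)) 2 volume := u.2

/-- The map `u ↦ (1 + |2πξ|²)^{s/2} 𝓕u` from `Hˢ(ℝⁿ)` to `L²(ℝⁿ)`. -/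
def Hs.weighted (n : ℕ) (s : ℝ) : Hs n s →ₗ[ℂ] Lp ℂ 2 (volume : Measure (Rn n)) where
  toFun u := u.memLp_bessel.toLp _
  map_add' u v := by
    rw [← MemLp.toLp_add]
    refine (MemLp.toLp_eq_toLp_iff _ _).2 ?_
    rw [map_add]
    exact bessel_add s _ _
  map_smul' c u := by
    rw [RingHom.id_apply, ← MemLp.toLp_const_smul]
    refine (MemLp.toLp_eq_toLp_iff _ _).2 ?_
    rw [map_smul]
    exact bessel_smul s c _

lemma Hs.weighted_injective (n : ℕ) (s : ℝ) : Function.Injective (Hs.weighted n s) := by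
  rw [← LinearMap.ker_eq_bot, LinearMap.ker_eq_bot']
  intro u hu
  have h1 : bessel s (Hs.incl n s u) =ᵐ[volume] 0 := by
    have h2 := u.memLp_bessel.coeFn_toLp
    have h3 : u.memLp_bessel.toLp _ = 0 := hu
    rw [h3] at h2
    exact h2.symm.trans (Lp.coeFn_zero _ _ _)
  have h4 : (𝓕 (Hs.incl n s u) : Lp ℂ 2 (volume : Measure (Rn n))) = 0 := by
    refine Lp.ext ?_
    filter_upwards [h1, Lp.coeFn_zero ℂ 2 (volume : Measure (Rn n))] with ξ hξ h0
    rw [h0]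
    have hw : (0 : ℝ) < (1 + (2 * Real.pi * ‖ξ‖) ^ 2) ^ (s / 2) := by positivity
    have := smul_eq_zero.1 hξ
    rcases this with h | h
    · exact absurd (Complex.ofReal_eq_zero.1 h) hw.ne'
    · exact h
  have h5 : Hs.incl n s u = 0 := by
    have := Lp.norm_fourier_eq (Hs.incl n s u)
    rw [h4, norm_zero] at this
    exact norm_eq_zero.1 this.symm
  exact Subtype.ext h5

instance (n : ℕ) (s : ℝ) : NormedAddCommGroup (Hs n s) :=
  NormedAddCommGroup.induced (Hs n s) _ (Hs.weighted n s) (Hs.weighted_injective n s)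

instance (n : ℕ) (s : ℝ) : NormedSpace ℂ (Hs n s) :=
  NormedSpace.induced ℂ (Hs n s) _ (Hs.weighted n s)

/-- `‖u‖_{Hˢ} = ‖(1 + |2πξ|²)^{s/2} 𝓕u‖_{L²}`. -/
lemma Hs.norm_eq {n : ℕ} {s : ℝ} (u : Hs n s) :
    ‖u‖ = (eLpNorm (bessel s (Hs.incl n s u)) 2 volume).toReal :=
  Lp.norm_toLp _ u.memLp_bessel

/-- Complex valued functions in `C_c^∞(U)`. -/
def IsTest {n : ℕ} (U : Set (Rn n)) (φ : Rn n → ℂ) : Prop :=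
  ContDiff ℝ ∞ φ ∧ HasCompactSupport φ ∧ tsupport φ ⊆ U

/-- `H̃ˢ(Ω)`: the closure of `C_c^∞(Ω)` in `Hˢ(ℝⁿ)`. -/
def HsTilde (n : ℕ) (s : ℝ) (Ω : Set (Rn n)) : Submodule ℂ (Hs n s) :=
  (Submodule.span ℂ {u : Hs n s | ∃ φ, IsTest Ω φ ∧ u.fn =ᵐ[volume] φ}).topologicalClosure

/-- The abstract trace space `X = Hˢ(ℝⁿ) / H̃ˢ(Ω)` with its quotient norm. -/
abbrev Trace (n : ℕ) (s : ℝ) (Ω : Set (Rn n)) : Type := Hs n s ⧸ HsTilde n s Ω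

/-- The class `[f] ∈ X` of `f ∈ Hˢ(ℝⁿ)`. -/
def Trace.mk {n : ℕ} {s : ℝ} (Ω : Set (Rn n)) (f : Hs n s) : Trace n s Ω :=
  Submodule.Quotient.mk f

/-- The bilinear dot product of `ℂⁿ` (no conjugation). -/
def dot {n : ℕ} (a b : Cn n) : ℂ := ∑ j, a j * b j

/-- The inclusion `ℝⁿ ⊆ ℂⁿ`. -/
def toCn {n : ℕ} (x : Rn n) : Cn n := WithLp.toLp 2 fun j => (x j : ℂ)

/-- The constant of the fractional Laplacian, `4ˢ Γ(n/2 + s) / (π^{n/2} |Γ(-s)|)`. -/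
def fracConst (n : ℕ) (s : ℝ) : ℝ :=
  4 ^ s * Real.Gamma (n / 2 + s) / (Real.pi ^ ((n : ℝ) / 2) * |Real.Gamma (-s)|)

/-- `α(x,y) = √(C_{n,s}/2) (y - x) / |y - x|^{n/2+s+1}`. -/
def alpha (n : ℕ) (s : ℝ) (z : Rn n × Rn n) : Rn n :=
  (Real.sqrt (fracConst n s) / Real.sqrt 2 / ‖z.2 - z.1‖ ^ ((n : ℝ) / 2 + s + 1)) • (z.2 - z.1)

/-- The fractional gradient `∇ˢu(x,y) = (u(x) - u(y)) α(x,y)`. -/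
def fracGrad (n : ℕ) (s : ℝ) (u : Rn n → ℂ) (z : Rn n × Rn n) : Cn n :=
  (u z.1 - u z.2) • toCn (alpha n s z)

/-- The magnetic fractional gradient `∇ˢ_A u(x,y) = ∇ˢu(x,y) + A(x,y) u(x)`. -/
def magGrad (n : ℕ) (s : ℝ) (A : Rn n × Rn n → Cn n) (u : Rn n → ℂ) (z : Rn n × Rn n) : Cn n :=
  fracGrad n s u z + u z.1 • A z

/-- Symmetric part. -/
def symPart {n : ℕ} (A : Rn n × Rn n → Cn n) (z : Rn n × Rn n) : Cn n :=
  (1 / 2 : ℂ) • (A z + A z.swap)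

/-- Antisymmetric part. -/
def antiPart {n : ℕ} (A : Rn n × Rn n → Cn n) (z : Rn n × Rn n) : Cn n :=
  A z - symPart A z

open Classical in
/-- Parallel part. -/
def parPart {n : ℕ} (A : Rn n × Rn n → Cn n) (z : Rn n × Rn n) : Cn n :=
  if z.1 = z.2 then A z
  else (dot (A z) (toCn (z.1 - z.2)) / ((‖z.1 - z.2‖ ^ 2 : ℝ) : ℂ)) • toCn (z.1 - z.2)

/-- `𝒥₁A(x) = ‖A(·,x)‖_{L²}`, with values in `[0,∞]`. -/
def J1 {n : ℕ} (A : Rn n × Rn n → Cn n) (x : Rn n) : ℝ≥0∞ :=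
  eLpNorm (fun y => A (y, x)) 2 volume

/-- `𝒥₂A(x) = ‖A(x,·)‖_{L²}`, with values in `[0,∞]`. -/
def J2 {n : ℕ} (A : Rn n × Rn n → Cn n) (x : Rn n) : ℝ≥0∞ :=
  eLpNorm (fun y => A (x, y)) 2 volume

/-- `p = max{2, n/(2s)}`. -/
def pReal (n : ℕ) (s : ℝ) : ℝ := max 2 (n / (2 * s))

/-- `p = max{2, n/(2s)}` as an integrability exponent. -/
def pExp (n : ℕ) (s : ℝ) : ℝ≥0∞ := ENNReal.ofReal (pReal n s)

/-- The class `𝒫₀` of pairs of potentials. A scalar potential in `L^p(Ω)` is covered through its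
extension by zero. -/
structure IsPotential₀ (n : ℕ) (s : ℝ) (A : Rn n × Rn n → Cn n) (q : Rn n → ℝ) : Prop where
  aesm : AEStronglyMeasurable A volume
  memJ1 : MemLp (J1 A) (2 * pExp n s) volume
  memJ2 : MemLp (J2 A) (2 * pExp n s) volume
  sympar : MemH (s * pReal n s - s) (fun z : R2n n => parPart (symPart A) z.ofLp)
  antipar : ∀ᵐ z : Rn n × Rn n, ∃ c : ℝ, 0 ≤ c ∧
    dot (parPart (antiPart A) z) (toCn (z.2 - z.1)) = (c : ℂ)
  memq : MemLp q (pExp n s) volume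

/-- The class `𝒫` of pairs of potentials. -/
structure IsPotential (n : ℕ) (s : ℝ) (Ω : Set (Rn n)) (A : Rn n × Rn n → Cn n)
    (q : Rn n → ℝ) : Prop extends IsPotential₀ n s A q where
  memA : MemLp A 2 volume
  supp : ∀ᵐ z : Rn n × Rn n, z ∉ Ω ×ˢ Ω → A z = 0

/-- The bilinear form `B^s_{A,q}[u,v]`. -/
def bform {n : ℕ} {s : ℝ} (A : Rn n × Rn n → Cn n) (q : Rn n → ℝ) (u v : Hs n s) : ℂ :=
  (∫ z : Rn n × Rn n, dot (magGrad n s A u.fn z) (magGrad n s A v.fn z)) +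
    ∫ x, (q x : ℂ) * u.fn x * v.fn x

/-- Zero is not an eigenvalue: the equation `(-Δ)ˢ_A w + q w = 0` in `Ω` has only the trivial weak
solution `w ∈ H̃ˢ(Ω)`. -/
def ZeroNotEigenvalue (n : ℕ) (s : ℝ) (Ω : Set (Rn n)) (A : Rn n × Rn n → Cn n)
    (q : Rn n → ℝ) : Prop :=
  ∀ w ∈ HsTilde n s Ω, (∀ v ∈ HsTilde n s Ω, bform A q w v = 0) → w = 0

/-- `u` solves `(-Δ)ˢ_A u + q u = 0` in `Ω` (weakly) with exterior value `f`. -/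
def IsSolution {n : ℕ} {s : ℝ} (Ω : Set (Rn n)) (A : Rn n × Rn n → Cn n) (q : Rn n → ℝ)
    (f u : Hs n s) : Prop :=
  u - f ∈ HsTilde n s Ω ∧ ∀ v ∈ HsTilde n s Ω, bform A q u v = 0

/-- `Λ : X → X*` satisfies `⟨Λ[f],[g]⟩ = B^s_{A,q}[u_f,g]` for all `f, g ∈ Hˢ(ℝⁿ)`, where `u_f`
solves the equation with exterior value `f`. Here `X*` is the normed dual of `X`. -/
def IsDNMap {n : ℕ} {s : ℝ} (Ω : Set (Rn n)) (A : Rn n × Rn n → Cn n) (q : Rn n → ℝ)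
    (Λ : Trace n s Ω →L[ℂ] Trace n s Ω →L[ℂ] ℂ) : Prop :=
  ∀ f g u : Hs n s, IsSolution Ω A q f u → Λ (Trace.mk Ω f) (Trace.mk Ω g) = bform A q u g

/-- The locally integrable function `d` represents the distribution `(∇·)ˢ v`, the adjoint of the
fractional gradient applied to `v`. -/
def IsFracDiv (n : ℕ) (s : ℝ) (v : Rn n × Rn n → Cn n) (d : Rn n → ℂ) : Prop :=
  LocallyIntegrable d volume ∧ ∀ φ : Rn n → ℂ, IsTest Set.univ φ →
    ∫ x, d x * φ x = ∫ z : Rn n × Rn n, dot (v z) (fracGrad n s φ z)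

open Classical in
/-- The fractional divergence `(∇·)ˢ v` when it is a locally integrable function (which is then
unique almost everywhere). -/
def fracDiv (n : ℕ) (s : ℝ) (v : Rn n × Rn n → Cn n) : Rn n → ℂ :=
  if h : ∃ d, IsFracDiv n s v d then h.choose else 0

/-- `Q(x) = q(x) + ∫ A(x,y)·A(x,y) dy + (∇·)ˢ A_{s∥}(x)`. -/
def bigQ (n : ℕ) (s : ℝ) (A : Rn n × Rn n → Cn n) (q : Rn n → ℝ) (x : Rn n) : ℂ :=
  (q x : ℂ) + (∫ y, dot (A (x, y)) (A (x, y))) + fracDiv n s (parPart (symPart A)) x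

end

end FracMag

/-! Part (1) is a Fredholm argument for a symmetric form, and part (2) an integral identity for that
form. Both rest on one Fourier computation. With h = y - x, Plancherel in x turns ‖∇ˢu‖² into ∫
m(ξ)|û(ξ)|² dξ, where m is `gradSymbol`. Scaling shows m ≤ C(1 + |2πξ|²)ˢ and c(1 + |2πξ|²)ˢ ≤ 1 + m
(`exists_gradSymbol_le`, `exists_le_gradSymbol`, `lintegral_fracGrad_sq`). So ∇ˢ is bounded from Hˢ
to L², and the L² norm together with the Gagliardo seminorm controls the Hˢ norm.

The critical Sobolev inequality gives Hˢ ⊆ L^{2p'}, with p' conjugate to p. Hence L^p functions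
define bounded forms on Hˢ, and cutting off their large values makes the relative bound arbitrarily
small (`Hs.exists_lintegral_mul_sq_le`). Since (𝒥₁A)² and (𝒥₂A)² lie in L^p, multiplication by A is
bounded from Hˢ to L² in either variable, and u(x)A is a small perturbation of ∇ˢu.

For (1), testing the bilinear form with the complex conjugate of u recovers ‖∇ˢu‖² and yields a
Gårding inequality (`exists_garding`). The L² remainder is weakly continuous on H̃ˢ(Ω) by a Rellich
argument (`HsTilde.tendsto_norm_incl`). Since zero is not an eigenvalue, the form is bounded below;
symmetry then makes it invertible on H̃ˢ(Ω) (`exists_le_norm_form`, `surjective_form`). The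
resulting solution operator P is bounded. B(Pf, g) vanishes when f or g lies in H̃ˢ(Ω), so it
descends to the quotient, and B(Pf, g) = B(Pf, Pg) is symmetric.

For (2), expand the form (`bform_eq`). The gradient sees only the parallel part of A. After swapping
x and y, the two symmetric cross terms combine by the product rule into the fractional divergence
tested with uv; the two antisymmetric ones are equal. The divergence is an L^p function because ∇ˢ
maps H^{s-t}(ℝⁿ) to H^{-t}(ℝ²ⁿ): by duality with t = sp - s, the divergence of an Hᵗ field lies in
H^{s(p-2)} ⊆ L^p (`exists_enorm_integral_dot_sq_le`, `exists_divergence`). The two forms at (u₁, u₂)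
have the same pure gradient term, so their difference is the asserted identity (`alessandrini`). -/

namespace FracMag

/-! ### The L² Fourier transform: duality, agreement with the integral, translations. -/

section FourierL2

open SchwartzMap

variable {V F : Type*} [NormedAddCommGroup V] [InnerProductSpace ℝ V] [FiniteDimensional ℝ V]
  [MeasurableSpace V] [BorelSpace V] [NormedAddCommGroup F] [InnerProductSpace ℂ F]
  [CompleteSpace F]

lemma integral_smul_fourier_Lp (u : Lp F 2 (volume : Measure V)) (φ : 𝓢(V, ℂ)) :
    ∫ x, φ x • (𝓕 u : Lp F 2 (volume : Measure V)) x = ∫ x, (𝓕 (φ : V → ℂ)) x • u x := by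
  have h := DFunLike.congr_fun (Lp.fourier_toTemperedDistribution_eq u) φ
  rw [TemperedDistribution.fourier_apply, Lp.toTemperedDistribution_apply,
    Lp.toTemperedDistribution_apply] at h
  exact h.symm

lemma integral_smul_fourierInv_Lp (u : Lp F 2 (volume : Measure V)) (φ : 𝓢(V, ℂ)) :
    ∫ x, φ x • (𝓕⁻ u : Lp F 2 (volume : Measure V)) x = ∫ x, (𝓕⁻ (φ : V → ℂ)) x • u x := by
  have h := DFunLike.congr_fun (Lp.fourierInv_toTemperedDistribution_eq u) φ
  rw [TemperedDistribution.fourierInv_apply, Lp.toTemperedDistribution_apply,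
    Lp.toTemperedDistribution_apply] at h
  rw [← SchwartzMap.fourierInv_coe]
  exact h.symm

/-- Two locally integrable functions with the same integrals against Schwartz functions agree
almost everywhere. -/
lemma ae_eq_of_integral_schwartz_smul_eq {f g : V → F} (hf : LocallyIntegrable f volume)
    (hg : LocallyIntegrable g volume)
    (h : ∀ φ : 𝓢(V, ℂ), ∫ x, φ x • f x = ∫ x, φ x • g x) : f =ᵐ[volume] g := by
  refine ae_eq_of_integral_contDiff_smul_eq hf hg fun φ hφ hc => ?_
  have hc' : HasCompactSupport fun x => (φ x : ℂ) := hc.comp_left Complex.ofReal_zero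
  have := h (hc'.toSchwartzMap (Complex.ofRealCLM.contDiff.comp hφ))
  have e : ∀ x, hc'.toSchwartzMap (Complex.ofRealCLM.contDiff.comp hφ) x = (φ x : ℂ) :=
    fun _ => rfl
  simp only [e, Complex.coe_smul] at this
  exact this

/-- On `L¹ ∩ L²` the `L²` Fourier transform is the Fourier integral. -/
lemma fourier_toLp_ae_eq {f : V → F} (h1 : Integrable f volume) (h2 : MemLp f 2 volume) :
    (𝓕 (h2.toLp f) : Lp F 2 (volume : Measure V)) =ᵐ[volume] 𝓕 f := by
  have hcont : Continuous (𝓕 f) :=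
    VectorFourier.fourierIntegral_continuous Real.continuous_fourierChar
      (by exact continuous_inner) h1
  refine ae_eq_of_integral_schwartz_smul_eq
    ((Lp.memLp _).locallyIntegrable one_le_two) hcont.locallyIntegrable fun φ => ?_
  rw [integral_smul_fourier_Lp]
  have h3 := VectorFourier.integral_fourierIntegral_smul_eq_flip (μ := volume) (ν := volume)
    (L := innerₗ V) (f := (φ : V → ℂ)) (g := f) Real.continuous_fourierChar
    (by exact continuous_inner) φ.integrable h1
  rw [flip_innerₗ] at h3
  refine Eq.trans (integral_congr_ae ?_) h3
  filter_upwards [h2.coeFn_toLp] with x hx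
  rw [hx]
  rfl

lemma fourierInv_toLp_ae_eq {f : V → F} (h1 : Integrable f volume) (h2 : MemLp f 2 volume) :
    (𝓕⁻ (h2.toLp f) : Lp F 2 (volume : Measure V)) =ᵐ[volume] 𝓕⁻ f := by
  have hcont : Continuous (𝓕⁻ f) :=
    VectorFourier.fourierIntegral_continuous Real.continuous_fourierChar
      (by exact continuous_inner.neg) h1
  refine ae_eq_of_integral_schwartz_smul_eq
    ((Lp.memLp _).locallyIntegrable one_le_two) hcont.locallyIntegrable fun φ => ?_
  rw [integral_smul_fourierInv_Lp]
  have h3 := VectorFourier.integral_fourierIntegral_smul_eq_flip (μ := volume) (ν := volume)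
    (L := -innerₗ V) (f := (φ : V → ℂ)) (g := f) Real.continuous_fourierChar
    (by exact continuous_inner.neg) φ.integrable h1
  have h4 : (-innerₗ V).flip = -innerₗ V := by
    ext x y; simp [real_inner_comm]
  rw [h4] at h3
  refine Eq.trans (integral_congr_ae ?_) h3
  filter_upwards [h2.coeFn_toLp] with x hx
  rw [hx]
  rfl

/-- Multiplication by the character `ξ ↦ e^{2πi⟨ξ,h⟩}` turns into translation. -/
lemma fourier_char_mul (φ : V → ℂ) (h x : V) :
    𝓕 (fun ξ => (Real.fourierChar (inner ℝ ξ h) : ℂ) * φ ξ) x = 𝓕 φ (x - h) := by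
  rw [Real.fourier_eq, Real.fourier_eq]
  refine integral_congr_ae (Eventually.of_forall fun ξ => ?_)
  simp only [Circle.smul_def, smul_eq_mul, ← mul_assoc]
  rw [← Circle.coe_mul, ← AddChar.map_add_eq_mul, inner_sub_right]
  congr 3
  ring

omit [InnerProductSpace ℂ F] [CompleteSpace F] in
lemma memLp_comp_add_right {f : V → F} (hf : MemLp f 2 volume) (h : V) :
    MemLp (fun x => f (x + h)) 2 volume :=
  hf.comp_measurePreserving (measurePreserving_add_right volume h)

lemma continuous_star_Lp : Continuous (star : Lp ℂ 2 (volume : Measure V) → Lp ℂ 2 volume) := by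
  refine (LipschitzWith.of_dist_le_mul (K := 1) fun a b => ?_).continuous
  have e : star a - star b = star (a - b) := by
    refine Lp.ext ?_
    filter_upwards [Lp.coeFn_star (a - b), Lp.coeFn_star a, Lp.coeFn_star b,
      Lp.coeFn_sub (star a) (star b), Lp.coeFn_sub a b] with x h1 h2 h3 h4 h5
    rw [h4, h1, Pi.sub_apply, h2, h3, Pi.star_apply, Pi.star_apply, Pi.star_apply, h5,
      Pi.sub_apply, star_sub]
  rw [NNReal.coe_one, one_mul, dist_eq_norm, dist_eq_norm, e, Lp.norm_def, Lp.norm_def]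
  refine le_of_eq (congrArg _ (eLpNorm_congr_norm_ae ?_))
  filter_upwards [Lp.coeFn_star (a - b)] with x hx
  simp [hx]

/-- Writing the bilinear pairing as an inner product with `star` makes both sides continuous in `v`,
so Schwartz `v` suffice, where the identity is the distributional definition of the transform. -/
lemma integral_fourier_mul_Lp (u v : Lp ℂ 2 (volume : Measure V)) :
    ∫ x, (𝓕 v : Lp ℂ 2 (volume : Measure V)) x * u x
      = ∫ x, v x * (𝓕 u : Lp ℂ 2 (volume : Measure V)) x := by
  have key : ∀ a b : Lp ℂ 2 (volume : Measure V), ∫ x, a x * b x =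
      (inner ℂ (star a) b : ℂ) := by
    intro a b
    rw [L2.inner_def]
    refine integral_congr_ae ?_
    filter_upwards [Lp.coeFn_star a] with x hx
    simp [hx, mul_comm]
  simp only [key]
  refine DenseRange.induction_on (SchwartzMap.denseRange_toLpCLM (E := V) (F := ℂ) (p := 2)
    (μ := volume) ENNReal.ofNat_ne_top) v (isClosed_eq ?_ ?_) fun φ => ?_
  · exact ((continuous_star_Lp.comp (Lp.fourierTransformₗᵢ V ℂ).continuous)).inner continuous_const
  · exact continuous_star_Lp.inner continuous_const
  · rw [← key, ← key]
    have := integral_smul_fourier_Lp u φ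
    simp only [smul_eq_mul] at this
    rw [SchwartzMap.toLpCLM_apply, SchwartzMap.toLp_fourier_eq]
    refine (integral_congr_ae ?_).trans (this.symm.trans (integral_congr_ae ?_))
    · filter_upwards [(𝓕 φ).coeFn_toLp 2] with x hx
      rw [hx]; rfl
    · filter_upwards [φ.coeFn_toLp 2] with x hx
      rw [hx]

/-- The Fourier transform of a translate. -/
lemma fourier_translate {f : V → ℂ} (hf : MemLp f 2 volume) (h : V) :
    (𝓕 ((memLp_comp_add_right hf h).toLp _) : Lp ℂ 2 (volume : Measure V)) =ᵐ[volume]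
      fun ξ => (Real.fourierChar (inner ℝ ξ h) : ℂ) *
        (𝓕 (hf.toLp f) : Lp ℂ 2 (volume : Measure V)) ξ := by
  have hbd : ∀ ξ : V, ‖(Real.fourierChar (inner ℝ ξ h) : ℂ)‖ = 1 := fun ξ => Circle.norm_coe _
  have hc : Continuous fun ξ : V => (Real.fourierChar (inner ℝ ξ h) : ℂ) :=
    continuous_subtype_val.comp (Real.continuous_fourierChar.comp (by fun_prop))
  have hmul : ∀ {g : V → ℂ} {p : ℝ≥0∞}, MemLp g p volume →
      MemLp (fun ξ => (Real.fourierChar (inner ℝ ξ h) : ℂ) * g ξ) p volume := fun hg =>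
    hg.of_le (hc.aestronglyMeasurable.mul hg.1) (Eventually.of_forall fun ξ => by
      rw [norm_mul, hbd, one_mul])
  refine ae_eq_of_integral_schwartz_smul_eq
    ((Lp.memLp _).locallyIntegrable one_le_two)
    ((hmul (Lp.memLp _)).locallyIntegrable one_le_two) fun φ => ?_
  have h2 : MemLp (fun ξ => (Real.fourierChar (inner ℝ ξ h) : ℂ) * φ ξ) 2 volume :=
    hmul (φ.memLp 2)
  have h1 : Integrable (fun ξ => (Real.fourierChar (inner ℝ ξ h) : ℂ) * φ ξ) volume :=
    memLp_one_iff_integrable.1 (hmul (φ.memLp 1))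
  -- Moved onto the test function, the character becomes a translation of 𝓕 φ, and a change of
  -- variables moves that translation onto `f`.
  have e1 := integral_fourier_mul_Lp (hf.toLp f) (h2.toLp _)
  rw [integral_smul_fourier_Lp]
  have e2 : ∫ x, (𝓕 (φ : V → ℂ)) x • ((memLp_comp_add_right hf h).toLp _) x =
      ∫ x, (𝓕 (φ : V → ℂ)) (x - h) * f x := by
    refine Eq.trans (integral_congr_ae ?_) (integral_add_right_eq_self (μ := volume)
      (fun x => (𝓕 (φ : V → ℂ)) (x - h) * f x) h)
    filter_upwards [(memLp_comp_add_right hf h).coeFn_toLp] with x hx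
    rw [hx, smul_eq_mul, add_sub_cancel_right]
  rw [e2]
  refine Eq.trans (integral_congr_ae ?_) (e1.trans (integral_congr_ae ?_))
  · filter_upwards [fourier_toLp_ae_eq h1 h2, hf.coeFn_toLp] with x hx hx2
    rw [hx, hx2, fourier_char_mul]
  · filter_upwards [h2.coeFn_toLp] with x hx
    rw [hx, smul_eq_mul]
    ring

end FourierL2

end FracMag

namespace FracMag

noncomputable section

lemma eLpNorm_two_sq {X E : Type*} [MeasurableSpace X] [ENorm E] (μ : Measure X) (f : X → E) :
    eLpNorm f 2 μ ^ 2 = ∫⁻ x, ‖f x‖ₑ ^ 2 ∂μ := by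
  rw [eLpNorm_eq_lintegral_rpow_enorm_toReal (by norm_num) (by norm_num)]
  simp only [ENNReal.toReal_ofNat, ENNReal.rpow_ofNat]
  rw [← ENNReal.rpow_natCast, ← ENNReal.rpow_mul]
  norm_num

lemma memLp_two_iff_lintegral {X E : Type*} [MeasurableSpace X] [NormedAddCommGroup E]
    {μ : Measure X} {f : X → E} (hf : AEStronglyMeasurable f μ) :
    MemLp f 2 μ ↔ ∫⁻ x, ‖f x‖ₑ ^ 2 ∂μ < ⊤ := by
  rw [← eLpNorm_two_sq, ENNReal.pow_lt_top_iff]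
  simp [MemLp, hf]

/-! ### Two-sided bounds for the Fourier symbol of the fractional gradient. -/

section Multiplier

variable (n : ℕ) (s : ℝ)

/-- The vector kernel `h ↦ α(x, x + h)`. -/
def alphaV (h : Rn n) : Rn n :=
  (Real.sqrt (fracConst n s) / Real.sqrt 2 / ‖h‖ ^ ((n : ℝ) / 2 + s + 1)) • h

lemma alpha_eq (z : Rn n × Rn n) : alpha n s z = alphaV n s (z.2 - z.1) := rfl

lemma alphaV_neg (h : Rn n) : alphaV n s (-h) = -alphaV n s h := by
  simp [alphaV]

lemma measurable_alphaV : Measurable (alphaV n s) := by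
  unfold alphaV
  fun_prop

/-- The constant in front of the kernel `α`. -/
def gradConst : ℝ := Real.sqrt (fracConst n s) / Real.sqrt 2

variable {n s}

lemma gradConst_pos (hs0 : 0 < s) (hs1 : s < 1) : 0 < gradConst n s := by
  have h1 : Real.Gamma (-s) ≠ 0 := by
    refine Real.Gamma_ne_zero fun m hm => ?_
    have hm' : s = m := neg_inj.1 hm
    rcases m with _ | m
    · simp at hm'; linarith
    · push_cast at hm'
      have : (0 : ℝ) ≤ m := Nat.cast_nonneg m
      linarith
  have h2 : 0 < Real.Gamma (n / 2 + s) := Real.Gamma_pos_of_pos (by positivity)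
  have h3 : 0 < fracConst n s := by
    unfold fracConst
    have := abs_pos.2 h1
    positivity
  unfold gradConst
  positivity

lemma gradConst_nonneg : 0 ≤ gradConst n s := by unfold gradConst; positivity

lemma norm_alphaV {h : Rn n} (hh : h ≠ 0) :
    ‖alphaV n s h‖ = gradConst n s * ‖h‖ ^ (-((n : ℝ) / 2 + s)) := by
  have h0 : 0 < ‖h‖ := norm_pos_iff.2 hh
  rw [alphaV, norm_smul, ← gradConst, Real.norm_eq_abs,
    abs_of_nonneg (div_nonneg gradConst_nonneg (by positivity)), div_mul_eq_mul_div, mul_div_assoc]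
  congr 1
  rw [Real.rpow_neg h0.le, Real.rpow_add h0, Real.rpow_one]
  field_simp

lemma norm_alphaV_sq {h : Rn n} (hh : h ≠ 0) :
    ‖alphaV n s h‖ ^ 2 = gradConst n s ^ 2 * ‖h‖ ^ (-((n : ℝ) + 2 * s)) := by
  rw [norm_alphaV hh, mul_pow, ← Real.rpow_mul_natCast (norm_nonneg h)]
  congr 2
  push_cast
  ring

/-- The quadratic Fourier symbol of the fractional gradient. -/
def gradSymbol (n : ℕ) (s : ℝ) (ξ : Rn n) : ℝ≥0∞ :=
  ∫⁻ h : Rn n, ‖alphaV n s h‖ₑ ^ 2 * ‖(Real.fourierChar (inner ℝ ξ h) : ℂ) - 1‖ₑ ^ 2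

lemma norm_fourierChar_sub_one_le (t : ℝ) :
    ‖(Real.fourierChar t : ℂ) - 1‖ ^ 2 ≤ min 4 ((2 * Real.pi * t) ^ 2) := by
  refine le_min ?_ ?_
  · have h1 : ‖(Real.fourierChar t : ℂ) - 1‖ ≤ 2 := by
      refine (norm_sub_le _ _).trans ?_
      rw [Circle.norm_coe, norm_one]
      norm_num
    nlinarith [norm_nonneg ((Real.fourierChar t : ℂ) - 1)]
  · rw [Real.fourierChar_apply, mul_comm _ Complex.I, ← sq_abs (2 * Real.pi * t)]
    exact pow_le_pow_left₀ (norm_nonneg _) Real.norm_exp_I_mul_ofReal_sub_one_le 2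

/-- The square equals 2 - 2 cos(2πt), and the cosine is nonpositive within 1/4 of t = 1/2. -/
lemma two_le_norm_fourierChar_sub_one {t : ℝ} (ht : |t - 1 / 2| ≤ 1 / 4) :
    2 ≤ ‖(Real.fourierChar t : ℂ) - 1‖ ^ 2 := by
  rw [abs_le] at ht
  have hpi := Real.pi_pos
  have h1 : 0 ≤ Real.cos (2 * Real.pi * t - Real.pi) :=
    Real.cos_nonneg_of_mem_Icc ⟨by nlinarith, by nlinarith⟩
  rw [Real.cos_sub_pi] at h1
  rw [Real.fourierChar_apply, Complex.sq_norm, Complex.normSq_apply]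
  simp only [Complex.sub_re, Complex.sub_im, Complex.one_re, Complex.one_im,
    Complex.exp_ofReal_mul_I_re, Complex.exp_ofReal_mul_I_im]
  nlinarith [Real.sin_sq_add_cos_sq (2 * Real.pi * t)]

/-- In polar coordinates the integrand is r^{-1-2s} min(4, (2πr)²). It behaves like r^{1-2s} near
zero, integrable because s < 1, and like r^{-1-2s} at infinity, integrable because s > 0. -/
lemma integrable_gradSymbol_bound (hn : 1 ≤ n) (hs0 : 0 < s) (hs1 : s < 1) :
    Integrable (fun h : Rn n =>
      ‖h‖ ^ (-((n : ℝ) + 2 * s)) * min 4 ((2 * Real.pi * ‖h‖) ^ 2)) volume := by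
  have : Nonempty (Fin n) := ⟨⟨0, hn⟩⟩
  rw [integrable_fun_norm_addHaar volume
    (f := fun r : ℝ => r ^ (-((n : ℝ) + 2 * s)) * min 4 ((2 * Real.pi * r) ^ 2))]
  simp only [finrank_euclideanSpace, Fintype.card_fin, smul_eq_mul]
  have hmeas : Measurable fun y : ℝ =>
      y ^ (n - 1) * (y ^ (-((n : ℝ) + 2 * s)) * min 4 ((2 * Real.pi * y) ^ 2)) := by fun_prop
  have hpow : ∀ y : ℝ, 0 < y → y ^ (n - 1) = y ^ ((n : ℝ) - 1) := by
    intro y hy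
    rw [← Real.rpow_natCast, Nat.cast_sub hn, Nat.cast_one]
  have hval : ∀ y : ℝ, 0 < y → y ^ (n - 1) * (y ^ (-((n : ℝ) + 2 * s)) *
      min 4 ((2 * Real.pi * y) ^ 2)) = y ^ (-1 - 2 * s) * min 4 ((2 * Real.pi * y) ^ 2) := by
    intro y hy
    rw [hpow y hy, ← mul_assoc, ← Real.rpow_add hy]
    congr 2
    ring
  rw [← Set.Ioc_union_Ioi_eq_Ioi (zero_le_one (α := ℝ))]
  refine IntegrableOn.union ?_ ?_
  · have h1 : IntegrableOn (fun y : ℝ => y ^ (1 - 2 * s) * (2 * Real.pi) ^ 2) (Set.Ioc 0 1) := by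
      rw [integrableOn_Ioc_iff_integrableOn_Ioo]
      exact ((intervalIntegral.integrableOn_Ioo_rpow_iff one_pos).2 (by linarith)).mul_const _
    refine Integrable.mono' h1 hmeas.aestronglyMeasurable ?_
    refine (ae_restrict_mem measurableSet_Ioc).mono fun y hy => ?_
    have hy0 := hy.1
    rw [hval y hy0, Real.norm_of_nonneg (by positivity)]
    have e : y ^ (1 - 2 * s) = y ^ (-1 - 2 * s) * y ^ 2 := by
      rw [← Real.rpow_natCast y 2, ← Real.rpow_add hy0]
      congr 1; push_cast; ring
    rw [e]
    have h2 : min 4 ((2 * Real.pi * y) ^ 2) ≤ y ^ 2 * (2 * Real.pi) ^ 2 :=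
      (min_le_right _ _).trans (le_of_eq (by ring))
    have h3 : 0 ≤ y ^ (-1 - 2 * s) := by positivity
    exact (mul_le_mul_of_nonneg_left h2 h3).trans (le_of_eq (by ring))
  · have h1 : IntegrableOn (fun y : ℝ => y ^ (-1 - 2 * s) * 4) (Set.Ioi 1) :=
      by
      have h2 := integrableOn_Ioi_rpow_of_lt (a := -1 - 2 * s) (c := 1) (by linarith) (by norm_num)
      exact Integrable.mul_const h2 4
    refine Integrable.mono' h1 hmeas.aestronglyMeasurable ?_
    refine (ae_restrict_mem measurableSet_Ioi).mono fun y hy => ?_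
    have hy0 : 0 < y := (zero_lt_one (α := ℝ)).trans hy
    rw [hval y hy0, Real.norm_of_nonneg (by positivity)]
    exact mul_le_mul_of_nonneg_left (min_le_left _ _) (by positivity)

lemma lintegral_comp_smul_Rn {r : ℝ} (hr : 0 < r) {G : Rn n → ℝ≥0∞} (hG : Measurable G) :
    ∫⁻ h, G (r • h) = ENNReal.ofReal (r ^ (-(n : ℝ))) * ∫⁻ h, G h := by
  have h1 := Measure.map_addHaar_smul (volume : Measure (Rn n)) hr.ne'
  have h2 : ∫⁻ h, G (r • h) = ∫⁻ h, G h ∂(Measure.map (fun x => r • x) volume) := by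
    rw [lintegral_map hG (by fun_prop)]
  rw [h2, h1, lintegral_smul_measure, smul_eq_mul, finrank_euclideanSpace, Fintype.card_fin,
    abs_of_pos (by positivity), Real.rpow_neg hr.le, Real.rpow_natCast]

/-- The upper bound `m(ξ) ≤ C (1 + |2πξ|²)ˢ`. -/
lemma exists_gradSymbol_le (hn : 1 ≤ n) (hs0 : 0 < s) (hs1 : s < 1) :
    ∃ C : ℝ, 0 < C ∧ ∀ ξ : Rn n,
      gradSymbol n s ξ ≤ ENNReal.ofReal (C * (1 + (2 * Real.pi * ‖ξ‖) ^ 2) ^ s) := by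
  have hint := integrable_gradSymbol_bound hn hs0 hs1
  set g : Rn n → ℝ := fun h => ‖h‖ ^ (-((n : ℝ) + 2 * s)) * min 4 ((2 * Real.pi * ‖h‖) ^ 2)
    with hg
  have hg0 : ∀ h, 0 ≤ g h := fun h => by rw [hg]; positivity
  obtain ⟨I, hIdef⟩ : ∃ I : ℝ, I = ∫ h, g h := ⟨_, rfl⟩
  have hI : 0 ≤ I := hIdef ▸ integral_nonneg hg0
  refine ⟨gradConst n s ^ 2 * I + 1, by positivity, fun ξ => ?_⟩
  rcases eq_or_ne ξ 0 with rfl | hξ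
  · simp [gradSymbol]
  have hξ0 : 0 < ‖ξ‖ := norm_pos_iff.2 hξ
  -- The substitution h ↦ |ξ|h makes the dominating integral independent of ξ: the kernel
  -- contributes |ξ|^{n+2s} and the Jacobian |ξ|^{-n}, leaving |ξ|^{2s}.
  have h1 : gradSymbol n s ξ ≤ ∫⁻ h, ENNReal.ofReal
      (gradConst n s ^ 2 * ‖ξ‖ ^ ((n : ℝ) + 2 * s)) * ENNReal.ofReal (g (‖ξ‖ • h)) := by
    refine lintegral_mono fun h => ?_
    rcases eq_or_ne h 0 with rfl | hh
    · simp [alphaV]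
    have hh0 : 0 < ‖h‖ := norm_pos_iff.2 hh
    dsimp only
    rw [← ofReal_norm, ← ofReal_norm, ← ENNReal.ofReal_pow (norm_nonneg _),
      ← ENNReal.ofReal_pow (norm_nonneg _), ← ENNReal.ofReal_mul (by positivity),
      ← ENNReal.ofReal_mul (by positivity)]
    refine ENNReal.ofReal_le_ofReal ?_
    rw [norm_alphaV_sq hh, mul_assoc, mul_assoc]
    refine mul_le_mul_of_nonneg_left ?_ (by positivity)
    rw [hg]
    simp only [norm_smul, norm_norm]
    rw [Real.mul_rpow hξ0.le hh0.le, ← mul_assoc, ← mul_assoc, ← Real.rpow_add hξ0,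
      add_neg_cancel, Real.rpow_zero, one_mul]
    refine mul_le_mul_of_nonneg_left ?_ (by positivity)
    refine (norm_fourierChar_sub_one_le _).trans (min_le_min_left _ ?_)
    rw [mul_pow, mul_pow (2 * Real.pi)]
    refine mul_le_mul_of_nonneg_left ?_ (by positivity)
    rw [← sq_abs]
    exact pow_le_pow_left₀ (abs_nonneg _) (abs_real_inner_le_norm _ _) 2
  refine h1.trans ?_
  have hgm : Measurable fun h => ENNReal.ofReal (g h) := by rw [hg]; fun_prop
  have hgm' : Measurable fun h => ENNReal.ofReal (g (‖ξ‖ • h)) :=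
    hgm.comp (measurable_const_smul _)
  rw [lintegral_const_mul _ hgm',
    lintegral_comp_smul_Rn hξ0 hgm, ← ofReal_integral_eq_lintegral_ofReal hint
      (Eventually.of_forall hg0), ← ENNReal.ofReal_mul (by positivity),
      ← ENNReal.ofReal_mul (by positivity)]
  refine ENNReal.ofReal_le_ofReal ?_
  rw [← hIdef]
  have e : ‖ξ‖ ^ ((n : ℝ) + 2 * s) * ‖ξ‖ ^ (-(n : ℝ)) = (‖ξ‖ ^ 2) ^ s := by
    rw [← Real.rpow_add hξ0, ← Real.rpow_natCast, ← Real.rpow_mul hξ0.le]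
    congr 1; push_cast; ring
  have h2 : (1 : ℝ) ≤ (2 * Real.pi) ^ 2 := one_le_pow₀ (by linarith [Real.pi_gt_three])
  have h3 : ‖ξ‖ ^ 2 ≤ 1 + (2 * Real.pi * ‖ξ‖) ^ 2 := by
    have h3 := mul_le_mul_of_nonneg_right h2 (sq_nonneg ‖ξ‖)
    rw [mul_pow]
    linarith
  have h4 : (‖ξ‖ ^ 2) ^ s ≤ (1 + (2 * Real.pi * ‖ξ‖) ^ 2) ^ s :=
    Real.rpow_le_rpow (by positivity) h3 hs0.le
  calc gradConst n s ^ 2 * ‖ξ‖ ^ ((n : ℝ) + 2 * s) * (‖ξ‖ ^ (-(n : ℝ)) * I)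
      = gradConst n s ^ 2 * I * (‖ξ‖ ^ 2) ^ s := by rw [← e]; ring
    _ ≤ gradConst n s ^ 2 * I * (1 + (2 * Real.pi * ‖ξ‖) ^ 2) ^ s := by gcongr
    _ ≤ (gradConst n s ^ 2 * I + 1) * (1 + (2 * Real.pi * ‖ξ‖) ^ 2) ^ s := by
        gcongr
        linarith

/-- The lower bound `c (1 + |2πξ|²)ˢ ≤ 1 + m(ξ)`. -/
lemma exists_le_gradSymbol (hn : 1 ≤ n) (hs0 : 0 < s) (hs1 : s < 1) :
    ∃ c : ℝ, 0 < c ∧ ∀ ξ : Rn n,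
      ENNReal.ofReal (c * (1 + (2 * Real.pi * ‖ξ‖) ^ 2) ^ s) ≤ 1 + gradSymbol n s ξ := by
  have : Nonempty (Fin n) := ⟨⟨0, hn⟩⟩
  set v : ℝ := (volume (Metric.ball (0 : Rn n) 1)).toReal with hv
  have hvtop : volume (Metric.ball (0 : Rn n) 1) ≠ ⊤ := measure_ball_lt_top.ne
  have hv0 : 0 < v := ENNReal.toReal_pos (Metric.measure_ball_pos _ _ one_pos).ne' hvtop
  have hg := gradConst_pos (n := n) hs0 hs1
  set c' : ℝ := gradConst n s ^ 2 * 2 * ((1 / 8) ^ n * v) with hc'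
  have hc'0 : 0 < c' := by positivity
  have hK : 0 < (2 * Real.pi) ^ (2 * s) := by positivity
  have key : ∀ ξ : Rn n, ξ ≠ 0 → ENNReal.ofReal (c' * ‖ξ‖ ^ (2 * s)) ≤ gradSymbol n s ξ := by
    intro ξ hξ
    have hξ0 : 0 < ‖ξ‖ := norm_pos_iff.2 hξ
    -- The centre satisfies ⟨ξ, h₀⟩ = 1/2. Within distance 1/(8|ξ|) of it the phase stays within 1/8
    -- of 1/2, and |h| ≤ 1/|ξ|. The squared kernel there is at least a multiple of |ξ|^{n+2s}, while
    -- the volume of the ball is a multiple of |ξ|^{-n}.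
    set h₀ : Rn n := (1 / (2 * ‖ξ‖ ^ 2)) • ξ with hh₀
    set ρ : ℝ := 1 / (8 * ‖ξ‖) with hρ
    have hρ0 : 0 < ρ := by positivity
    have hle : ∀ h ∈ Metric.ball h₀ ρ, ENNReal.ofReal
        (gradConst n s ^ 2 * ‖ξ‖ ^ ((n : ℝ) + 2 * s) * 2) ≤
        ‖alphaV n s h‖ₑ ^ 2 * ‖(Real.fourierChar (inner ℝ ξ h) : ℂ) - 1‖ₑ ^ 2 := by
      intro h hh
      rw [mem_ball_iff_norm] at hh
      have hin : |inner ℝ ξ h - 1 / 2| ≤ 1 / 8 := by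
        have e1 : inner ℝ ξ h₀ = (1 / 2 : ℝ) := by
          rw [hh₀, inner_smul_right, real_inner_self_eq_norm_sq]
          field_simp
        rw [← e1, ← inner_sub_right]
        refine (abs_real_inner_le_norm _ _).trans ?_
        have := mul_le_mul_of_nonneg_left hh.le hξ0.le
        refine this.trans (le_of_eq ?_)
        rw [hρ]; field_simp
      have hne : h ≠ 0 := by
        rintro rfl
        rw [inner_zero_right, abs_le] at hin
        norm_num at hin
      have hh0 : 0 < ‖h‖ := norm_pos_iff.2 hne
      have hnorm : ‖h‖ ≤ ‖ξ‖⁻¹ := by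
        have e1 : ‖h₀‖ = 1 / (2 * ‖ξ‖) := by
          rw [hh₀, norm_smul, Real.norm_of_nonneg (by positivity)]
          field_simp
        have e2 : ‖h‖ ≤ ‖h₀‖ + ‖h - h₀‖ := norm_le_norm_add_norm_sub' _ _
        have e3 : ‖h₀‖ + ρ ≤ ‖ξ‖⁻¹ := by
          rw [e1, hρ]
          field_simp
          norm_num
        linarith
      rw [← ofReal_norm, ← ofReal_norm, ← ENNReal.ofReal_pow (norm_nonneg _),
        ← ENNReal.ofReal_pow (norm_nonneg _), ← ENNReal.ofReal_mul (by positivity)]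
      refine ENNReal.ofReal_le_ofReal ?_
      refine mul_le_mul ?_ (two_le_norm_fourierChar_sub_one (hin.trans (by norm_num)))
        (by positivity) (by positivity)
      rw [norm_alphaV_sq hne]
      refine mul_le_mul_of_nonneg_left ?_ (by positivity)
      have := Real.rpow_le_rpow_of_nonpos hh0 hnorm
        (by have : (0 : ℝ) ≤ n := Nat.cast_nonneg n
            linarith : -((n : ℝ) + 2 * s) ≤ 0)
      refine le_trans (le_of_eq ?_) this
      rw [Real.inv_rpow hξ0.le, Real.rpow_neg hξ0.le, inv_inv]
    calc ENNReal.ofReal (c' * ‖ξ‖ ^ (2 * s))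
        = ENNReal.ofReal (gradConst n s ^ 2 * ‖ξ‖ ^ ((n : ℝ) + 2 * s) * 2) *
            volume (Metric.ball h₀ ρ) := by
          rw [Measure.addHaar_ball _ _ hρ0.le, finrank_euclideanSpace, Fintype.card_fin,
            ← ENNReal.ofReal_toReal hvtop, ← hv, ← ENNReal.ofReal_mul (by positivity),
            ← ENNReal.ofReal_mul (by positivity), hc']
          congr 1
          have e : ‖ξ‖ ^ (2 * s) = ‖ξ‖ ^ ((n : ℝ) + 2 * s) * (1 / ‖ξ‖) ^ n := by
            rw [Real.rpow_add hξ0, Real.rpow_natCast, one_div, inv_pow]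
            field_simp
          have e2 : ρ ^ n = (1 / 8) ^ n * (1 / ‖ξ‖) ^ n := by
            rw [hρ, ← mul_pow]; congr 1; field_simp
          rw [e, e2]
          ring
      _ = ∫⁻ _ in Metric.ball h₀ ρ, ENNReal.ofReal
            (gradConst n s ^ 2 * ‖ξ‖ ^ ((n : ℝ) + 2 * s) * 2) := by
          rw [setLIntegral_const]
      _ ≤ ∫⁻ h in Metric.ball h₀ ρ, ‖alphaV n s h‖ₑ ^ 2 *
            ‖(Real.fourierChar (inner ℝ ξ h) : ℂ) - 1‖ₑ ^ 2 :=
          setLIntegral_mono' measurableSet_ball hle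
      _ ≤ gradSymbol n s ξ := setLIntegral_le_lintegral _ _
  -- As s ≤ 1, (1 + x)ˢ ≤ 1 + xˢ. The first entry of the minimum absorbs the summand 1, the second
  -- absorbs (2π|ξ|)^{2s}.
  refine ⟨min 1 (c' / (2 * Real.pi) ^ (2 * s)), by positivity, fun ξ => ?_⟩
  set c : ℝ := min 1 (c' / (2 * Real.pi) ^ (2 * s)) with hc
  have hc0 : 0 < c := by positivity
  have h1 : (1 + (2 * Real.pi * ‖ξ‖) ^ 2) ^ s ≤
      1 + (2 * Real.pi) ^ (2 * s) * ‖ξ‖ ^ (2 * s) := by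
    refine (Real.rpow_add_le_add_rpow zero_le_one (by positivity) hs0.le hs1.le).trans ?_
    rw [Real.one_rpow, ← Real.rpow_natCast, ← Real.rpow_mul (by positivity),
      Real.mul_rpow (by positivity) (norm_nonneg _)]
    push_cast
    exact le_rfl
  have h2 : c * (1 + (2 * Real.pi * ‖ξ‖) ^ 2) ^ s ≤ 1 + c' * ‖ξ‖ ^ (2 * s) := by
    refine (mul_le_mul_of_nonneg_left h1 hc0.le).trans ?_
    rw [mul_add, mul_one]
    refine add_le_add (min_le_left _ _) ?_
    have h3 : c * (2 * Real.pi) ^ (2 * s) ≤ c' := by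
      rw [← le_div_iff₀ hK]; exact min_le_right _ _
    rw [← mul_assoc]
    exact mul_le_mul_of_nonneg_right h3 (by positivity)
  refine (ENNReal.ofReal_le_ofReal h2).trans ?_
  rw [ENNReal.ofReal_add zero_le_one (by positivity), ENNReal.ofReal_one]
  refine add_le_add le_rfl ?_
  rcases eq_or_ne ξ 0 with rfl | hξ
  · rw [norm_zero, Real.zero_rpow (by positivity), mul_zero, ENNReal.ofReal_zero]
    exact zero_le
  · exact key ξ hξ

end Multiplier

end

end FracMag

/-! ### The Gagliardo seminorm as a Fourier integral. -/

namespace FracMag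

noncomputable section

lemma lintegral_fourier_sq {V F : Type*} [NormedAddCommGroup V] [InnerProductSpace ℝ V]
    [FiniteDimensional ℝ V] [MeasurableSpace V] [BorelSpace V] [NormedAddCommGroup F]
    [InnerProductSpace ℂ F] [CompleteSpace F] (u : Lp F 2 (volume : Measure V)) :
    ∫⁻ ξ, ‖(𝓕 u : Lp F 2 (volume : Measure V)) ξ‖ₑ ^ 2 = ∫⁻ x, ‖u x‖ₑ ^ 2 := by
  rw [← eLpNorm_two_sq, ← eLpNorm_two_sq, ← Lp.enorm_def, ← Lp.enorm_def, ← ofReal_norm,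
    ← ofReal_norm, Lp.norm_fourier_eq]

variable {n : ℕ} {s : ℝ}

lemma enorm_toCn (x : Rn n) : ‖toCn x‖ₑ = ‖x‖ₑ := by
  rw [← ofReal_norm, ← ofReal_norm]
  simp [toCn, EuclideanSpace.norm_eq]

lemma enorm_fracGrad (u : Rn n → ℂ) (z : Rn n × Rn n) :
    ‖fracGrad n s u z‖ₑ = ‖u z.1 - u z.2‖ₑ * ‖alphaV n s (z.2 - z.1)‖ₑ := by
  rw [fracGrad, enorm_smul, enorm_toCn, alpha_eq]

lemma continuous_toCn : Continuous (toCn : Rn n → Cn n) := by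
  unfold toCn
  fun_prop

lemma aestronglyMeasurable_fracGrad {u : Rn n → ℂ} (hu : AEStronglyMeasurable u volume) :
    AEStronglyMeasurable (fracGrad n s u) volume := by
  refine AEStronglyMeasurable.smul (𝕜 := ℂ) (hu.comp_fst.sub hu.comp_snd) ?_
  refine (continuous_toCn.measurable.comp ?_).aestronglyMeasurable
  exact (measurable_alphaV n s).comp (measurable_snd.sub measurable_fst)

/-- Plancherel: translating by h multiplies the transform by e^{2πi⟨ξ,h⟩}. -/
lemma lintegral_sub_translate_sq {f : Rn n → ℂ} (hf : MemLp f 2 volume) (h : Rn n) :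
    ∫⁻ x, ‖f x - f (x + h)‖ₑ ^ 2 = ∫⁻ ξ, ‖(Real.fourierChar (inner ℝ ξ h) : ℂ) - 1‖ₑ ^ 2 *
      ‖(𝓕 (hf.toLp f) : Lp ℂ 2 (volume : Measure (Rn n))) ξ‖ₑ ^ 2 := by
  set g := (memLp_comp_add_right hf h).toLp _
  have e1 : ∫⁻ x, ‖f x - f (x + h)‖ₑ ^ 2 = ∫⁻ x, ‖(g - hf.toLp f) x‖ₑ ^ 2 := by
    refine lintegral_congr_ae ?_
    filter_upwards [Lp.coeFn_sub g (hf.toLp f), hf.coeFn_toLp,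
      (memLp_comp_add_right hf h).coeFn_toLp] with x h1 h2 h3
    rw [h1, Pi.sub_apply, h2, h3, ← enorm_neg, neg_sub]
  rw [e1, ← lintegral_fourier_sq]
  refine lintegral_congr_ae ?_
  have e2 : (𝓕 (g - hf.toLp f) : Lp ℂ 2 (volume : Measure (Rn n))) = 𝓕 g - 𝓕 (hf.toLp f) :=
    (Lp.fourierTransformₗᵢ (Rn n) ℂ).map_sub g (hf.toLp f)
  rw [e2]
  filter_upwards [Lp.coeFn_sub (𝓕 g : Lp ℂ 2 (volume : Measure (Rn n))) (𝓕 (hf.toLp f)),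
    fourier_translate hf h] with ξ h1 h2
  rw [h1, Pi.sub_apply, h2, ← mul_pow, ← enorm_mul, sub_mul, one_mul]

/-- The shear (x, h) ↦ (x, x + h) preserves volume. The difference h is kept as the outer variable,
so that Plancherel applies in x for each fixed h. -/
lemma lintegral_shear {Φ : Rn n × Rn n → ℝ≥0∞} (hm : AEMeasurable Φ volume) :
    ∫⁻ z, Φ z = ∫⁻ h : Rn n, ∫⁻ x : Rn n, Φ (x, x + h) := by
  have hmp : MeasurePreserving (fun z : Rn n × Rn n => (z.1, z.1 + z.2)) volume volume :=
    measurePreserving_prod_add volume volume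
  have hm' : AEMeasurable (fun z : Rn n × Rn n => Φ (z.1, z.1 + z.2)) volume :=
    hm.comp_quasiMeasurePreserving hmp.quasiMeasurePreserving
  conv_lhs => rw [← hmp.map_eq]
  rw [lintegral_map' (by rwa [hmp.map_eq]) hmp.measurable.aemeasurable]
  exact lintegral_prod_symm _ hm'

lemma measurable_enorm_fourierChar_sub_one : Measurable fun p : Rn n × Rn n =>
    ‖(Real.fourierChar (inner ℝ p.1 p.2) : ℂ) - 1‖ₑ ^ 2 := by
  refine (Continuous.measurable ?_).pow_const 2
  refine continuous_enorm.comp (Continuous.sub ?_ continuous_const)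
  exact continuous_subtype_val.comp (Real.continuous_fourierChar.comp (by fun_prop))

lemma measurable_enorm_fourierChar_sub_one' : Measurable fun p : Rn n × Rn n =>
    ‖(Real.fourierChar (inner ℝ p.2 p.1) : ℂ) - 1‖ₑ ^ 2 := by
  refine (Continuous.measurable ?_).pow_const 2
  refine continuous_enorm.comp (Continuous.sub ?_ continuous_const)
  exact continuous_subtype_val.comp (Real.continuous_fourierChar.comp (by fun_prop))

lemma measurable_enorm_alphaV_sq : Measurable fun h : Rn n => ‖alphaV n s h‖ₑ ^ 2 :=
  (measurable_alphaV n s).enorm.pow_const 2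

lemma lintegral_fracGrad_translate_sq {f : Rn n → ℂ} (hf : MemLp f 2 volume) (h : Rn n) :
    ∫⁻ x : Rn n, ‖fracGrad n s f (x, x + h)‖ₑ ^ 2 = ∫⁻ ξ : Rn n, ‖alphaV n s h‖ₑ ^ 2 *
      (‖(Real.fourierChar (inner ℝ ξ h) : ℂ) - 1‖ₑ ^ 2 *
        ‖(𝓕 (hf.toLp f) : Lp ℂ 2 (volume : Measure (Rn n))) ξ‖ₑ ^ 2) := by
  have e1 : ∀ x : Rn n, ‖fracGrad n s f (x, x + h)‖ₑ ^ 2 =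
      ‖alphaV n s h‖ₑ ^ 2 * ‖f x - f (x + h)‖ₑ ^ 2 := fun x => by
    rw [enorm_fracGrad, mul_pow, mul_comm, add_sub_cancel_left]
  simp only [e1]
  have hfm : AEMeasurable (fun x => ‖f x - f (x + h)‖ₑ ^ 2) volume :=
    (hf.1.sub (memLp_comp_add_right hf h).1).enorm.pow_const 2
  rw [lintegral_const_mul'' _ hfm, lintegral_sub_translate_sq hf, lintegral_const_mul]
  exact (measurable_enorm_fourierChar_sub_one.comp measurable_prodMk_right).mul
    ((Lp.stronglyMeasurable _).measurable.enorm.pow_const 2)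

lemma measurable_gradSymbol_integrand (ξ : Rn n) : Measurable fun h : Rn n =>
    ‖alphaV n s h‖ₑ ^ 2 * ‖(Real.fourierChar (inner ℝ ξ h) : ℂ) - 1‖ₑ ^ 2 := by
  refine measurable_enorm_alphaV_sq.mul ?_
  refine (Continuous.measurable ?_).pow_const 2
  refine continuous_enorm.comp (Continuous.sub ?_ continuous_const)
  exact continuous_subtype_val.comp (Real.continuous_fourierChar.comp (by fun_prop))

lemma measurable_uncurry_gradSymbol_mul {G : Rn n → ℝ≥0∞} (hG : Measurable G) :
    Measurable (Function.uncurry fun h ξ : Rn n => ‖alphaV n s h‖ₑ ^ 2 *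
      (‖(Real.fourierChar (inner ℝ ξ h) : ℂ) - 1‖ₑ ^ 2 * G ξ)) := by
  have h2 : Measurable fun p : Rn n × Rn n => ‖alphaV n s p.1‖ₑ ^ 2 :=
    ((measurable_alphaV n s).comp measurable_fst).enorm.pow_const 2
  have h3 : Measurable fun p : Rn n × Rn n => G p.2 := hG.comp measurable_snd
  exact h2.mul (measurable_enorm_fourierChar_sub_one'.mul h3)

lemma lintegral_gradSymbol_mul {G : Rn n → ℝ≥0∞} (hG : Measurable G) :
    ∫⁻ h : Rn n, ∫⁻ ξ : Rn n, ‖alphaV n s h‖ₑ ^ 2 *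
      (‖(Real.fourierChar (inner ℝ ξ h) : ℂ) - 1‖ₑ ^ 2 * G ξ) =
      ∫⁻ ξ, gradSymbol n s ξ * G ξ := by
  refine (lintegral_lintegral_swap (measurable_uncurry_gradSymbol_mul hG).aemeasurable).trans
    (lintegral_congr fun ξ => ?_)
  rw [gradSymbol, ← lintegral_mul_const _ (measurable_gradSymbol_integrand ξ)]
  simp only [mul_assoc]

/-- The Gagliardo seminorm in Fourier variables. -/
lemma lintegral_fracGrad_sq {f : Rn n → ℂ} (hf : MemLp f 2 volume) :
    ∫⁻ z, ‖fracGrad n s f z‖ₑ ^ 2 = ∫⁻ ξ, gradSymbol n s ξ *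
      ‖(𝓕 (hf.toLp f) : Lp ℂ 2 (volume : Measure (Rn n))) ξ‖ₑ ^ 2 := by
  rw [lintegral_shear ((aestronglyMeasurable_fracGrad hf.1).enorm.pow_const 2),
    ← lintegral_gradSymbol_mul ((Lp.stronglyMeasurable _).measurable.enorm.pow_const 2)]
  exact lintegral_congr fun h => lintegral_fracGrad_translate_sq hf h

end

end FracMag

/-! ### The critical Sobolev inequality, by level-dependent frequency cut-off. -/

namespace FracMag

noncomputable section

variable {n : ℕ}

lemma integrableOn_norm_rpow_neg (hn : 1 ≤ n) {a : ℝ} (ha : a < n) :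
    IntegrableOn (fun ξ : Rn n => ‖ξ‖ ^ (-a)) (Metric.ball 0 1) volume := by
  have : Nonempty (Fin n) := ⟨⟨0, hn⟩⟩
  rw [← integrable_indicator_iff measurableSet_ball]
  have h1 : (Metric.ball (0 : Rn n) 1).indicator (fun ξ : Rn n => ‖ξ‖ ^ (-a)) =
      fun ξ => (Set.Iio (1 : ℝ)).indicator (fun y : ℝ => y ^ (-a)) ‖ξ‖ := by
    ext ξ
    simp [Set.indicator]
  rw [h1, integrable_fun_norm_addHaar volume
    (f := (Set.Iio (1 : ℝ)).indicator (fun y : ℝ => y ^ (-a)))]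
  simp only [finrank_euclideanSpace, Fintype.card_fin, smul_eq_mul]
  have h2 : IntegrableOn (fun y : ℝ => y ^ ((n : ℝ) - 1 - a)) (Set.Ioo 0 1) :=
    (intervalIntegral.integrableOn_Ioo_rpow_iff one_pos).2 (by linarith)
  have h3 : Integrable ((Set.Ioo (0 : ℝ) 1).indicator fun y : ℝ => y ^ ((n : ℝ) - 1 - a)) :=
    (integrable_indicator_iff measurableSet_Ioo).2 h2
  refine (h3.integrableOn (s := Set.Ioi 0)).congr_fun (fun y hy => ?_) measurableSet_Ioi
  have hy0 : (0 : ℝ) < y := hy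
  by_cases hy1 : y < 1
  · rw [Set.indicator_of_mem (show y ∈ Set.Ioo 0 1 from ⟨hy0, hy1⟩)]
    simp only [Set.indicator, Set.mem_Iio, hy1, if_true]
    rw [← Real.rpow_natCast, Nat.cast_sub hn, Nat.cast_one, ← Real.rpow_add hy0]
    congr 1
  · rw [Set.indicator_of_notMem (fun h => hy1 h.2)]
    simp [Set.indicator, hy1]

/-- Scaling reduces every radius to the unit ball, where |ξ|^{-a} is integrable because a < n. The
summand 1 in κ keeps it positive. -/
lemma exists_lintegral_ball_rpow_le (hn : 1 ≤ n) {a : ℝ} (ha : a < n) :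
    ∃ κ : ℝ, 0 < κ ∧ ∀ R : ℝ, 0 < R →
      ∫⁻ ξ in Metric.ball (0 : Rn n) R, ENNReal.ofReal (‖ξ‖ ^ (-a)) ≤
        ENNReal.ofReal (κ * R ^ ((n : ℝ) - a)) := by
  have hint := integrableOn_norm_rpow_neg hn ha
  set G : Rn n → ℝ≥0∞ := (Metric.ball 0 1).indicator fun ξ => ENNReal.ofReal (‖ξ‖ ^ (-a)) with hG
  have hGm : Measurable G := Measurable.indicator (by fun_prop) measurableSet_ball
  have hGi : ∫⁻ ξ, G ξ ≠ ⊤ := by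
    rw [hG, lintegral_indicator measurableSet_ball]
    exact (hint.lintegral_lt_top).ne
  refine ⟨(∫⁻ ξ, G ξ).toReal + 1, by positivity, fun R hR => ?_⟩
  have h1 : ∫⁻ ξ in Metric.ball (0 : Rn n) R, ENNReal.ofReal (‖ξ‖ ^ (-a)) =
      ENNReal.ofReal (R ^ (-a)) * ∫⁻ ξ, G (R⁻¹ • ξ) := by
    rw [← lintegral_indicator measurableSet_ball, ← lintegral_const_mul]
    · refine lintegral_congr fun ξ => ?_
      by_cases hξ : ‖ξ‖ < R
      · have hξ' : R⁻¹ * ‖ξ‖ < 1 := by rwa [inv_mul_lt_iff₀ hR, mul_one]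
        simp only [hG, Set.indicator, mem_ball_zero_iff, hξ, if_true, norm_smul, norm_inv,
          Real.norm_of_nonneg hR.le, hξ']
        rw [← ENNReal.ofReal_mul (by positivity), Real.mul_rpow (by positivity) (norm_nonneg _),
          ← mul_assoc, ← Real.mul_rpow hR.le (by positivity), mul_inv_cancel₀ hR.ne',
          Real.one_rpow, one_mul]
      · have hξ' : ¬ R⁻¹ * ‖ξ‖ < 1 := by rwa [inv_mul_lt_iff₀ hR, mul_one]
        simp [hG, Set.indicator, hξ, norm_smul, abs_of_pos hR, hξ']
    · exact hGm.comp (measurable_const_smul _)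
  rw [h1, lintegral_comp_smul_Rn (inv_pos.2 hR) hGm, ← mul_assoc,
    ← ENNReal.ofReal_mul (by positivity)]
  have e : R ^ (-a) * R⁻¹ ^ (-(n : ℝ)) = R ^ ((n : ℝ) - a) := by
    rw [Real.inv_rpow hR.le, Real.rpow_neg hR.le (n : ℝ), inv_inv, ← Real.rpow_add hR]
    congr 1; ring
  rw [e, mul_comm (_ + 1), ENNReal.ofReal_mul (by positivity)]
  gcongr
  rw [← ENNReal.ofReal_toReal hGi]
  exact ENNReal.ofReal_le_ofReal (by simp)

/-- Cauchy-Schwarz for the low frequencies. -/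
lemma lintegral_low_frequency_le {r : ℝ} (L : Set (Rn n)) {f : Rn n → ℂ}
    (hf : AEStronglyMeasurable f volume) {B : ℝ≥0∞}
    (hL : ∫⁻ ξ in L, ENNReal.ofReal (‖ξ‖ ^ (-(2 * r))) ≤ B ^ 2)
    (hu : ∫⁻ ξ, ENNReal.ofReal (‖ξ‖ ^ (2 * r)) * ‖f ξ‖ₑ ^ 2 ≤ 1) (hn : 1 ≤ n) :
    ∫⁻ ξ in L, ‖f ξ‖ₑ ≤ B := by
  have : Nonempty (Fin n) := ⟨⟨0, hn⟩⟩
  have h1 : ∫⁻ ξ in L, ‖f ξ‖ₑ ≤ ∫⁻ ξ in L, ((fun ξ : Rn n => ENNReal.ofReal (‖ξ‖ ^ (-r))) *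
      fun ξ => ENNReal.ofReal (‖ξ‖ ^ r) * ‖f ξ‖ₑ) ξ := by
    refine lintegral_mono_ae ?_
    have h0 : ∀ᵐ ξ : Rn n, ξ ≠ 0 := by simp [ae_iff]
    filter_upwards [ae_restrict_of_ae h0] with ξ hξ
    have : 0 < ‖ξ‖ := norm_pos_iff.2 hξ
    rw [Pi.mul_apply, ← mul_assoc, ← ENNReal.ofReal_mul (by positivity), ← Real.rpow_add this]
    simp
  refine h1.trans ?_
  have h2 := ENNReal.lintegral_mul_le_Lp_mul_Lq (volume.restrict L) Real.HolderConjugate.two_two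
    (f := fun ξ : Rn n => ENNReal.ofReal (‖ξ‖ ^ (-r)))
    (g := fun ξ => ENNReal.ofReal (‖ξ‖ ^ r) * ‖f ξ‖ₑ)
    (by fun_prop) ((Measurable.aemeasurable (by fun_prop)).mul hf.restrict.enorm)
  refine h2.trans ?_
  have e1 : ∀ ξ : Rn n, ENNReal.ofReal (‖ξ‖ ^ (-r)) ^ (2 : ℝ) =
      ENNReal.ofReal (‖ξ‖ ^ (-(2 * r))) := fun ξ => by
    rw [ENNReal.rpow_ofNat, ← ENNReal.ofReal_pow (by positivity), ← Real.rpow_mul_natCast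
      (norm_nonneg _)]
    congr 2; push_cast; ring
  have e2 : ∀ ξ : Rn n, (ENNReal.ofReal (‖ξ‖ ^ r) * ‖f ξ‖ₑ) ^ (2 : ℝ) =
      ENNReal.ofReal (‖ξ‖ ^ (2 * r)) * ‖f ξ‖ₑ ^ 2 := fun ξ => by
    rw [ENNReal.rpow_ofNat, mul_pow, ← ENNReal.ofReal_pow (by positivity), ← Real.rpow_mul_natCast
      (norm_nonneg _)]
    congr 3; push_cast; ring
  simp only [e1, e2]
  have h3 : (∫⁻ ξ in L, ENNReal.ofReal (‖ξ‖ ^ (2 * r)) * ‖f ξ‖ₑ ^ 2) ≤ 1 :=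
    (setLIntegral_le_lintegral _ _).trans hu
  calc _ ≤ (B ^ 2) ^ (1 / 2 : ℝ) * 1 ^ (1 / 2 : ℝ) := by gcongr
    _ = B := by
      rw [ENNReal.one_rpow, mul_one, ← ENNReal.rpow_natCast, ← ENNReal.rpow_mul]
      norm_num

/-- The distribution function of `u` is controlled by its high frequencies. -/
lemma meas_lt_norm_le (u : Lp ℂ 2 (volume : Measure (Rn n))) {t : ℝ} (ht : 0 < t)
    {L : Set (Rn n)} (hLm : MeasurableSet L) (hLf : volume L ≠ ⊤)
    (hL : ∫⁻ ξ in L, ‖(𝓕 u : Lp ℂ 2 (volume : Measure (Rn n))) ξ‖ₑ ≤ ENNReal.ofReal (t / 2)) :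
    volume {x | t < ‖u x‖} ≤ ENNReal.ofReal (4 / t ^ 2) *
      ∫⁻ ξ in Lᶜ, ‖(𝓕 u : Lp ℂ 2 (volume : Measure (Rn n))) ξ‖ₑ ^ 2 := by
  set f := (𝓕 u : Lp ℂ 2 (volume : Measure (Rn n))) with hfdef
  have hf2 : MemLp f 2 volume := Lp.memLp f
  have hg2 : MemLp (L.indicator f) 2 volume := hf2.indicator hLm
  have hg1 : Integrable (L.indicator f) volume := by
    rw [integrable_indicator_iff hLm]
    have : IsFiniteMeasure (volume.restrict L) := ⟨by
      rw [Measure.restrict_apply_univ]; exact hLf.lt_top⟩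
    exact hf2.restrict L |>.integrable one_le_two
  -- The low-frequency part of `u` satisfies |v| ≤ t/2 almost everywhere. Where |u| > t the rest
  -- exceeds t/2, and Chebyshev's inequality gives the factor 4/t².
  set v : Lp ℂ 2 (volume : Measure (Rn n)) := 𝓕⁻ (hg2.toLp _) with hv
  have hvb : ∀ᵐ x, ‖v x‖ ≤ t / 2 := by
    filter_upwards [fourierInv_toLp_ae_eq hg1 hg2] with x hx
    rw [hv, hx]
    refine (VectorFourier.norm_fourierIntegral_le_integral_norm _ _ _ _ _).trans ?_
    rw [integral_norm_eq_lintegral_enorm hg1.1]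
    refine ENNReal.toReal_le_of_le_ofReal (by positivity) ?_
    refine le_trans (le_of_eq ?_) hL
    rw [← lintegral_indicator hLm]
    refine lintegral_congr fun ξ => ?_
    by_cases hξ : ξ ∈ L <;> simp [Set.indicator, hξ]
  have hhigh : ∫⁻ x, ‖(u - v) x‖ₑ ^ 2 = ∫⁻ ξ in Lᶜ, ‖f ξ‖ₑ ^ 2 := by
    rw [← lintegral_fourier_sq, ← lintegral_indicator hLm.compl]
    have e : (𝓕 (u - v) : Lp ℂ 2 (volume : Measure (Rn n))) = f - hg2.toLp _ := by
      have := (Lp.fourierTransformₗᵢ (Rn n) ℂ).map_sub u v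
      refine this.trans ?_
      congr 1
      exact (Lp.fourierTransformₗᵢ (Rn n) ℂ).apply_symm_apply _
    rw [e]
    refine lintegral_congr_ae ?_
    filter_upwards [Lp.coeFn_sub f (hg2.toLp _), hg2.coeFn_toLp] with ξ h1 h2
    rw [h1, Pi.sub_apply, h2]
    by_cases hξ : ξ ∈ L <;> simp [Set.indicator, hξ]
  rw [← hhigh]
  have hch : volume {x | t < ‖u x‖} ≤ volume {x | ENNReal.ofReal (t ^ 2 / 4) ≤ ‖(u - v) x‖ₑ ^ 2} := by
    refine measure_mono_ae ?_
    filter_upwards [hvb, Lp.coeFn_sub u v] with x h1 h2 h3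
    have h3' : t < ‖u x‖ := h3
    change ENNReal.ofReal (t ^ 2 / 4) ≤ ‖(u - v) x‖ₑ ^ 2
    rw [h2, Pi.sub_apply, ← ofReal_norm, ← ENNReal.ofReal_pow (norm_nonneg _)]
    refine ENNReal.ofReal_le_ofReal ?_
    have h4 : t / 2 ≤ ‖u x - v x‖ := by
      have := norm_sub_norm_le (u x) (v x)
      linarith
    calc t ^ 2 / 4 = (t / 2) ^ 2 := by ring
      _ ≤ _ := pow_le_pow_left₀ (by positivity) h4 2
  refine hch.trans ?_
  have hmk := mul_meas_ge_le_lintegral₀ (μ := volume) (f := fun x => ‖(u - v) x‖ₑ ^ 2)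
    ((Lp.aestronglyMeasurable (u - v)).enorm.pow_const 2) (ENNReal.ofReal (t ^ 2 / 4))
  have h1 : ENNReal.ofReal (4 / t ^ 2) * ENNReal.ofReal (t ^ 2 / 4) = 1 := by
    rw [← ENNReal.ofReal_mul (by positivity), ← ENNReal.ofReal_one]
    congr 1; field_simp
  calc _ = ENNReal.ofReal (4 / t ^ 2) * (ENNReal.ofReal (t ^ 2 / 4) *
        volume {x | ENNReal.ofReal (t ^ 2 / 4) ≤ ‖(u - v) x‖ₑ ^ 2}) := by
        rw [← mul_assoc, h1, one_mul]
    _ ≤ _ := by gcongr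

lemma lintegral_Ioc_rpow {q T : ℝ} (hq : 2 < q) (hT : 0 ≤ T) :
    ∫⁻ t in Set.Ioc 0 T, ENNReal.ofReal (t ^ (q - 3)) =
      ENNReal.ofReal (T ^ (q - 2) / (q - 2)) := by
  have h1 : IntervalIntegrable (fun t : ℝ => t ^ (q - 3)) volume 0 T :=
    intervalIntegral.intervalIntegrable_rpow' (by linarith)
  rw [← ofReal_integral_eq_lintegral_ofReal
    ((intervalIntegrable_iff_integrableOn_Ioc_of_le hT).1 h1)
    ((ae_restrict_mem measurableSet_Ioc).mono fun t ht => by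
      have := ht.1
      simp only [Pi.zero_apply]
      positivity),
    ← intervalIntegral.integral_of_le hT, integral_rpow (Or.inl (by linarith))]
  rw [show q - 3 + 1 = q - 2 by ring, Real.zero_rpow (by linarith), sub_zero]

/-- The critical Sobolev inequality, normalised. -/
lemma exists_lintegral_rpow_le (hn : 1 ≤ n) {r : ℝ} (hr0 : 0 < r) (hr : 2 * r < n) :
    ∃ C : ℝ, 0 < C ∧ ∀ u : Lp ℂ 2 (volume : Measure (Rn n)),
      ∫⁻ ξ, ENNReal.ofReal (‖ξ‖ ^ (2 * r)) *
        ‖(𝓕 u : Lp ℂ 2 (volume : Measure (Rn n))) ξ‖ₑ ^ 2 ≤ 1 →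
      ∫⁻ x, ENNReal.ofReal (‖u x‖ ^ (2 * n / (n - 2 * r))) ≤ ENNReal.ofReal C := by
  obtain ⟨κ, hκ0, hκ⟩ := exists_lintegral_ball_rpow_le hn hr
  set m : ℝ := n - 2 * r with hm
  have hm0 : 0 < m := by linarith
  set q : ℝ := 2 * n / m with hq
  have hn0 : (0 : ℝ) < n := by linarith
  have hq2 : 2 < q := by
    rw [hq, lt_div_iff₀ hm0]; linarith
  have hqm : (q - 2) * m = 4 * r := by
    rw [hq]; field_simp; rw [hm]; ring
  set K : ℝ := (4 * κ) ^ ((q - 2) / 2) / (q - 2) with hK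
  have hK0 : 0 < K := by
    have : 0 < q - 2 := by linarith
    positivity
  refine ⟨q * (4 * K), by positivity, fun u hu => ?_⟩
  set f := (𝓕 u : Lp ℂ 2 (volume : Measure (Rn n))) with hf
  have hfm : Measurable fun ξ => ‖f ξ‖ₑ ^ 2 := (Lp.stronglyMeasurable f).measurable.enorm.pow_const 2
  -- The cut-off radius R depends on the level t through κ Rᵐ = (t/2)². This is what Cauchy-Schwarz
  -- needs to bound the low frequencies by t/2.
  set L : ℝ → Set (Rn n) := fun t => {ξ | 4 * κ * ‖ξ‖ ^ m < t ^ 2} with hLdef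
  have hLm : ∀ t, MeasurableSet (L t) := fun t =>
    measurableSet_lt (by fun_prop) measurable_const
  have hdist : ∀ t : ℝ, 0 < t → volume {x | t < ‖u x‖} ≤ ENNReal.ofReal (4 / t ^ 2) *
      ∫⁻ ξ in (L t)ᶜ, ‖f ξ‖ₑ ^ 2 := by
    intro t ht
    set R : ℝ := (t ^ 2 / (4 * κ)) ^ (1 / m) with hR
    have hR0 : 0 < R := by positivity
    have hRm : R ^ m = t ^ 2 / (4 * κ) := by
      rw [hR, ← Real.rpow_mul (by positivity), one_div_mul_cancel hm0.ne', Real.rpow_one]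
    have hsub : L t ⊆ Metric.ball 0 R := by
      intro ξ hξ
      rw [mem_ball_zero_iff]
      by_contra hcon
      push Not at hcon
      have h1 := Real.rpow_le_rpow hR0.le hcon hm0.le
      rw [hRm, div_le_iff₀ (by positivity)] at h1
      have h2 : 4 * κ * ‖ξ‖ ^ m < t ^ 2 := hξ
      linarith
    refine meas_lt_norm_le u ht (hLm t) ((measure_mono hsub).trans_lt measure_ball_lt_top).ne ?_
    refine lintegral_low_frequency_le (L t) (Lp.aestronglyMeasurable f) ?_ hu hn
    refine (lintegral_mono_set hsub).trans ((hκ R hR0).trans ?_)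
    rw [hRm, ← ENNReal.ofReal_pow (by positivity)]
    refine ENNReal.ofReal_le_ofReal (le_of_eq ?_)
    field_simp
    norm_num
  have hlc := lintegral_rpow_eq_lintegral_meas_lt_mul (μ := volume) (f := fun x => ‖u x‖)
    (Eventually.of_forall fun x => norm_nonneg _) (Lp.aestronglyMeasurable u).norm.aemeasurable
    (p := q) (by linarith)
  rw [hlc]
  set S : Set (ℝ × Rn n) := {p | p.1 ^ 2 ≤ 4 * κ * ‖p.2‖ ^ m} with hS
  have hSm : MeasurableSet S := measurableSet_le (by fun_prop) (by fun_prop)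
  have h1 : ∫⁻ t in Set.Ioi (0 : ℝ), volume {x | t < ‖u x‖} * ENNReal.ofReal (t ^ (q - 1)) ≤
      ∫⁻ t in Set.Ioi (0 : ℝ), ∫⁻ ξ, S.indicator
        (fun p : ℝ × Rn n => ENNReal.ofReal (4 * p.1 ^ (q - 3)) * ‖f p.2‖ₑ ^ 2) (t, ξ) := by
    refine setLIntegral_mono_ae' measurableSet_Ioi (Eventually.of_forall fun t ht => ?_)
    have ht0 : (0 : ℝ) < t := ht
    refine (mul_le_mul_left (hdist t ht0) _).trans (le_of_eq ?_)
    rw [mul_right_comm, ← ENNReal.ofReal_mul (by positivity),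
      ← lintegral_indicator (hLm t).compl, ← lintegral_const_mul _ (hfm.indicator (hLm t).compl)]
    refine lintegral_congr fun ξ => ?_
    have e1 : 4 / t ^ 2 * t ^ (q - 1) = 4 * t ^ (q - 3) := by
      rw [show q - 1 = (q - 3) + (2 : ℕ) by push_cast; ring, Real.rpow_add_natCast ht0.ne']
      field_simp
    rw [e1]
    by_cases hξ : t ^ 2 ≤ 4 * κ * ‖ξ‖ ^ m
    · have h2 : ξ ∈ (L t)ᶜ := by simpa [hLdef] using hξ
      have h3 : (t, ξ) ∈ S := hξ
      rw [Set.indicator_of_mem h2, Set.indicator_of_mem h3]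
    · have h2 : ξ ∉ (L t)ᶜ := by simpa [hLdef] using hξ
      have h3 : (t, ξ) ∉ S := hξ
      rw [Set.indicator_of_notMem h2, Set.indicator_of_notMem h3, mul_zero]
  have hjm : Measurable (S.indicator
      (fun p : ℝ × Rn n => ENNReal.ofReal (4 * p.1 ^ (q - 3)) * ‖f p.2‖ₑ ^ 2)) := by
    refine Measurable.indicator ?_ hSm
    exact Measurable.mul (by fun_prop) (hfm.comp measurable_snd)
  -- By Tonelli the level integral may be done first. For fixed ξ it runs up to T = √(4κ|ξ|ᵐ), and
  -- ∫₀ᵀ t^{q-3} dt is a multiple of |ξ|^{m(q-2)/2} = |ξ|^{2r}, exactly the weight in the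
  -- hypothesis.
  have h2 : ∀ ξ : Rn n, ∫⁻ t in Set.Ioi (0 : ℝ), S.indicator
        (fun p : ℝ × Rn n => ENNReal.ofReal (4 * p.1 ^ (q - 3)) * ‖f p.2‖ₑ ^ 2) (t, ξ) =
      ENNReal.ofReal (4 * K) * (ENNReal.ofReal (‖ξ‖ ^ (2 * r)) * ‖f ξ‖ₑ ^ 2) := by
    intro ξ
    set T : ℝ := Real.sqrt (4 * κ * ‖ξ‖ ^ m) with hT
    have hmem : ∀ t : ℝ, 0 < t → ((t, ξ) ∈ S ↔ t ≤ T) := fun t ht => by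
      rw [hT, Real.le_sqrt ht.le (by positivity)]; rfl
    have e1 : ∫⁻ t in Set.Ioi (0 : ℝ), S.indicator
        (fun p : ℝ × Rn n => ENNReal.ofReal (4 * p.1 ^ (q - 3)) * ‖f p.2‖ₑ ^ 2) (t, ξ) =
        ∫⁻ t in Set.Ioc 0 T, ENNReal.ofReal (t ^ (q - 3)) * (4 * ‖f ξ‖ₑ ^ 2) := by
      rw [← lintegral_indicator measurableSet_Ioi, ← lintegral_indicator measurableSet_Ioc]
      refine lintegral_congr fun t => ?_
      by_cases ht : 0 < t
      · rw [Set.indicator_of_mem (show t ∈ Set.Ioi 0 from ht)]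
        by_cases htT : t ≤ T
        · rw [Set.indicator_of_mem ((hmem t ht).2 htT), Set.indicator_of_mem (show t ∈ Set.Ioc 0 T from ⟨ht, htT⟩),
            mul_comm 4, ENNReal.ofReal_mul (by positivity), ENNReal.ofReal_ofNat, mul_assoc]
        · rw [Set.indicator_of_notMem (fun h => htT ((hmem t ht).1 h)),
            Set.indicator_of_notMem (fun h => htT h.2)]
      · rw [Set.indicator_of_notMem (show t ∉ Set.Ioi 0 from ht),
          Set.indicator_of_notMem (fun h => ht h.1)]
    rw [e1, lintegral_mul_const _ (by fun_prop), lintegral_Ioc_rpow hq2 (Real.sqrt_nonneg _)]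
    have e2 : T ^ (q - 2) / (q - 2) = K * ‖ξ‖ ^ (2 * r) := by
      rw [hT, Real.sqrt_eq_rpow, ← Real.rpow_mul (by positivity),
        Real.mul_rpow (by positivity) (by positivity), ← Real.rpow_mul (norm_nonneg _), hK,
        show m * (1 / 2 * (q - 2)) = 2 * r by linarith,
        show 1 / 2 * (q - 2) = (q - 2) / 2 by ring]
      ring
    rw [e2, ENNReal.ofReal_mul hK0.le, ENNReal.ofReal_mul (p := 4) (by norm_num),
      ENNReal.ofReal_ofNat]
    ring
  have h3 : ∫⁻ t in Set.Ioi (0 : ℝ), ∫⁻ ξ, S.indicator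
        (fun p : ℝ × Rn n => ENNReal.ofReal (4 * p.1 ^ (q - 3)) * ‖f p.2‖ₑ ^ 2) (t, ξ) ≤
      ENNReal.ofReal (4 * K) := by
    rw [lintegral_lintegral_swap (f := fun t ξ => S.indicator
        (fun p : ℝ × Rn n => ENNReal.ofReal (4 * p.1 ^ (q - 3)) * ‖f p.2‖ₑ ^ 2) (t, ξ))
        hjm.aemeasurable]
    simp only [h2]
    have hm2 : Measurable fun ξ : Rn n => ENNReal.ofReal (‖ξ‖ ^ (2 * r)) * ‖f ξ‖ₑ ^ 2 :=
      Measurable.mul (by fun_prop) hfm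
    rw [lintegral_const_mul _ hm2]
    exact mul_le_of_le_one_right' hu
  rw [ENNReal.ofReal_mul (by positivity)]
  gcongr
  exact h1.trans h3

/-- The critical Sobolev inequality `‖u‖_{L^q} ≤ C ‖ |ξ|ʳ û ‖_{L²}`, `q = 2n/(n - 2r)`. -/
lemma exists_eLpNorm_le_fourier (hn : 1 ≤ n) {r : ℝ} (hr0 : 0 < r) (hr : 2 * r < n) :
    ∃ C : ℝ, 0 < C ∧ ∀ (u : Lp ℂ 2 (volume : Measure (Rn n))) (N : ℝ), 0 < N →
      ∫⁻ ξ, ENNReal.ofReal (‖ξ‖ ^ (2 * r)) *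
        ‖(𝓕 u : Lp ℂ 2 (volume : Measure (Rn n))) ξ‖ₑ ^ 2 ≤ ENNReal.ofReal (N ^ 2) →
      eLpNorm u (ENNReal.ofReal (2 * n / (n - 2 * r))) volume ≤ ENNReal.ofReal (C * N) := by
  obtain ⟨C, hC0, hC⟩ := exists_lintegral_rpow_le hn hr0 hr
  set q : ℝ := 2 * n / (n - 2 * r) with hq
  have hn0 : (0 : ℝ) < n := by linarith
  have hq0 : 0 < q := by
    have : 0 < n - 2 * r := by linarith
    positivity
  refine ⟨C ^ (1 / q), by positivity, fun u N hN hu => ?_⟩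
  -- Both sides are homogeneous in `u`, so dividing by N reduces to the normalised inequality.
  set c : ℂ := ((N⁻¹ : ℝ) : ℂ) with hc
  have hcn : ‖c‖ₑ = ENNReal.ofReal N⁻¹ := by
    rw [hc, ← ofReal_norm, Complex.norm_real, Real.norm_of_nonneg (by positivity)]
  have h1 : ∫⁻ ξ, ENNReal.ofReal (‖ξ‖ ^ (2 * r)) *
      ‖(𝓕 (c • u) : Lp ℂ 2 (volume : Measure (Rn n))) ξ‖ₑ ^ 2 ≤ 1 := by
    have e : (𝓕 (c • u) : Lp ℂ 2 (volume : Measure (Rn n))) = c • 𝓕 u :=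
      FourierTransform.fourier_smul c u
    have hm2 : Measurable fun ξ : Rn n => ENNReal.ofReal (‖ξ‖ ^ (2 * r)) *
        ‖(𝓕 u : Lp ℂ 2 (volume : Measure (Rn n))) ξ‖ₑ ^ 2 :=
      Measurable.mul (by fun_prop) ((Lp.stronglyMeasurable _).measurable.enorm.pow_const 2)
    calc _ = ∫⁻ ξ, ENNReal.ofReal N⁻¹ ^ 2 * (ENNReal.ofReal (‖ξ‖ ^ (2 * r)) *
          ‖(𝓕 u : Lp ℂ 2 (volume : Measure (Rn n))) ξ‖ₑ ^ 2) := by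
          refine lintegral_congr_ae ?_
          filter_upwards [Lp.coeFn_smul c (𝓕 u : Lp ℂ 2 (volume : Measure (Rn n)))] with ξ hξ
          rw [e, hξ, Pi.smul_apply, enorm_smul, hcn]
          ring
      _ ≤ ENNReal.ofReal N⁻¹ ^ 2 * ENNReal.ofReal (N ^ 2) := by
          rw [lintegral_const_mul _ hm2]
          gcongr
      _ = 1 := by
          rw [← ENNReal.ofReal_pow (by positivity), ← ENNReal.ofReal_mul (by positivity),
            ← mul_pow, inv_mul_cancel₀ hN.ne', one_pow, ENNReal.ofReal_one]
  have h2 := hC (c • u) h1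
  have h3 : eLpNorm (c • u : Lp ℂ 2 (volume : Measure (Rn n))) (ENNReal.ofReal q) volume ≤
      ENNReal.ofReal (C ^ (1 / q)) := by
    rw [eLpNorm_eq_lintegral_rpow_enorm_toReal (by simpa using hq0) ENNReal.ofReal_ne_top,
      ENNReal.toReal_ofReal hq0.le, ← ENNReal.ofReal_rpow_of_pos hC0]
    refine ENNReal.rpow_le_rpow (le_trans (le_of_eq (lintegral_congr fun x => ?_)) h2)
      (by positivity)
    rw [← ofReal_norm, ENNReal.ofReal_rpow_of_nonneg (norm_nonneg _) hq0.le]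
  have h4 : eLpNorm (c • u : Lp ℂ 2 (volume : Measure (Rn n))) (ENNReal.ofReal q) volume =
      ENNReal.ofReal N⁻¹ * eLpNorm u (ENNReal.ofReal q) volume := by
    rw [eLpNorm_congr_ae (Lp.coeFn_smul c u), eLpNorm_const_smul, hcn]
  rw [h4] at h3
  calc eLpNorm u (ENNReal.ofReal q) volume
      = ENNReal.ofReal N * (ENNReal.ofReal N⁻¹ * eLpNorm u (ENNReal.ofReal q) volume) := by
        rw [← mul_assoc, ← ENNReal.ofReal_mul hN.le, mul_inv_cancel₀ hN.ne', ENNReal.ofReal_one,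
          one_mul]
    _ ≤ ENNReal.ofReal N * ENNReal.ofReal (C ^ (1 / q)) := by gcongr
    _ = _ := by rw [mul_comm, ← ENNReal.ofReal_mul (by positivity)]

end

end FracMag

/-! ### The Hilbert space Hˢ, conjugation, and the support of H̃ˢ(Ω). -/

namespace FracMag

noncomputable section

variable {n : ℕ} {s : ℝ}

/-- The `L²` Fourier transform of `u ∈ Hˢ`. -/
def Hs.hat (u : Hs n s) : Lp ℂ 2 (volume : Measure (Rn n)) := 𝓕 (Hs.incl n s u)

lemma Hs.memLp (u : Hs n s) : MemLp u.fn 2 volume := Lp.memLp (Hs.incl n s u)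

lemma Hs.toLp_fn (u : Hs n s) : u.memLp.toLp u.fn = Hs.incl n s u := Lp.toLp_coeFn _ _

lemma Hs.incl_injective : Function.Injective (Hs.incl n s) := Subtype.val_injective

lemma Hs.ext_fn {u v : Hs n s} (h : u.fn =ᵐ[volume] v.fn) : u = v :=
  Hs.incl_injective (Lp.ext h)

lemma Hs.fn_add (u v : Hs n s) : (u + v).fn =ᵐ[volume] u.fn + v.fn := by
  unfold Hs.fn
  rw [map_add]
  exact Lp.coeFn_add _ _

lemma Hs.fn_sub (u v : Hs n s) : (u - v).fn =ᵐ[volume] u.fn - v.fn := by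
  unfold Hs.fn
  rw [map_sub]
  exact Lp.coeFn_sub _ _

lemma Hs.fn_smul (c : ℂ) (u : Hs n s) : (c • u).fn =ᵐ[volume] c • u.fn := by
  unfold Hs.fn
  rw [map_smul]
  exact Lp.coeFn_smul _ _

lemma Hs.enorm_sq (u : Hs n s) : ‖u‖ₑ ^ 2 =
    ∫⁻ ξ, ENNReal.ofReal ((1 + (2 * Real.pi * ‖ξ‖) ^ 2) ^ s) * ‖u.hat ξ‖ₑ ^ 2 := by
  have h1 : ‖u‖ₑ = eLpNorm (bessel s (Hs.incl n s u)) 2 volume := by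
    rw [← ofReal_norm, Hs.norm_eq, ENNReal.ofReal_toReal u.memLp_bessel.2.ne]
  rw [h1, eLpNorm_two_sq]
  refine lintegral_congr fun ξ => ?_
  rw [bessel, enorm_smul, mul_pow, ← ofReal_norm (_ : ℂ), Complex.norm_real,
    Real.norm_of_nonneg (by positivity), ← ENNReal.ofReal_pow (by positivity),
    ← Real.rpow_mul_natCast (by positivity)]
  norm_num
  rfl

lemma Hs.lintegral_hat_sq (u : Hs n s) : ∫⁻ ξ, ‖u.hat ξ‖ₑ ^ 2 = ∫⁻ x, ‖u.fn x‖ₑ ^ 2 :=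
  lintegral_fourier_sq _

lemma Hs.enorm_incl_sq (u : Hs n s) : ‖Hs.incl n s u‖ₑ ^ 2 = ∫⁻ x, ‖u.fn x‖ₑ ^ 2 := by
  rw [Lp.enorm_def, eLpNorm_two_sq]; rfl

lemma Hs.enorm_incl_le (hs0 : 0 ≤ s) (u : Hs n s) : ‖Hs.incl n s u‖ₑ ≤ ‖u‖ₑ := by
  rw [← ENNReal.pow_le_pow_left_iff two_ne_zero, Hs.enorm_sq, Hs.enorm_incl_sq,
    ← Hs.lintegral_hat_sq]
  refine lintegral_mono fun ξ => ?_
  refine le_mul_of_one_le_left' ?_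
  rw [← ENNReal.ofReal_one]
  refine ENNReal.ofReal_le_ofReal (Real.one_le_rpow ?_ hs0)
  linarith [sq_nonneg (2 * Real.pi * ‖ξ‖)]

lemma Hs.norm_incl_le (hs0 : 0 ≤ s) (u : Hs n s) : ‖Hs.incl n s u‖ ≤ ‖u‖ := by
  rw [← ENNReal.ofReal_le_ofReal_iff (norm_nonneg _), ofReal_norm, ofReal_norm]
  exact Hs.enorm_incl_le hs0 u

/-- The inclusion `Hˢ → L²` as a bounded map. -/
def Hs.inclL (n : ℕ) {s : ℝ} (hs0 : 0 ≤ s) :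
    Hs n s →L[ℂ] Lp ℂ 2 (volume : Measure (Rn n)) :=
  (Hs.incl n s).mkContinuous 1 fun u => by
    rw [one_mul]; exact Hs.norm_incl_le hs0 u

lemma aestronglyMeasurable_bessel (t : ℝ) (u : Lp ℂ 2 (volume : Measure (Rn n))) :
    AEStronglyMeasurable (bessel t u) volume := by
  refine AEStronglyMeasurable.smul (𝕜 := ℂ) (Measurable.aestronglyMeasurable ?_)
    (Lp.aestronglyMeasurable _)
  fun_prop

/-- Membership in `Hˢ` through the weighted `L²` norm of the Fourier transform. -/
lemma memLp_bessel_of_lintegral {u : Lp ℂ 2 (volume : Measure (Rn n))}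
    (hu : ∫⁻ ξ, ENNReal.ofReal ((1 + (2 * Real.pi * ‖ξ‖) ^ 2) ^ s) *
      ‖(𝓕 u : Lp ℂ 2 (volume : Measure (Rn n))) ξ‖ₑ ^ 2 < ⊤) : MemLp (bessel s u) 2 volume := by
  rw [memLp_two_iff_lintegral (aestronglyMeasurable_bessel s u)]
  refine lt_of_eq_of_lt (lintegral_congr fun ξ => ?_) hu
  rw [bessel, enorm_smul, mul_pow, ← ofReal_norm (_ : ℂ), Complex.norm_real,
    Real.norm_of_nonneg (by positivity), ← ENNReal.ofReal_pow (by positivity),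
    ← Real.rpow_mul_natCast (by positivity)]
  norm_num

/-- A preimage of `g` is the inverse transform of g divided by the weight. For s ≥ 0 this quotient
is again in L², the weight being at least 1. Completeness and separability of Hˢ are then inherited
from L². -/
lemma Hs.weighted_surjective (hs0 : 0 ≤ s) : Function.Surjective (Hs.weighted n s) := by
  intro g
  set k : Rn n → ℂ := fun ξ => (((1 + (2 * Real.pi * ‖ξ‖) ^ 2) ^ (-(s / 2)) : ℝ) : ℂ) * g ξ with hk
  have hk2 : MemLp k 2 volume := by
    refine (Lp.memLp g).of_le ((Measurable.aestronglyMeasurable (by fun_prop)).mul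
      (Lp.aestronglyMeasurable g)) (Eventually.of_forall fun ξ => ?_)
    rw [hk, norm_mul, Complex.norm_real, Real.norm_of_nonneg (by positivity)]
    refine mul_le_of_le_one_left (norm_nonneg _) ?_
    exact Real.rpow_le_one_of_one_le_of_nonpos
      (by linarith [sq_nonneg (2 * Real.pi * ‖ξ‖)]) (by linarith)
  set u : Lp ℂ 2 (volume : Measure (Rn n)) := 𝓕⁻ (hk2.toLp k) with hu
  have hfu : (𝓕 u : Lp ℂ 2 (volume : Measure (Rn n))) = hk2.toLp k :=
    (Lp.fourierTransformₗᵢ (Rn n) ℂ).apply_symm_apply _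
  have hb : bessel s u =ᵐ[volume] g := by
    filter_upwards [hk2.coeFn_toLp] with ξ hξ
    rw [bessel, hfu, hξ, hk, smul_eq_mul, ← mul_assoc, ← Complex.ofReal_mul,
      ← Real.rpow_add (by positivity)]
    simp
  have hmem : MemLp (bessel s u) 2 volume := (memLp_congr_ae hb).2 (Lp.memLp g)
  refine ⟨(⟨u, hmem⟩ : hsSubmodule n s), Lp.ext ?_⟩
  exact (MemLp.coeFn_toLp hmem).trans hb

/-- `Hˢ` is isometric to `L²`. -/
def Hs.weightedₗᵢ (n : ℕ) {s : ℝ} (hs0 : 0 ≤ s) :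
    Hs n s ≃ₗᵢ[ℂ] Lp ℂ 2 (volume : Measure (Rn n)) where
  toLinearEquiv := LinearEquiv.ofBijective (Hs.weighted n s)
    ⟨Hs.weighted_injective n s, Hs.weighted_surjective hs0⟩
  norm_map' _ := rfl

lemma Hs.completeSpace (hs0 : 0 ≤ s) : CompleteSpace (Hs n s) :=
  (Hs.weightedₗᵢ n hs0).symm.isometry.isUniformInducing.completeSpace_congr
    (Hs.weightedₗᵢ n hs0).symm.surjective |>.1 inferInstance

/-- The Hilbert space structure of `Hˢ`. -/
@[reducible] def Hs.innerProductSpace (n : ℕ) (s : ℝ) : InnerProductSpace ℂ (Hs n s) where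
  inner u v := inner ℂ (Hs.weighted n s u) (Hs.weighted n s v)
  norm_sq_eq_re_inner u := norm_sq_eq_re_inner (𝕜 := ℂ) (Hs.weighted n s u)
  conj_inner_symm u v := inner_conj_symm (𝕜 := ℂ) _ _
  add_left u v w := by rw [map_add, inner_add_left]
  smul_left u v c := by rw [map_smul, inner_smul_left]

lemma measurable_ofReal_weight (t : ℝ) : Measurable fun ξ : Rn n =>
    ENNReal.ofReal ((1 + (2 * Real.pi * ‖ξ‖) ^ 2) ^ t) := by fun_prop

lemma measurable_enorm_Lp_sq (u : Lp ℂ 2 (volume : Measure (Rn n))) :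
    Measurable fun ξ => ‖u ξ‖ₑ ^ 2 := (Lp.stronglyMeasurable u).measurable.enorm.pow_const 2

lemma measurable_weight_mul_enorm_sq (t : ℝ) (u : Lp ℂ 2 (volume : Measure (Rn n))) :
    Measurable fun ξ => ENNReal.ofReal ((1 + (2 * Real.pi * ‖ξ‖) ^ 2) ^ t) * ‖u ξ‖ₑ ^ 2 :=
  (measurable_ofReal_weight t).mul (measurable_enorm_Lp_sq u)

/-- The fractional gradient is bounded on `Hˢ`. -/
lemma exists_lintegral_fracGrad_sq_le (hn : 1 ≤ n) (hs0 : 0 < s) (hs1 : s < 1) :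
    ∃ C : ℝ, 0 < C ∧ ∀ u : Hs n s,
      ∫⁻ z, ‖fracGrad n s u.fn z‖ₑ ^ 2 ≤ ENNReal.ofReal C * ‖u‖ₑ ^ 2 := by
  obtain ⟨C, hC0, hC⟩ := exists_gradSymbol_le hn hs0 hs1
  refine ⟨C, hC0, fun u => ?_⟩
  rw [lintegral_fracGrad_sq u.memLp, Hs.toLp_fn, Hs.enorm_sq, ← lintegral_const_mul _
    (measurable_weight_mul_enorm_sq s _)]
  refine lintegral_mono fun ξ => ?_
  dsimp only
  rw [← mul_assoc, ← ENNReal.ofReal_mul hC0.le]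
  exact mul_le_mul_left (hC ξ) _

/-- A function in `L²` with finite Gagliardo seminorm lies in `Hˢ`. -/
lemma exists_enorm_sq_le (hn : 1 ≤ n) (hs0 : 0 < s) (hs1 : s < 1) :
    ∃ c : ℝ, 0 < c ∧ ∀ u : Lp ℂ 2 (volume : Measure (Rn n)),
      ENNReal.ofReal c * ∫⁻ ξ, ENNReal.ofReal ((1 + (2 * Real.pi * ‖ξ‖) ^ 2) ^ s) *
        ‖(𝓕 u : Lp ℂ 2 (volume : Measure (Rn n))) ξ‖ₑ ^ 2 ≤
      (∫⁻ x, ‖u x‖ₑ ^ 2) + ∫⁻ z, ‖fracGrad n s u z‖ₑ ^ 2 := by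
  obtain ⟨c, hc0, hc⟩ := exists_le_gradSymbol hn hs0 hs1
  refine ⟨c, hc0, fun u => ?_⟩
  rw [lintegral_fracGrad_sq (Lp.memLp u), Lp.toLp_coeFn, ← lintegral_fourier_sq u,
    ← lintegral_add_left (measurable_enorm_Lp_sq _), ← lintegral_const_mul _
    (measurable_weight_mul_enorm_sq s _)]
  refine lintegral_mono fun ξ => ?_
  dsimp only
  rw [← mul_assoc, ← ENNReal.ofReal_mul hc0.le, ← one_add_mul]
  exact mul_le_mul_left (hc ξ) _

lemma fracGrad_congr {u v : Rn n → ℂ} (h : u =ᵐ[volume] v) :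
    fracGrad n s u =ᵐ[volume] fracGrad n s v := by
  have h1 : ∀ᵐ z : Rn n × Rn n, u z.1 = v z.1 :=
    Measure.quasiMeasurePreserving_fst.ae h
  have h2 : ∀ᵐ z : Rn n × Rn n, u z.2 = v z.2 :=
    Measure.quasiMeasurePreserving_snd.ae h
  filter_upwards [h1, h2] with z hz1 hz2
  rw [fracGrad, fracGrad, hz1, hz2]

/-- This is the lower symbol bound read as a membership criterion. It is free of Fourier transforms,
hence convenient for complex conjugates. -/
lemma exists_Hs_of_memLp (hn : 1 ≤ n) (hs0 : 0 < s) (hs1 : s < 1) {f : Rn n → ℂ}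
    (hf : MemLp f 2 volume) (hg : ∫⁻ z, ‖fracGrad n s f z‖ₑ ^ 2 < ⊤) :
    ∃ u : Hs n s, u.fn =ᵐ[volume] f := by
  obtain ⟨c, hc0, hc⟩ := exists_enorm_sq_le (n := n) hn hs0 hs1
  have h1 := hc (hf.toLp f)
  have h2 : (∫⁻ x, ‖hf.toLp f x‖ₑ ^ 2) < ⊤ :=
    (memLp_two_iff_lintegral (Lp.aestronglyMeasurable _)).1 (Lp.memLp _)
  have h3 : ∫⁻ z, ‖fracGrad n s (hf.toLp f) z‖ₑ ^ 2 = ∫⁻ z, ‖fracGrad n s f z‖ₑ ^ 2 := by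
    refine lintegral_congr_ae ?_
    filter_upwards [fracGrad_congr (s := s) hf.coeFn_toLp] with z hz
    rw [hz]
  rw [h3] at h1
  have h4 := h1.trans_lt (ENNReal.add_lt_top.2 ⟨h2, hg⟩)
  have h5 := ENNReal.lt_top_of_mul_ne_top_right h4.ne (by simpa using hc0)
  exact ⟨(⟨hf.toLp f, memLp_bessel_of_lintegral h5⟩ : hsSubmodule n s), hf.coeFn_toLp⟩

lemma exists_Hs_enorm_sq_le (hn : 1 ≤ n) (hs0 : 0 < s) (hs1 : s < 1) :
    ∃ c : ℝ, 0 < c ∧ ∀ u : Hs n s, ENNReal.ofReal c * ‖u‖ₑ ^ 2 ≤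
      (∫⁻ x, ‖u.fn x‖ₑ ^ 2) + ∫⁻ z, ‖fracGrad n s u.fn z‖ₑ ^ 2 := by
  obtain ⟨c, hc0, hc⟩ := exists_enorm_sq_le (n := n) hn hs0 hs1
  exact ⟨c, hc0, fun u => by rw [Hs.enorm_sq]; exact hc (Hs.incl n s u)⟩

section Conj

lemma enorm_fracGrad_conj (u : Rn n → ℂ) (z : Rn n × Rn n) :
    ‖fracGrad n s (fun x => starRingEnd ℂ (u x)) z‖ₑ = ‖fracGrad n s u z‖ₑ := by
  rw [enorm_fracGrad, enorm_fracGrad, ← map_sub, ← ofReal_norm (starRingEnd ℂ _),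
    RCLike.norm_conj, ofReal_norm]

lemma exists_conj (hn : 1 ≤ n) (hs0 : 0 < s) (hs1 : s < 1) (u : Hs n s) :
    ∃ v : Hs n s, v.fn =ᵐ[volume] fun x => starRingEnd ℂ (u.fn x) := by
  refine exists_Hs_of_memLp hn hs0 hs1 u.memLp.star ?_
  simp only [enorm_fracGrad_conj]
  obtain ⟨C, hC0, hC⟩ := exists_lintegral_fracGrad_sq_le hn hs0 hs1
  exact (hC u).trans_lt (ENNReal.mul_lt_top ENNReal.ofReal_lt_top
    (ENNReal.pow_lt_top enorm_lt_top))

/-- Complex conjugation on `Hˢ`. -/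
def Hs.conj (hn : 1 ≤ n) (hs0 : 0 < s) (hs1 : s < 1) : Hs n s →ₗ⋆[ℂ] Hs n s where
  toFun u := (exists_conj hn hs0 hs1 u).choose
  map_add' u v := by
    refine Hs.ext_fn ?_
    filter_upwards [(exists_conj hn hs0 hs1 u).choose_spec, (exists_conj hn hs0 hs1 v).choose_spec,
      (exists_conj hn hs0 hs1 (u + v)).choose_spec, Hs.fn_add u v,
      Hs.fn_add (exists_conj hn hs0 hs1 u).choose (exists_conj hn hs0 hs1 v).choose]
      with x h1 h2 h3 h4 h5
    rw [h3, h5, h4, Pi.add_apply, Pi.add_apply, h1, h2, map_add]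
  map_smul' c u := by
    refine Hs.ext_fn ?_
    filter_upwards [(exists_conj hn hs0 hs1 u).choose_spec,
      (exists_conj hn hs0 hs1 (c • u)).choose_spec, Hs.fn_smul c u,
      Hs.fn_smul (starRingEnd ℂ c) (exists_conj hn hs0 hs1 u).choose]
      with x h1 h3 h4 h5
    rw [h3, h5, h4, Pi.smul_apply, Pi.smul_apply, h1, smul_eq_mul, smul_eq_mul, map_mul]

lemma Hs.fn_conj (hn : 1 ≤ n) (hs0 : 0 < s) (hs1 : s < 1) (u : Hs n s) :
    (Hs.conj hn hs0 hs1 u).fn =ᵐ[volume] fun x => starRingEnd ℂ (u.fn x) :=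
  (exists_conj hn hs0 hs1 u).choose_spec

/-- Conjugation preserves the L² norm and the Gagliardo seminorm, which together control the Hˢ
norm. -/
lemma Hs.exists_norm_conj_le (hn : 1 ≤ n) (hs0 : 0 < s) (hs1 : s < 1) :
    ∃ C : ℝ, 0 < C ∧ ∀ u : Hs n s, ‖Hs.conj hn hs0 hs1 u‖ ≤ C * ‖u‖ := by
  obtain ⟨c, hc0, hc⟩ := exists_Hs_enorm_sq_le hn hs0 hs1
  obtain ⟨C, hC0, hC⟩ := exists_lintegral_fracGrad_sq_le hn hs0 hs1
  refine ⟨Real.sqrt ((1 + C) / c), by positivity, fun u => ?_⟩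
  have h1 := hc (Hs.conj hn hs0 hs1 u)
  have h2 : ∫⁻ x, ‖(Hs.conj hn hs0 hs1 u).fn x‖ₑ ^ 2 = ‖Hs.incl n s u‖ₑ ^ 2 := by
    rw [Hs.enorm_incl_sq]
    refine lintegral_congr_ae ?_
    filter_upwards [Hs.fn_conj hn hs0 hs1 u] with x hx
    rw [hx, ← ofReal_norm, ← ofReal_norm, RCLike.norm_conj]
  have h3 : ∫⁻ z, ‖fracGrad n s (Hs.conj hn hs0 hs1 u).fn z‖ₑ ^ 2 =
      ∫⁻ z, ‖fracGrad n s u.fn z‖ₑ ^ 2 := by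
    refine lintegral_congr_ae ?_
    filter_upwards [fracGrad_congr (s := s) (Hs.fn_conj hn hs0 hs1 u)] with z hz
    rw [hz, enorm_fracGrad_conj]
  rw [h2, h3] at h1
  have h4 : ENNReal.ofReal c * ‖Hs.conj hn hs0 hs1 u‖ₑ ^ 2 ≤
      ‖u‖ₑ ^ 2 + ENNReal.ofReal C * ‖u‖ₑ ^ 2 :=
    h1.trans (add_le_add (ENNReal.pow_le_pow_left (Hs.enorm_incl_le hs0.le u)) (hC u))
  rw [← ofReal_norm, ← ofReal_norm, ← ENNReal.ofReal_pow (norm_nonneg _),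
    ← ENNReal.ofReal_pow (norm_nonneg _), ← ENNReal.ofReal_mul hc0.le,
    ← ENNReal.ofReal_mul hC0.le, ← ENNReal.ofReal_add (by positivity) (by positivity),
    ENNReal.ofReal_le_ofReal_iff (by positivity)] at h4
  rw [← Real.sqrt_sq (norm_nonneg u), ← Real.sqrt_mul (by positivity)]
  refine Real.le_sqrt_of_sq_le ?_
  rw [div_mul_eq_mul_div, le_div_iff₀ hc0]
  linarith

lemma Hs.continuous_conj (hn : 1 ≤ n) (hs0 : 0 < s) (hs1 : s < 1) :
    Continuous (Hs.conj (n := n) hn hs0 hs1) := by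
  obtain ⟨C, hC0, hC⟩ := Hs.exists_norm_conj_le hn hs0 hs1
  exact AddMonoidHomClass.continuous_of_bound (Hs.conj hn hs0 hs1) C hC

lemma IsTest.conj {U : Set (Rn n)} {φ : Rn n → ℂ} (h : IsTest U φ) :
    IsTest U fun x => starRingEnd ℂ (φ x) := by
  refine ⟨Complex.conjCLE.contDiff.comp h.1, h.2.1.comp_left (map_zero _), ?_⟩
  refine (closure_mono fun x hx => ?_).trans h.2.2
  contrapose! hx
  simp only [Function.mem_support, not_not] at hx ⊢
  rw [hx, map_zero]

lemma Hs.conj_mem_HsTilde (hn : 1 ≤ n) (hs0 : 0 < s) (hs1 : s < 1) {Ω : Set (Rn n)}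
    {u : Hs n s} (hu : u ∈ HsTilde n s Ω) : Hs.conj hn hs0 hs1 u ∈ HsTilde n s Ω := by
  have h1 : HsTilde n s Ω ≤ (HsTilde n s Ω).comap (Hs.conj hn hs0 hs1) := by
    refine Submodule.topologicalClosure_minimal _ (Submodule.span_le.2 ?_) ?_
    · rintro v ⟨φ, hφ, hv⟩
      refine Submodule.le_topologicalClosure _ (Submodule.subset_span ⟨_, hφ.conj, ?_⟩)
      filter_upwards [hv, Hs.fn_conj hn hs0 hs1 v] with x h1 h2
      rw [h2, h1]
    · exact (Submodule.isClosed_topologicalClosure _).preimage (Hs.continuous_conj hn hs0 hs1)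
  exact h1 hu

end Conj

/-- Functions in `H̃ˢ(Ω)` vanish almost everywhere outside `Ω`. -/
lemma HsTilde.ae_eq_zero (hs0 : 0 ≤ s) {Ω : Set (Rn n)} (hΩ : MeasurableSet Ω) {u : Hs n s}
    (hu : u ∈ HsTilde n s Ω) : ∀ᵐ x, x ∉ Ω → u.fn x = 0 := by
  let K : Submodule ℂ (Hs n s) :=
    { carrier := {u | ∀ᵐ x, x ∉ Ω → u.fn x = 0}
      add_mem' := fun {u v} hu hv => by
        filter_upwards [hu, hv, Hs.fn_add u v] with x h1 h2 h3 hx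
        rw [h3, Pi.add_apply, h1 hx, h2 hx, add_zero]
      zero_mem' := by
        have h : (0 : Hs n s).fn =ᵐ[volume] 0 := by
          unfold Hs.fn; rw [map_zero]; exact Lp.coeFn_zero _ _ _
        filter_upwards [h] with x h1 _
        exact h1
      smul_mem' := fun c u hu => by
        filter_upwards [hu, Hs.fn_smul c u] with x h1 h3 hx
        rw [h3, Pi.smul_apply, h1 hx, smul_zero] }
  -- In terms of the L² norm over the complement, vanishing outside Ω is visibly stable under Hˢ
  -- limits.
  have hK : ∀ u : Hs n s, u ∈ K ↔ eLpNorm u.fn 2 (volume.restrict Ωᶜ) = 0 := fun u => by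
    rw [eLpNorm_eq_zero_iff u.memLp.1.restrict two_ne_zero]
    exact (ae_restrict_iff' hΩ.compl).symm
  have hclosed : IsClosed (K : Set (Hs n s)) := by
    refine isClosed_of_closure_subset fun u hu => ?_
    rw [SetLike.mem_coe, hK, ← nonpos_iff_eq_zero]
    refine ENNReal.le_of_forall_pos_le_add fun ε hε _ => ?_
    obtain ⟨v, hv, huv⟩ := Metric.mem_closure_iff.1 hu ε hε
    have hv0 := (hK v).1 hv
    calc eLpNorm u.fn 2 (volume.restrict Ωᶜ)
        ≤ eLpNorm (u - v).fn 2 (volume.restrict Ωᶜ) + eLpNorm v.fn 2 (volume.restrict Ωᶜ) := by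
          refine le_trans (le_of_eq (eLpNorm_congr_ae ?_)) (eLpNorm_add_le
            (u - v).memLp.1.restrict v.memLp.1.restrict (by norm_num))
          filter_upwards [ae_restrict_of_ae (Hs.fn_sub u v)] with x hx
          rw [Pi.add_apply, hx, Pi.sub_apply, sub_add_cancel]
      _ ≤ ‖u - v‖ₑ + 0 := by
          rw [hv0]
          gcongr
          refine (eLpNorm_mono_measure _ Measure.restrict_le_self).trans ?_
          refine le_trans (le_of_eq ?_) (Hs.enorm_incl_le hs0 (u - v))
          rw [Lp.enorm_def]; rfl
      _ ≤ 0 + ε := by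
          rw [zero_add, add_zero, ← ofReal_norm, ← dist_eq_norm]
          exact ENNReal.ofReal_le_of_le_toReal (by simpa using huv.le)
  have hle : HsTilde n s Ω ≤ K := by
    refine Submodule.topologicalClosure_minimal _ (Submodule.span_le.2 ?_) hclosed
    rintro v ⟨φ, hφ, hv⟩
    filter_upwards [hv] with x h1 hx
    rw [h1]
    exact image_eq_zero_of_notMem_tsupport fun h => hx (hφ.2.2 h)
  exact hle hu

end

end FracMag

namespace FracMag

noncomputable section

variable {n : ℕ} {s : ℝ}

/-! ### Sobolev embedding into L^{2p'} and form bounds for L^p potentials. -/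

section Exponents

lemma two_le_pReal : 2 ≤ pReal n s := le_max_left _ _

lemma pReal_pos : 0 < pReal n s := by linarith [two_le_pReal (n := n) (s := s)]

/-- The exponent `2p'`, where `p'` is the conjugate exponent of `p = max{2, n/(2s)}`. -/
def sobReal (n : ℕ) (s : ℝ) : ℝ := 2 * pReal n s / (pReal n s - 1)

/-- The Sobolev embedding `Hˢ ⊆ L^{2p'}`. -/
lemma Hs.exists_eLpNorm_le (hn : 1 ≤ n) (hs0 : 0 < s) :
    ∃ C : ℝ, 0 < C ∧ ∀ u : Hs n s,
      eLpNorm u.fn (ENNReal.ofReal (sobReal n s)) volume ≤ ENNReal.ofReal C * ‖u‖ₑ := by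
  set p := pReal n s with hp
  have hp2 : 2 ≤ p := two_le_pReal
  have hp0 : 0 < p := pReal_pos
  have hn0 : (0 : ℝ) < n := by exact_mod_cast hn
  -- The order for which the critical exponent 2n/(n - 2r) equals 2p/(p - 1) = 2p'. It is at most s
  -- because p ≥ n/(2s), and 2r < n because p > 1.
  set r : ℝ := n / (2 * p) with hr
  have hr0 : 0 < r := by positivity
  have hrs : r ≤ s := by
    have h1 : (n : ℝ) / (2 * s) ≤ p := le_max_right _ _
    rw [div_le_iff₀ (by positivity)] at h1
    rw [hr, div_le_iff₀ (by positivity)]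
    linarith
  have h2r : 2 * r < n := by
    rw [hr, ← mul_div_assoc, mul_div_mul_left _ _ two_ne_zero, div_lt_iff₀ hp0]
    nlinarith
  obtain ⟨C, hC0, hC⟩ := exists_eLpNorm_le_fourier hn hr0 h2r
  have hq : 2 * (n : ℝ) / (n - 2 * r) = sobReal n s := by
    rw [sobReal, ← hp, hr]
    have : p - 1 ≠ 0 := by linarith
    field_simp
  rw [hq] at hC
  refine ⟨C, hC0, fun u => ?_⟩
  rcases eq_or_ne u 0 with rfl | hu
  · have h : (0 : Hs n s).fn =ᵐ[volume] 0 := by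
      unfold Hs.fn; rw [map_zero]; exact Lp.coeFn_zero _ _ _
    rw [eLpNorm_congr_ae h]
    simp
  rw [← ofReal_norm, ← ENNReal.ofReal_mul hC0.le]
  refine hC (Hs.incl n s u) ‖u‖ (norm_pos_iff.2 hu) ?_
  rw [ENNReal.ofReal_pow (norm_nonneg _), ofReal_norm, Hs.enorm_sq]
  refine lintegral_mono fun ξ => mul_le_mul_left (ENNReal.ofReal_le_ofReal ?_) _
  have h3 : (1 : ℝ) ≤ 2 * Real.pi := by linarith [Real.pi_gt_three]
  have h4 : ‖ξ‖ ≤ 2 * Real.pi * ‖ξ‖ := le_mul_of_one_le_left (norm_nonneg _) h3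
  calc ‖ξ‖ ^ (2 * r) = (‖ξ‖ ^ 2) ^ r := by
        rw [← Real.rpow_natCast, ← Real.rpow_mul (norm_nonneg _)]; norm_num
    _ ≤ (1 + (2 * Real.pi * ‖ξ‖) ^ 2) ^ r := by
        refine Real.rpow_le_rpow (by positivity) ?_ hr0.le
        have := pow_le_pow_left₀ (norm_nonneg _) h4 2
        linarith
    _ ≤ _ := Real.rpow_le_rpow_of_exponent_le
        (by linarith [sq_nonneg (2 * Real.pi * ‖ξ‖)]) hrs

/-- Hölder's inequality with exponents `p, 2p', 2p'`. -/
lemma lintegral_mul_mul_le {X : Type*} [MeasurableSpace X] {μ : Measure X} {p : ℝ} (hp : 2 ≤ p)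
    {g f h : X → ℝ≥0∞} (hg : AEMeasurable g μ) (hf : AEMeasurable f μ) (hh : AEMeasurable h μ) :
    ∫⁻ x, g x * (f x * h x) ∂μ ≤ eLpNorm g (ENNReal.ofReal p) μ *
      (eLpNorm f (ENNReal.ofReal (2 * p / (p - 1))) μ *
        eLpNorm h (ENNReal.ofReal (2 * p / (p - 1))) μ) := by
  have hp0 : 0 < p := by linarith
  have hp1 : 0 < p - 1 := by linarith
  set p' : ℝ := p / (p - 1) with hp'
  have hp'0 : 0 < p' := by positivity
  have hconj : p.HolderConjugate p' := Real.HolderConjugate.conjExponent (by linarith)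
  have hq : 2 * p / (p - 1) = 2 * p' := by rw [hp']; ring
  have hev : ∀ (k : X → ℝ≥0∞) (a : ℝ), 0 < a →
      eLpNorm k (ENNReal.ofReal a) μ = (∫⁻ x, k x ^ a ∂μ) ^ (1 / a) := fun k a ha => by
    rw [eLpNorm_eq_lintegral_rpow_enorm_toReal (by simpa using ha) ENNReal.ofReal_ne_top,
      ENNReal.toReal_ofReal ha.le]
    rfl
  rw [hq, hev g p hp0, hev f _ (by positivity), hev h _ (by positivity)]
  have h1 := ENNReal.lintegral_mul_le_Lp_mul_Lq μ hconj hg (hf.mul hh)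
  refine h1.trans ?_
  gcongr
  -- After Hölder with p and p', the product of `f` and `h` is measured in L^{p'}; Cauchy-Schwarz
  -- for their p'-th powers separates them into L^{2p'}.
  have h2 := ENNReal.lintegral_mul_le_Lp_mul_Lq μ Real.HolderConjugate.two_two
    (hf.pow_const p') (hh.pow_const p')
  have e1 : ∫⁻ x, (f * h) x ^ p' ∂μ = ∫⁻ x, ((fun x => f x ^ p') * fun x => h x ^ p') x ∂μ := by
    refine lintegral_congr fun x => ?_
    rw [Pi.mul_apply, Pi.mul_apply, ENNReal.mul_rpow_of_nonneg _ _ hp'0.le]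
  rw [e1, ← ENNReal.mul_rpow_of_nonneg _ _ (by positivity : 0 ≤ 1 / (2 * p'))]
  have e2 : ∀ k : X → ℝ≥0∞, ∫⁻ x, (k x ^ p') ^ (2 : ℝ) ∂μ = ∫⁻ x, k x ^ (2 * p') ∂μ := fun k =>
    lintegral_congr fun x => by rw [← ENNReal.rpow_mul, mul_comm]
  simp only [e2] at h2
  rw [← ENNReal.mul_rpow_of_nonneg _ _ (by norm_num : (0 : ℝ) ≤ 1 / 2)] at h2
  refine (ENNReal.rpow_le_rpow h2 (by positivity : 0 ≤ 1 / p')).trans (le_of_eq ?_)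
  rw [← ENNReal.rpow_mul]
  congr 1
  field_simp

/-- Multiplication by `L^p` functions is bounded on `Hˢ` in the sense of forms. -/
lemma Hs.exists_lintegral_mul_le (hn : 1 ≤ n) (hs0 : 0 < s) :
    ∃ C : ℝ, 0 < C ∧ ∀ g : Rn n → ℝ≥0∞, AEMeasurable g volume → ∀ u v : Hs n s,
      ∫⁻ x, g x * (‖u.fn x‖ₑ * ‖v.fn x‖ₑ) ≤
        eLpNorm g (pExp n s) volume * (ENNReal.ofReal C * (‖u‖ₑ * ‖v‖ₑ)) := by
  obtain ⟨C, hC0, hC⟩ := Hs.exists_eLpNorm_le hn hs0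
  refine ⟨C * C, by positivity, fun g hg u v => ?_⟩
  refine (lintegral_mul_mul_le (two_le_pReal (n := n) (s := s)) hg u.memLp.1.enorm v.memLp.1.enorm).trans ?_
  rw [ENNReal.ofReal_mul hC0.le]
  have e : ∀ w : Hs n s, eLpNorm (fun x => ‖w.fn x‖ₑ)
      (ENNReal.ofReal (2 * pReal n s / (pReal n s - 1))) volume ≤ ENNReal.ofReal C * ‖w‖ₑ :=
    fun w => by rw [eLpNorm_enorm]; exact hC w
  rw [pExp]
  calc _ ≤ eLpNorm g (ENNReal.ofReal (pReal n s)) volume *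
        ((ENNReal.ofReal C * ‖u‖ₑ) * (ENNReal.ofReal C * ‖v‖ₑ)) := by
        gcongr
        · exact e u
        · exact e v
    _ = _ := by ring

/-- Large values of an `L^p` function have small `L^p` norm. -/
lemma exists_eLpNorm_indicator_le {X : Type*} [MeasurableSpace X] {μ : Measure X} {p : ℝ}
    (hp : 0 < p) {g : X → ℝ≥0∞} (hg : AEMeasurable g μ)
    (hgp : eLpNorm g (ENNReal.ofReal p) μ < ⊤) {δ : ℝ≥0∞} (hδ : 0 < δ) :
    ∃ M : ℕ, eLpNorm ({x | (M : ℝ≥0∞) < g x}.indicator g) (ENNReal.ofReal p) μ ≤ δ := by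
  have hev : ∀ k : X → ℝ≥0∞,
      eLpNorm k (ENNReal.ofReal p) μ = (∫⁻ x, k x ^ p ∂μ) ^ (1 / p) := fun k => by
    rw [eLpNorm_eq_lintegral_rpow_enorm_toReal (by simpa using hp) ENNReal.ofReal_ne_top,
      ENNReal.toReal_ofReal hp.le]
    rfl
  have hfin : ∫⁻ x, g x ^ p ∂μ ≠ ⊤ := by
    rw [hev] at hgp
    intro h
    rw [h, ENNReal.top_rpow_of_pos (by positivity)] at hgp
    exact lt_irrefl _ hgp
  -- Dominated convergence: `g` is finite almost everywhere, so at almost every point the indicator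
  -- vanishes for large M.
  have htend : Tendsto (fun M : ℕ => ∫⁻ x, {x | (M : ℝ≥0∞) < g x}.indicator g x ^ p ∂μ) atTop
      (nhds 0) := by
    have h0 : (0 : ℝ≥0∞) = ∫⁻ _, 0 ∂μ := by simp
    rw [h0]
    refine tendsto_lintegral_of_dominated_convergence' (fun x => g x ^ p) (fun M => ?_)
      (fun M => ?_) hfin ?_
    · exact (hg.indicator₀ (nullMeasurableSet_lt aemeasurable_const hg)).pow_const p
    · refine Eventually.of_forall fun x => ENNReal.rpow_le_rpow ?_ hp.le
      exact Set.indicator_le_self' (fun _ _ => bot_le) x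
    · have h1 : ∀ᵐ x ∂μ, g x ^ p < ⊤ := ae_lt_top' (hg.pow_const p) hfin
      filter_upwards [h1] with x hx
      have hx' : g x ≠ ⊤ := fun h => by simp [h, hp] at hx
      refine tendsto_const_nhds.congr' ?_
      obtain ⟨N, hN⟩ := ENNReal.exists_nat_gt hx'
      filter_upwards [eventually_ge_atTop N] with M hM
      rw [Set.indicator_of_notMem, ENNReal.zero_rpow_of_pos hp]
      simp only [Set.mem_ofPred_eq, not_lt]
      exact hN.le.trans (by exact_mod_cast hM)
  have hδp : 0 < δ ^ p := by
    rcases eq_or_ne δ ⊤ with rfl | h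
    · simp [hp]
    · exact ENNReal.rpow_pos hδ h
  obtain ⟨M, hM⟩ := ((htend.eventually (gt_mem_nhds hδp))).exists
  refine ⟨M, ?_⟩
  rw [hev]
  refine (ENNReal.rpow_le_rpow hM.le (by positivity)).trans (le_of_eq ?_)
  rw [← ENNReal.rpow_mul, mul_one_div_cancel hp.ne', ENNReal.rpow_one]

/-- `L^p` potentials are form bounded on `Hˢ` with relative bound zero. -/
lemma Hs.exists_lintegral_mul_sq_le (hn : 1 ≤ n) (hs0 : 0 < s) {g : Rn n → ℝ≥0∞}
    (hg : AEMeasurable g volume) (hgp : eLpNorm g (pExp n s) volume < ⊤) {ε : ℝ} (hε : 0 < ε) :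
    ∃ M : ℝ, 0 ≤ M ∧ ∀ u : Hs n s, ∫⁻ x, g x * ‖u.fn x‖ₑ ^ 2 ≤
      ENNReal.ofReal ε * ‖u‖ₑ ^ 2 + ENNReal.ofReal M * ‖Hs.incl n s u‖ₑ ^ 2 := by
  obtain ⟨C, hC0, hC⟩ := Hs.exists_lintegral_mul_le hn hs0
  -- The potential is split at height M. The part above has L^p norm at most ε/C, so the form bound
  -- with constant C gives ε‖u‖². The part below is at most M and costs only an L² norm.
  obtain ⟨M, hM⟩ := exists_eLpNorm_indicator_le (δ := ENNReal.ofReal (ε / C)) pReal_pos hg hgp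
    (by simpa using div_pos hε hC0)
  set S := {x | (M : ℝ≥0∞) < g x} with hS
  have hgm : AEMeasurable (S.indicator g) volume :=
    hg.indicator₀ (nullMeasurableSet_lt aemeasurable_const hg)
  refine ⟨M, by positivity, fun u => ?_⟩
  have h1 : ∀ x, g x * ‖u.fn x‖ₑ ^ 2 ≤
      S.indicator g x * (‖u.fn x‖ₑ * ‖u.fn x‖ₑ) + (M : ℝ≥0∞) * ‖u.fn x‖ₑ ^ 2 := fun x => by
    rw [← sq, ← add_mul]
    refine mul_le_mul_left ?_ _
    by_cases hx : x ∈ S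
    · rw [Set.indicator_of_mem hx]; exact le_self_add
    · rw [Set.indicator_of_notMem hx, zero_add]; exact not_lt.1 hx
  refine (lintegral_mono h1).trans ?_
  rw [lintegral_add_right' _ ((u.memLp.1.enorm.pow_const 2).const_mul _),
    lintegral_const_mul'' _ (u.memLp.1.enorm.pow_const 2), ← Hs.enorm_incl_sq,
    ENNReal.ofReal_natCast]
  gcongr
  refine (hC _ hgm u u).trans ?_
  calc _ ≤ ENNReal.ofReal (ε / C) * (ENNReal.ofReal C * (‖u‖ₑ * ‖u‖ₑ)) := by
        gcongr
        exact hM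
    _ = _ := by
        rw [← mul_assoc, ← ENNReal.ofReal_mul (by positivity), div_mul_cancel₀ _ hC0.ne', sq]

end Exponents

/-! ### Density of Schwartz functions in Hˢ. -/

section Schwartz

open SchwartzMap

lemma hasTemperateGrowth_weight (t : ℝ) : Function.HasTemperateGrowth
    fun ξ : Rn n => (((1 + (2 * Real.pi * ‖ξ‖) ^ 2) ^ t : ℝ) : ℂ) := by
  have h : Function.HasTemperateGrowth fun ξ : Rn n => (1 + (2 * Real.pi * ‖ξ‖) ^ 2) ^ t := by
    have h := (Function.hasTemperateGrowth_one_add_norm_sq_rpow (Rn n) t).comp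
      (f := fun x : Rn n => (2 * Real.pi) • x) (by fun_prop)
    have e : (fun ξ : Rn n => (1 + (2 * Real.pi * ‖ξ‖) ^ 2) ^ t) =
        (fun x : Rn n => (1 + ‖x‖ ^ 2) ^ t) ∘ fun x : Rn n => (2 * Real.pi) • x := by
      ext ξ
      simp [norm_smul, abs_of_pos Real.pi_pos]
    rw [e]
    exact h
  exact Complex.ofRealCLM.hasTemperateGrowth.comp h

/-- Multiplication of a Schwartz function by a power of the weight `1 + |2πξ|²`. -/
def weightS (t : ℝ) : 𝓢(Rn n, ℂ) →L[ℂ] 𝓢(Rn n, ℂ) :=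
  SchwartzMap.smulLeftCLM ℂ fun ξ : Rn n => (((1 + (2 * Real.pi * ‖ξ‖) ^ 2) ^ t : ℝ) : ℂ)

lemma weightS_apply (t : ℝ) (φ : 𝓢(Rn n, ℂ)) (ξ : Rn n) :
    weightS t φ ξ = (((1 + (2 * Real.pi * ‖ξ‖) ^ 2) ^ t : ℝ) : ℂ) * φ ξ :=
  SchwartzMap.smulLeftCLM_apply_apply (hasTemperateGrowth_weight t) φ ξ

lemma weightS_weightS_neg (t : ℝ) (φ : 𝓢(Rn n, ℂ)) : weightS t (weightS (-t) φ) = φ := by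
  ext ξ
  rw [weightS_apply, weightS_apply, ← mul_assoc, ← Complex.ofReal_mul,
    ← Real.rpow_add (by positivity)]
  simp

lemma bessel_schwartz (t : ℝ) (φ : 𝓢(Rn n, ℂ)) :
    bessel t (φ.toLp 2 : Lp ℂ 2 (volume : Measure (Rn n))) =ᵐ[volume] weightS (t / 2) (𝓕 φ) := by
  filter_upwards [(𝓕 φ).coeFn_toLp 2 volume] with ξ hξ
  rw [bessel, SchwartzMap.toLp_fourier_eq, hξ, weightS_apply, smul_eq_mul]

lemma memLp_bessel_schwartz (t : ℝ) (φ : 𝓢(Rn n, ℂ)) :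
    MemLp (bessel t (φ.toLp 2 : Lp ℂ 2 (volume : Measure (Rn n)))) 2 volume := by
  have h : MemLp (weightS (t / 2) (𝓕 φ)) 2 volume := SchwartzMap.memLp _ 2 volume
  exact (memLp_congr_ae (bessel_schwartz t φ)).2 h

/-- Schwartz functions lie in `Hˢ`. -/
def Hs.ofSchwartz (s : ℝ) (φ : 𝓢(Rn n, ℂ)) : Hs n s :=
  (⟨φ.toLp 2 volume, memLp_bessel_schwartz s φ⟩ : hsSubmodule n s)

lemma Hs.fn_ofSchwartz (φ : 𝓢(Rn n, ℂ)) : (Hs.ofSchwartz s φ).fn =ᵐ[volume] φ :=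
  φ.coeFn_toLp 2 volume

/-- The isometry onto L² and its inverse act on Schwartz functions by the Fourier transform and by
powers of the weight, both of which preserve the Schwartz class. Density in L² therefore transfers.
-/
lemma Hs.denseRange_ofSchwartz (hs0 : 0 ≤ s) : DenseRange (Hs.ofSchwartz (n := n) s) := by
  have h1 : DenseRange (SchwartzMap.toLpCLM ℂ (E := Rn n) ℂ 2 volume) :=
    SchwartzMap.denseRange_toLpCLM ENNReal.ofNat_ne_top
  have h2 : DenseRange fun φ : 𝓢(Rn n, ℂ) => (Hs.weightedₗᵢ n hs0).symm (φ.toLp 2) :=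
    (Hs.weightedₗᵢ n hs0).symm.surjective.denseRange.comp h1 (LinearIsometryEquiv.continuous _)
  refine h2.mono ?_
  rintro _ ⟨φ, rfl⟩
  refine ⟨𝓕⁻ (weightS (-(s / 2)) φ), ?_⟩
  rw [LinearIsometryEquiv.eq_symm_apply]
  refine Lp.ext ?_
  refine (MemLp.coeFn_toLp (Hs.memLp_bessel _)).trans ?_
  refine (bessel_schwartz s _).trans ?_
  rw [FourierTransform.fourier_fourierInv_eq, weightS_weightS_neg]
  exact (φ.coeFn_toLp 2 volume).symm

end Schwartz

end

end FracMag

namespace FracMag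

noncomputable section

variable {n : ℕ} {s : ℝ}

/-! ### Bilinear pairings and bounded operators from Hˢ to L². -/

section Dot

lemma dot_add_left (a b c : Cn n) : dot (a + b) c = dot a c + dot b c := by
  simp [dot, add_mul, Finset.sum_add_distrib]

lemma dot_add_right (a b c : Cn n) : dot a (b + c) = dot a b + dot a c := by
  simp [dot, mul_add, Finset.sum_add_distrib]

lemma dot_smul_left (k : ℂ) (a b : Cn n) : dot (k • a) b = k * dot a b := by
  simp [dot, Finset.mul_sum, mul_assoc]

lemma dot_smul_right (k : ℂ) (a b : Cn n) : dot a (k • b) = k * dot a b := by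
  simp [dot, Finset.mul_sum, mul_left_comm]

lemma dot_comm (a b : Cn n) : dot a b = dot b a := by
  simp [dot, mul_comm]

/-- Componentwise complex conjugation on `ℂⁿ`. -/
def conjCn (a : Cn n) : Cn n := WithLp.toLp 2 fun j => starRingEnd ℂ (a j)

lemma norm_conjCn (a : Cn n) : ‖conjCn a‖ = ‖a‖ := by
  simp [conjCn, EuclideanSpace.norm_eq]

lemma dot_eq_inner (a b : Cn n) : dot a b = inner ℂ (conjCn a) b := by
  simp [dot, conjCn, PiLp.inner_apply, mul_comm]

lemma conjCn_conjCn (a : Cn n) : conjCn (conjCn a) = a := by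
  ext j; simp [conjCn]

lemma norm_dot_le (a b : Cn n) : ‖dot a b‖ ≤ ‖a‖ * ‖b‖ := by
  rw [dot_eq_inner, ← norm_conjCn a]
  exact norm_inner_le_norm _ _

lemma dot_conjCn_self (a : Cn n) : dot a (conjCn a) = ((‖a‖ ^ 2 : ℝ) : ℂ) := by
  rw [dot_comm, dot_eq_inner, conjCn_conjCn, inner_self_eq_norm_sq_to_K]
  norm_num

/-- The bilinear dot product as a bounded bilinear map. -/
def dotL (n : ℕ) : Cn n →L[ℂ] Cn n →L[ℂ] ℂ :=
  (LinearMap.mk₂ ℂ dot dot_add_left dot_smul_left dot_add_right dot_smul_right).mkContinuous₂ 1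
    fun a b => by rw [one_mul]; exact norm_dot_le a b

lemma dotL_apply (a b : Cn n) : dotL n a b = dot a b := rfl

lemma continuous_dot : Continuous fun p : Cn n × Cn n => dot p.1 p.2 :=
  (dotL n).continuous₂

/-- The bilinear pairing of `L²` vector fields. -/
def pairL {X : Type*} [MeasurableSpace X] (μ : Measure X) (n : ℕ) :
    Lp (Cn n) 2 μ →L[ℂ] Lp (Cn n) 2 μ →L[ℂ] ℂ :=
  ContinuousLinearMap.lpPairing μ 2 2 (dotL n)

lemma pairL_eq {X : Type*} [MeasurableSpace X] {μ : Measure X} {f g : Lp (Cn n) 2 μ}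
    {f' g' : X → Cn n} (hf : f =ᵐ[μ] f') (hg : g =ᵐ[μ] g') :
    pairL μ n f g = ∫ x, dot (f' x) (g' x) ∂μ := by
  rw [pairL, ContinuousLinearMap.lpPairing_eq_integral]
  refine integral_congr_ae ?_
  filter_upwards [hf, hg] with x h1 h2
  rw [h1, h2, dotL_apply]

lemma integrable_dot {X : Type*} [MeasurableSpace X] {μ : Measure X} {f g : X → Cn n}
    (hf : MemLp f 2 μ) (hg : MemLp g 2 μ) : Integrable (fun x => dot (f x) (g x)) μ := by
  have h1 : Integrable (fun x => ‖f x‖ * ‖g x‖) μ := hf.norm.integrable_mul hg.norm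
  have h2 : AEStronglyMeasurable (fun x => dot (f x) (g x)) μ :=
    continuous_dot.comp_aestronglyMeasurable (g := fun p : Cn n × Cn n => dot p.1 p.2)
      (f := fun x => (f x, g x)) (hf.1.prodMk hg.1)
  refine h1.mono' h2 ?_
  exact Eventually.of_forall fun x => norm_dot_le _ _

end Dot

section ToL2

/-- The gradient and both multiplications by a field are packaged as continuous operators in this
way, so forms built from them are continuous and can be checked on dense sets. -/
lemma exists_toL2 {X E : Type*} [MeasurableSpace X] {μ : Measure X} [NormedAddCommGroup E]
    [NormedSpace ℂ E] (T : Hs n s → X → E) (hadd : ∀ u v, T (u + v) =ᵐ[μ] T u + T v)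
    (hsmul : ∀ (c : ℂ) u, T (c • u) =ᵐ[μ] c • T u) (hm : ∀ u, AEStronglyMeasurable (T u) μ)
    (hb : ∃ C : ℝ, 0 ≤ C ∧ ∀ u, ∫⁻ x, ‖T u x‖ₑ ^ 2 ∂μ ≤ ENNReal.ofReal C * ‖u‖ₑ ^ 2) :
    ∃ L : Hs n s →L[ℂ] Lp E 2 μ, ∀ u, L u =ᵐ[μ] T u := by
  obtain ⟨C, hC0, hC⟩ := hb
  have hmem : ∀ u, MemLp (T u) 2 μ := fun u => (memLp_two_iff_lintegral (hm u)).2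
    ((hC u).trans_lt (ENNReal.mul_lt_top ENNReal.ofReal_lt_top (ENNReal.pow_lt_top enorm_lt_top)))
  let L₀ : Hs n s →ₗ[ℂ] Lp E 2 μ :=
    { toFun := fun u => (hmem u).toLp (T u)
      map_add' := fun u v => by
        rw [← MemLp.toLp_add]
        exact (MemLp.toLp_eq_toLp_iff _ _).2 (hadd u v)
      map_smul' := fun c u => by
        rw [RingHom.id_apply, ← MemLp.toLp_const_smul]
        exact (MemLp.toLp_eq_toLp_iff _ _).2 (hsmul c u) }
  refine ⟨L₀.mkContinuous (Real.sqrt C) fun u => ?_, fun u => (hmem u).coeFn_toLp⟩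
  have h1 : ‖L₀ u‖ₑ ^ 2 = ∫⁻ x, ‖T u x‖ₑ ^ 2 ∂μ := by
    rw [Lp.enorm_def, eLpNorm_two_sq]
    refine lintegral_congr_ae ?_
    filter_upwards [(hmem u).coeFn_toLp] with x hx
    rw [← hx]; rfl
  have h2 := hC u
  rw [← h1, ← ofReal_norm, ← ofReal_norm, ← ENNReal.ofReal_pow (norm_nonneg _),
    ← ENNReal.ofReal_pow (norm_nonneg _), ← ENNReal.ofReal_mul hC0,
    ENNReal.ofReal_le_ofReal_iff (by positivity)] at h2
  rw [← Real.sqrt_sq (norm_nonneg u), ← Real.sqrt_mul hC0]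
  exact Real.le_sqrt_of_sq_le h2

end ToL2

section Grad

lemma fracGrad_add (u v : Rn n → ℂ) : fracGrad n s (u + v) = fracGrad n s u + fracGrad n s v := by
  ext1 z
  simp only [fracGrad, Pi.add_apply, ← add_smul]
  congr 1
  ring

lemma fracGrad_smul (c : ℂ) (u : Rn n → ℂ) : fracGrad n s (c • u) = c • fracGrad n s u := by
  ext1 z
  simp only [fracGrad, Pi.smul_apply, smul_smul, smul_eq_mul, ← mul_sub]

lemma exists_gradL (hn : 1 ≤ n) (hs0 : 0 < s) (hs1 : s < 1) :
    ∃ L : Hs n s →L[ℂ] Lp (Cn n) 2 (volume : Measure (Rn n × Rn n)),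
      ∀ u, L u =ᵐ[volume] fracGrad n s u.fn := by
  obtain ⟨C, hC0, hC⟩ := exists_lintegral_fracGrad_sq_le (n := n) hn hs0 hs1
  refine exists_toL2 (fun u => fracGrad n s u.fn) (fun u v => ?_) (fun c u => ?_)
    (fun u => aestronglyMeasurable_fracGrad u.memLp.1) ⟨C, hC0.le, hC⟩
  · rw [← fracGrad_add]; exact fracGrad_congr (Hs.fn_add u v)
  · rw [← fracGrad_smul]; exact fracGrad_congr (Hs.fn_smul c u)

/-- The fractional gradient as a bounded map on `Hˢ`. -/
def gradL (hn : 1 ≤ n) (hs0 : 0 < s) (hs1 : s < 1) :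
    Hs n s →L[ℂ] Lp (Cn n) 2 (volume : Measure (Rn n × Rn n)) :=
  (exists_gradL hn hs0 hs1).choose

lemma gradL_ae (hn : 1 ≤ n) (hs0 : 0 < s) (hs1 : s < 1) (u : Hs n s) :
    gradL hn hs0 hs1 u =ᵐ[volume] fracGrad n s u.fn := (exists_gradL hn hs0 hs1).choose_spec u

lemma memLp_fracGrad (hn : 1 ≤ n) (hs0 : 0 < s) (hs1 : s < 1) (u : Hs n s) :
    MemLp (fracGrad n s u.fn) 2 volume :=
  (memLp_congr_ae (gradL_ae hn hs0 hs1 u)).1 (Lp.memLp _)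

end Grad

/-! ### Multiplication by the magnetic field. -/

section Mult

/-- Multiplication by the field `A`, in either variable, is bounded from `Hˢ(ℝⁿ)` to
`L²(ℝ²ⁿ)`. -/
structure IsMult (s : ℝ) (A : Rn n × Rn n → Cn n) : Prop where
  aesm : AEStronglyMeasurable A volume
  bound : ∃ C : ℝ, 0 ≤ C ∧ ∀ u : Hs n s,
    ∫⁻ z, ‖u.fn z.1 • A z‖ₑ ^ 2 ≤ ENNReal.ofReal C * ‖u‖ₑ ^ 2
  bound' : ∃ C : ℝ, 0 ≤ C ∧ ∀ u : Hs n s,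
    ∫⁻ z, ‖u.fn z.2 • A z‖ₑ ^ 2 ≤ ENNReal.ofReal C * ‖u‖ₑ ^ 2

lemma lintegral_swap_Rn {Φ : Rn n × Rn n → ℝ≥0∞} :
    ∫⁻ z : Rn n × Rn n, Φ z.swap = ∫⁻ z, Φ z :=
  (Measure.measurePreserving_swap (μ := (volume : Measure (Rn n)))
    (ν := (volume : Measure (Rn n)))).lintegral_comp_emb
      MeasurableEquiv.prodComm.measurableEmbedding Φ

lemma quasiMeasurePreserving_swap_Rn :
    Measure.QuasiMeasurePreserving (Prod.swap : Rn n × Rn n → Rn n × Rn n) volume volume :=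
  (Measure.measurePreserving_swap (μ := (volume : Measure (Rn n)))
    (ν := (volume : Measure (Rn n)))).quasiMeasurePreserving

lemma aestronglyMeasurable_comp_swap {E : Type*} [TopologicalSpace E] {A : Rn n × Rn n → E}
    (hA : AEStronglyMeasurable A volume) :
    AEStronglyMeasurable (fun z : Rn n × Rn n => A z.swap) volume :=
  hA.comp_quasiMeasurePreserving quasiMeasurePreserving_swap_Rn

lemma aestronglyMeasurable_smul_fst {u : Rn n → ℂ} {A : Rn n × Rn n → Cn n}
    (hu : AEStronglyMeasurable u volume) (hA : AEStronglyMeasurable A volume) :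
    AEStronglyMeasurable (fun z : Rn n × Rn n => u z.1 • A z) volume :=
  AEStronglyMeasurable.smul (𝕜 := ℂ) hu.comp_fst hA

lemma aestronglyMeasurable_smul_snd {u : Rn n → ℂ} {A : Rn n × Rn n → Cn n}
    (hu : AEStronglyMeasurable u volume) (hA : AEStronglyMeasurable A volume) :
    AEStronglyMeasurable (fun z : Rn n × Rn n => u z.2 • A z) volume :=
  AEStronglyMeasurable.smul (𝕜 := ℂ) hu.comp_snd hA

lemma IsMult.swap {A : Rn n × Rn n → Cn n} (hA : IsMult s A) : IsMult s fun z => A z.swap where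
  aesm := aestronglyMeasurable_comp_swap hA.aesm
  bound := by
    obtain ⟨C, hC0, hC⟩ := hA.bound'
    refine ⟨C, hC0, fun u => le_trans (le_of_eq ?_) (hC u)⟩
    exact lintegral_swap_Rn (Φ := fun z => ‖u.fn z.2 • A z‖ₑ ^ 2)
  bound' := by
    obtain ⟨C, hC0, hC⟩ := hA.bound
    refine ⟨C, hC0, fun u => le_trans (le_of_eq ?_) (hC u)⟩
    exact lintegral_swap_Rn (Φ := fun z => ‖u.fn z.1 • A z‖ₑ ^ 2)

lemma sq_smul_le_of_norm_le {a b c : Cn n} (h : ‖a‖ ≤ ‖b‖ + ‖c‖) (k : ℂ) :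
    ‖k • a‖ₑ ^ 2 ≤ 2 * ‖k • b‖ₑ ^ 2 + 2 * ‖k • c‖ₑ ^ 2 := by
  simp only [← ofReal_norm, ← ENNReal.ofReal_pow (norm_nonneg _)]
  have h2 : ∀ x : ℝ, (2 : ℝ≥0∞) * ENNReal.ofReal x = ENNReal.ofReal (2 * x) := fun x => by
    rw [ENNReal.ofReal_mul zero_le_two, ENNReal.ofReal_ofNat]
  rw [h2, h2, ← ENNReal.ofReal_add (by positivity) (by positivity)]
  refine ENNReal.ofReal_le_ofReal ?_
  simp only [norm_smul, mul_pow]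
  have h1 : ‖a‖ ^ 2 ≤ 2 * ‖b‖ ^ 2 + 2 * ‖c‖ ^ 2 := by
    have := pow_le_pow_left₀ (norm_nonneg a) h 2
    nlinarith [sq_nonneg (‖b‖ - ‖c‖)]
  nlinarith [mul_le_mul_of_nonneg_left h1 (sq_nonneg ‖k‖)]

/-- From (b + c)² ≤ 2b² + 2c². With `A'` the swapped field it covers the symmetric and antisymmetric
parts. -/
lemma IsMult.mono {A A' B : Rn n × Rn n → Cn n} (hA : IsMult s A) (hA' : IsMult s A')
    (hB : AEStronglyMeasurable B volume) (h : ∀ z, ‖B z‖ ≤ ‖A z‖ + ‖A' z‖) : IsMult s B where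
  aesm := hB
  bound := by
    obtain ⟨C, hC0, hC⟩ := hA.bound
    obtain ⟨C', hC0', hC'⟩ := hA'.bound
    refine ⟨2 * C + 2 * C', by positivity, fun u => ?_⟩
    refine (lintegral_mono fun z => sq_smul_le_of_norm_le (h z) (u.fn z.1)).trans ?_
    rw [lintegral_add_right' _ (((aestronglyMeasurable_smul_fst u.memLp.1
      hA'.aesm).enorm.pow_const 2).const_mul _), lintegral_const_mul' _ _ (by simp),
      lintegral_const_mul' _ _ (by simp), ENNReal.ofReal_add (by positivity) (by positivity),
      add_mul, ENNReal.ofReal_mul zero_le_two, ENNReal.ofReal_mul zero_le_two,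
      ENNReal.ofReal_ofNat, mul_assoc, mul_assoc]
    gcongr
    · exact hC u
    · exact hC' u
  bound' := by
    obtain ⟨C, hC0, hC⟩ := hA.bound'
    obtain ⟨C', hC0', hC'⟩ := hA'.bound'
    refine ⟨2 * C + 2 * C', by positivity, fun u => ?_⟩
    refine (lintegral_mono fun z => sq_smul_le_of_norm_le (h z) (u.fn z.2)).trans ?_
    rw [lintegral_add_right' _ (((aestronglyMeasurable_smul_snd u.memLp.1
      hA'.aesm).enorm.pow_const 2).const_mul _), lintegral_const_mul' _ _ (by simp),
      lintegral_const_mul' _ _ (by simp), ENNReal.ofReal_add (by positivity) (by positivity),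
      add_mul, ENNReal.ofReal_mul zero_le_two, ENNReal.ofReal_mul zero_le_two,
      ENNReal.ofReal_ofNat, mul_assoc, mul_assoc]
    gcongr
    · exact hC u
    · exact hC' u

lemma IsMult.exists_mulL₁ {A : Rn n × Rn n → Cn n} (hA : IsMult s A) :
    ∃ L : Hs n s →L[ℂ] Lp (Cn n) 2 (volume : Measure (Rn n × Rn n)),
      ∀ u, L u =ᵐ[volume] fun z => u.fn z.1 • A z := by
  refine exists_toL2 (fun u z => u.fn z.1 • A z) (fun u v => ?_) (fun c u => ?_)
    (fun u => aestronglyMeasurable_smul_fst u.memLp.1 hA.aesm) hA.bound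
  · filter_upwards [Measure.quasiMeasurePreserving_fst.ae (Hs.fn_add u v)] with z hz
    rw [hz, Pi.add_apply, Pi.add_apply, add_smul]
  · filter_upwards [Measure.quasiMeasurePreserving_fst.ae (Hs.fn_smul c u)] with z hz
    rw [hz, Pi.smul_apply, Pi.smul_apply, smul_eq_mul, mul_smul]

lemma IsMult.exists_mulL₂ {A : Rn n × Rn n → Cn n} (hA : IsMult s A) :
    ∃ L : Hs n s →L[ℂ] Lp (Cn n) 2 (volume : Measure (Rn n × Rn n)),
      ∀ u, L u =ᵐ[volume] fun z => u.fn z.2 • A z := by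
  refine exists_toL2 (fun u z => u.fn z.2 • A z) (fun u v => ?_) (fun c u => ?_)
    (fun u => aestronglyMeasurable_smul_snd u.memLp.1 hA.aesm) hA.bound'
  · filter_upwards [Measure.quasiMeasurePreserving_snd.ae (Hs.fn_add u v)] with z hz
    rw [hz, Pi.add_apply, Pi.add_apply, add_smul]
  · filter_upwards [Measure.quasiMeasurePreserving_snd.ae (Hs.fn_smul c u)] with z hz
    rw [hz, Pi.smul_apply, Pi.smul_apply, smul_eq_mul, mul_smul]

lemma IsMult.memLp₁ {A : Rn n × Rn n → Cn n} (hA : IsMult s A) (u : Hs n s) :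
    MemLp (fun z => u.fn z.1 • A z) 2 volume := by
  obtain ⟨L, hL⟩ := hA.exists_mulL₁
  exact (memLp_congr_ae (hL u)).1 (Lp.memLp _)

lemma IsMult.memLp₂ {A : Rn n × Rn n → Cn n} (hA : IsMult s A) (u : Hs n s) :
    MemLp (fun z => u.fn z.2 • A z) 2 volume := by
  obtain ⟨L, hL⟩ := hA.exists_mulL₂
  exact (memLp_congr_ae (hL u)).1 (Lp.memLp _)

lemma eLpNorm_sq_two_mul {X : Type*} [MeasurableSpace X] {μ : Measure X} {p : ℝ} (hp : 0 < p)
    (g : X → ℝ≥0∞) : eLpNorm (fun x => g x ^ 2) (ENNReal.ofReal p) μ =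
      eLpNorm g (2 * ENNReal.ofReal p) μ ^ 2 := by
  have h2 : 2 * ENNReal.ofReal p = ENNReal.ofReal (2 * p) := by
    rw [ENNReal.ofReal_mul zero_le_two, ENNReal.ofReal_ofNat]
  rw [h2, eLpNorm_eq_lintegral_rpow_enorm_toReal (by simpa using hp) ENNReal.ofReal_ne_top,
    eLpNorm_eq_lintegral_rpow_enorm_toReal (by simpa using hp) ENNReal.ofReal_ne_top,
    ENNReal.toReal_ofReal hp.le, ENNReal.toReal_ofReal (by positivity),
    ← ENNReal.rpow_natCast, ← ENNReal.rpow_mul]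
  congr 1
  · refine lintegral_congr fun x => ?_
    rw [enorm_eq_self, enorm_eq_self, ← ENNReal.rpow_natCast, ← ENNReal.rpow_mul]
    norm_num
  · push_cast; field_simp

lemma lintegral_smul_fst_sq {u : Rn n → ℂ} {A : Rn n × Rn n → Cn n}
    (hu : AEStronglyMeasurable u volume) (hA : AEStronglyMeasurable A volume) :
    ∫⁻ z : Rn n × Rn n, ‖u z.1 • A z‖ₑ ^ 2 = ∫⁻ x, J2 A x ^ 2 * ‖u x‖ₑ ^ 2 := by
  rw [Measure.volume_eq_prod, lintegral_prod _
    ((aestronglyMeasurable_smul_fst hu hA).enorm.pow_const 2)]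
  refine lintegral_congr fun x => ?_
  simp only [enorm_smul, mul_pow]
  rw [lintegral_const_mul' _ _ (by finiteness), J2, eLpNorm_two_sq, mul_comm]

lemma memLp_J2_sq {A : Rn n × Rn n → Cn n} (h : MemLp (J2 A) (2 * pExp n s) volume) :
    AEMeasurable (fun x => J2 A x ^ 2) volume ∧
      eLpNorm (fun x => J2 A x ^ 2) (pExp n s) volume < ⊤ := by
  refine ⟨h.1.aemeasurable.pow_const 2, ?_⟩
  rw [pExp, eLpNorm_sq_two_mul pReal_pos]
  exact ENNReal.pow_lt_top h.2

/-- Integrating out y leaves ∫ (𝒥₂A)²|u|², the form of a potential in L^p. -/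
lemma exists_bound_of_memLp_J2 (hn : 1 ≤ n) (hs0 : 0 < s) {A : Rn n × Rn n → Cn n}
    (hA : AEStronglyMeasurable A volume) (h : MemLp (J2 A) (2 * pExp n s) volume) :
    ∃ C : ℝ, 0 ≤ C ∧ ∀ u : Hs n s,
      ∫⁻ z, ‖u.fn z.1 • A z‖ₑ ^ 2 ≤ ENNReal.ofReal C * ‖u‖ₑ ^ 2 := by
  obtain ⟨M, hM0, hM⟩ := Hs.exists_lintegral_mul_sq_le hn hs0 (memLp_J2_sq h).1
    (memLp_J2_sq h).2 one_pos
  refine ⟨1 + M, by positivity, fun u => ?_⟩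
  rw [lintegral_smul_fst_sq u.memLp.1 hA, ENNReal.ofReal_add zero_le_one hM0, add_mul]
  refine (hM u).trans ?_
  gcongr
  exact Hs.enorm_incl_le hs0.le u

/-- The bound with u(y) is the bound with u(x) for the swapped field, for which 𝒥₁A takes the place
of 𝒥₂A. -/
lemma isMult_of_memLp (hn : 1 ≤ n) (hs0 : 0 < s) {A : Rn n × Rn n → Cn n}
    (hA : AEStronglyMeasurable A volume) (h1 : MemLp (J1 A) (2 * pExp n s) volume)
    (h2 : MemLp (J2 A) (2 * pExp n s) volume) : IsMult s A where
  aesm := hA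
  bound := exists_bound_of_memLp_J2 hn hs0 hA h2
  bound' := by
    obtain ⟨C, hC0, hC⟩ := exists_bound_of_memLp_J2 hn hs0 (aestronglyMeasurable_comp_swap hA) h1
    refine ⟨C, hC0, fun u => le_trans (le_of_eq ?_) (hC u)⟩
    exact (lintegral_swap_Rn (Φ := fun z => ‖u.fn z.2 • A z‖ₑ ^ 2)).symm

end Mult

/-! ### Potentials as bounded bilinear forms. -/

section Form

/-- The integrand of the form given by an `L^p` potential is integrable. -/
lemma Hs.integrable_mul_mul (hn : 1 ≤ n) (hs0 : 0 < s) {g : Rn n → ℂ}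
    (hg : MemLp g (pExp n s) volume) (u v : Hs n s) :
    Integrable (fun x => g x * u.fn x * v.fn x) volume := by
  obtain ⟨C, hC0, hC⟩ := Hs.exists_lintegral_mul_le (n := n) hn hs0
  refine ⟨(hg.1.mul u.memLp.1).mul v.memLp.1, ?_⟩
  have h1 := hC (fun x => ‖g x‖ₑ) hg.1.enorm u v
  rw [hasFiniteIntegral_iff_enorm]
  simp only [enorm_mul, mul_assoc]
  refine h1.trans_lt ?_
  rw [eLpNorm_enorm]
  exact ENNReal.mul_lt_top hg.2 (ENNReal.mul_lt_top ENNReal.ofReal_lt_top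
    (ENNReal.mul_lt_top enorm_lt_top enorm_lt_top))

lemma Hs.exists_potL (hn : 1 ≤ n) (hs0 : 0 < s) {g : Rn n → ℂ}
    (hg : MemLp g (pExp n s) volume) :
    ∃ Q : Hs n s →L[ℂ] Hs n s →L[ℂ] ℂ, ∀ u v, Q u v = ∫ x, g x * u.fn x * v.fn x := by
  obtain ⟨C, hC0, hC⟩ := Hs.exists_lintegral_mul_le (n := n) hn hs0
  have hi := Hs.integrable_mul_mul hn hs0 hg
  let Q₀ : Hs n s →ₗ[ℂ] Hs n s →ₗ[ℂ] ℂ := LinearMap.mk₂ ℂ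
    (fun u v => ∫ x, g x * u.fn x * v.fn x)
    (fun u u' v => by
      rw [← integral_add (hi u v) (hi u' v)]
      refine integral_congr_ae ?_
      filter_upwards [Hs.fn_add u u'] with x hx
      rw [hx, Pi.add_apply]; ring)
    (fun c u v => by
      rw [smul_eq_mul, ← integral_const_mul]
      refine integral_congr_ae ?_
      filter_upwards [Hs.fn_smul c u] with x hx
      rw [hx, Pi.smul_apply, smul_eq_mul]; ring)
    (fun u v v' => by
      rw [← integral_add (hi u v) (hi u v')]
      refine integral_congr_ae ?_
      filter_upwards [Hs.fn_add v v'] with x hx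
      rw [hx, Pi.add_apply]; ring)
    (fun c u v => by
      rw [smul_eq_mul, ← integral_const_mul]
      refine integral_congr_ae ?_
      filter_upwards [Hs.fn_smul c v] with x hx
      rw [hx, Pi.smul_apply, smul_eq_mul]; ring)
  refine ⟨Q₀.mkContinuous₂ ((eLpNorm g (pExp n s) volume).toReal * C) fun u v => ?_,
    fun u v => rfl⟩
  have h1 := hC (fun x => ‖g x‖ₑ) hg.1.enorm u v
  rw [eLpNorm_enorm] at h1
  change ‖∫ x, g x * u.fn x * v.fn x‖ ≤ _
  refine (norm_integral_le_lintegral_norm _).trans ?_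
  refine ENNReal.toReal_le_of_le_ofReal (by positivity) ?_
  refine le_trans (le_of_eq (lintegral_congr fun x => ?_)) (h1.trans (le_of_eq ?_))
  · rw [ofReal_norm, enorm_mul, enorm_mul, mul_assoc]
  · rw [mul_assoc, mul_assoc, ENNReal.ofReal_mul ENNReal.toReal_nonneg,
      ENNReal.ofReal_toReal hg.2.ne, ENNReal.ofReal_mul hC0.le,
      ENNReal.ofReal_mul (norm_nonneg _), ofReal_norm, ofReal_norm]

end Form

end

end FracMag

namespace FracMag

noncomputable section

variable {n : ℕ} {s : ℝ}

/-! ### Abstract solvability of symmetric forms with a Gårding inequality. -/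

section Hilbert

variable {H : Type*} [NormedAddCommGroup H] [InnerProductSpace ℂ H] [CompleteSpace H]

/-- Sequential Banach-Alaoglu in the dual, carried back by the Riesz isomorphism. That isomorphism
is conjugate-linear, whence the conjugations. -/
lemma exists_weak_subseq [TopologicalSpace.SeparableSpace H] {w : ℕ → H} {M : ℝ}
    (hw : ∀ k, ‖w k‖ ≤ M) : ∃ (w₀ : H) (φ : ℕ → ℕ), StrictMono φ ∧
      ∀ ℓ : H →L[ℂ] ℂ, Tendsto (fun k => ℓ (w (φ k))) atTop (nhds (ℓ w₀)) := by
  obtain ⟨ψ, -, φ, hφ, hlim⟩ := WeakDual.isSeqCompact_closedBall ℂ H 0 M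
    (x := fun k => StrongDual.toWeakDual (InnerProductSpace.toDual ℂ H (w k))) (fun k => by
      simpa using hw k)
  refine ⟨(InnerProductSpace.toDual ℂ H).symm (WeakDual.toStrongDual ψ), φ, hφ, fun ℓ => ?_⟩
  set y := (InnerProductSpace.toDual ℂ H).symm ℓ with hy
  have h1 : ∀ v, ℓ v = inner ℂ y v := fun v => by
    rw [hy, InnerProductSpace.toDual_symm_apply]
  simp only [h1]
  have h2 := ((WeakDual.eval_continuous y).tendsto ψ).comp hlim
  have h3 := (Complex.continuous_conj.tendsto _).comp h2
  have h4 : ∀ k, (starRingEnd ℂ) (inner ℂ (w (φ k)) y) = inner ℂ y (w (φ k)) := fun k =>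
    inner_conj_symm _ _
  rw [← inner_conj_symm]
  simp only [← h4, InnerProductSpace.toDual_symm_apply]
  exact h3

/-- A bounded symmetric bilinear form which satisfies a Gårding inequality modulo a weakly
continuous perturbation, and which has a trivial kernel, is bounded below. -/
lemma exists_le_norm_form [TopologicalSpace.SeparableSpace H] {B : H →L[ℂ] H →L[ℂ] ℂ}
    (hsymm : ∀ u v, B u v = B v u) (hinj : ∀ u, B u = 0 → u = 0) {N : H → ℝ} {c K : ℝ}
    (hc : 0 < c) (hG : ∀ u, c * ‖u‖ ^ 2 ≤ K * ‖u‖ * ‖B u‖ + K * N u ^ 2)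
    (hN : ∀ w : ℕ → H, (∀ k, ‖w k‖ ≤ 1) →
      (∀ ℓ : H →L[ℂ] ℂ, Tendsto (fun k => ℓ (w k)) atTop (nhds 0)) →
      Tendsto (fun k => N (w k)) atTop (nhds 0)) :
    ∃ δ : ℝ, 0 < δ ∧ ∀ u, δ * ‖u‖ ≤ ‖B u‖ := by
  by_contra! hcon
  have h1 : ∀ k : ℕ, ∃ w : H, ‖w‖ = 1 ∧ ‖B w‖ ≤ 1 / ((k : ℝ) + 1) := by
    intro k
    obtain ⟨u, hu⟩ := hcon (1 / ((k : ℝ) + 1)) (by positivity)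
    have hu0 : u ≠ 0 := by rintro rfl; simp at hu
    have hpos : 0 < ‖u‖ := norm_pos_iff.2 hu0
    refine ⟨((‖u‖⁻¹ : ℝ) : ℂ) • u, ?_, ?_⟩
    · rw [norm_smul, Complex.norm_real, norm_inv, norm_norm, inv_mul_cancel₀ hpos.ne']
    · rw [map_smul, norm_smul, Complex.norm_real, norm_inv, norm_norm, inv_mul_le_iff₀ hpos,
        mul_comm]
      exact hu.le
  choose w hw1 hwB using h1
  obtain ⟨w₀, φ, hφ, hlim⟩ := exists_weak_subseq (fun k => (hw1 k).le)
  have hB0 : Tendsto (fun k => ‖B (w (φ k))‖) atTop (nhds 0) := by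
    refine squeeze_zero (fun _ => norm_nonneg _) (fun k => hwB (φ k)) ?_
    exact tendsto_one_div_add_atTop_nhds_zero_nat.comp hφ.tendsto_atTop
  -- For fixed v, symmetry bounds |B(v, w_k)| by ‖B w_k‖‖v‖, which tends to zero. The weak limit
  -- therefore lies in the kernel.
  have hw₀ : w₀ = 0 := by
    refine hinj _ (ContinuousLinearMap.ext fun v => ?_)
    have h2 := hlim (B v)
    have h3 : Tendsto (fun k => B v (w (φ k))) atTop (nhds 0) := by
      refine squeeze_zero_norm (a := fun k => ‖B (w (φ k))‖ * ‖v‖) (fun k => ?_) ?_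
      · rw [hsymm]; exact (B (w (φ k))).le_opNorm v
      · simpa using hB0.mul_const ‖v‖
    rw [hsymm, tendsto_nhds_unique h2 h3]
    rfl
  subst hw₀
  -- Now both terms on the right of the Gårding inequality vanish in the limit while the left side
  -- is `c` at unit vectors, contradicting c > 0.
  have hN0 := hN (fun k => w (φ k)) (fun k => (hw1 _).le) (fun ℓ => by simpa using hlim ℓ)
  have h5 : Tendsto (fun k => K * ‖w (φ k)‖ * ‖B (w (φ k))‖ + K * N (w (φ k)) ^ 2) atTop
      (nhds (K * 1 * 0 + K * 0 ^ 2)) := by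
    simp only [hw1]
    exact (hB0.const_mul _).add ((hN0.pow 2).const_mul _)
  have h6 : c ≤ K * 1 * 0 + K * 0 ^ 2 := by
    refine ge_of_tendsto' h5 fun k => ?_
    have := hG (w (φ k))
    rwa [hw1, one_pow, mul_one, ← hw1 (φ k)] at this
  simp at h6
  linarith

/-- The lower bound makes the range closed, and by symmetry a vector orthogonal to the range lies in
the kernel, which the lower bound makes trivial. -/
lemma surjective_form {B : H →L[ℂ] H →L[ℂ] ℂ} (hsymm : ∀ u v, B u v = B v u) {δ : ℝ}
    (hδ : 0 < δ) (hB : ∀ u, δ * ‖u‖ ≤ ‖B u‖) (ℓ : H →L[ℂ] ℂ) : ∃ u, B u = ℓ := by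
  set T : H →L⋆[ℂ] H :=
    ((InnerProductSpace.toDual ℂ H).symm.toContinuousLinearEquiv :
      StrongDual ℂ H →L⋆[ℂ] H).comp B with hT
  have hTi : ∀ u v, inner ℂ (T u) v = B u v := fun u v => InnerProductSpace.toDual_symm_apply
  have hanti : AntilipschitzWith (Real.toNNReal δ⁻¹) T := by
    refine AddMonoidHomClass.antilipschitz_of_bound T fun u => ?_
    have h1 : ‖T u‖ = ‖B u‖ := (InnerProductSpace.toDual ℂ H).symm.norm_map (B u)
    rw [h1, Real.coe_toNNReal _ (by positivity), ← div_eq_inv_mul, le_div_iff₀ hδ, mul_comm]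
    exact hB u
  have hcl : IsClosed (LinearMap.range (T : H →ₛₗ[starRingEnd ℂ] H) : Set H) := by
    have := hanti.isClosed_range T.uniformContinuous
    exact this
  have : CompleteSpace (LinearMap.range (T : H →ₛₗ[starRingEnd ℂ] H)) := hcl.completeSpace_coe
  have htop : LinearMap.range (T : H →ₛₗ[starRingEnd ℂ] H) = ⊤ := by
    rw [← Submodule.orthogonal_eq_bot_iff, Submodule.eq_bot_iff]
    intro y hy
    have h1 : B y = 0 := by
      ext u
      rw [hsymm, ← hTi]
      exact (Submodule.mem_orthogonal _ _).1 hy _ ⟨u, rfl⟩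
    have h2 := hB y
    rw [h1, norm_zero] at h2
    have h3 : ‖y‖ ≤ 0 := by nlinarith [norm_nonneg y]
    exact norm_le_zero_iff.1 h3
  obtain ⟨u, hu⟩ : (InnerProductSpace.toDual ℂ H).symm ℓ ∈
      LinearMap.range (T : H →ₛₗ[starRingEnd ℂ] H) := by rw [htop]; trivial
  exact ⟨u, (InnerProductSpace.toDual ℂ H).symm.injective hu⟩

end Hilbert

end

end FracMag

namespace FracMag

noncomputable section

variable {n : ℕ} {s : ℝ}

/-! ### Rellich compactness through the Fourier transform. -/

section Rellich

/-- The value at `ξ` of the Fourier transform of `1_Ω u`, as a functional of `u ∈ L²`. -/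
lemma exists_fourierL {Ω : Set (Rn n)} (hΩ : MeasurableSet Ω) (hΩf : volume Ω < ⊤) (ξ : Rn n) :
    ∃ ℓ : Lp ℂ 2 (volume : Measure (Rn n)) →L[ℂ] ℂ,
      ‖ℓ‖ ≤ Real.sqrt (volume Ω).toReal ∧ ∀ (u : Lp ℂ 2 (volume : Measure (Rn n)))
        (f : Rn n → ℂ), u =ᵐ[volume] f → (∀ᵐ x, x ∉ Ω → f x = 0) → ℓ u = 𝓕 f ξ := by
  set g : Rn n → ℂ := Ω.indicator fun x => (Real.fourierChar (inner ℝ x ξ) : ℂ) with hg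
  have hgn : ∀ x, ‖g x‖ₑ ^ 2 = Ω.indicator 1 x := by
    intro x
    by_cases hx : x ∈ Ω
    · rw [hg, Set.indicator_of_mem hx, Set.indicator_of_mem hx, ← ofReal_norm, Circle.norm_coe]
      simp
    · simp [hg, hx]
  have hgm : AEStronglyMeasurable g volume :=
    (Continuous.aestronglyMeasurable (by fun_prop)).indicator hΩ
  have hgi : ∫⁻ x, ‖g x‖ₑ ^ 2 = volume Ω := by
    simp only [hgn]; exact lintegral_indicator_one hΩ
  have hg2 : MemLp g 2 volume := (memLp_two_iff_lintegral hgm).2 (by rw [hgi]; exact hΩf)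
  refine ⟨innerSL ℂ (hg2.toLp g), ?_, fun u f huf hf => ?_⟩
  · rw [innerSL_apply_norm, Lp.norm_toLp]
    refine Real.le_sqrt_of_sq_le ?_
    rw [← ENNReal.toReal_pow, eLpNorm_two_sq, hgi]
  · rw [innerSL_apply_apply, L2.inner_def, Real.fourier_eq]
    refine integral_congr_ae ?_
    filter_upwards [huf, hf, hg2.coeFn_toLp] with x h1 h2 h3
    rw [h3, h1]
    by_cases hx : x ∈ Ω
    · rw [hg, Set.indicator_of_mem hx, RCLike.inner_apply, ← Circle.coe_inv_eq_conj,
        Circle.smul_def, smul_eq_mul, ← AddChar.map_neg_eq_inv, mul_comm]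
    · rw [h2 hx]; simp

/-- A bounded weakly null sequence in `H̃ˢ(Ω)`, with `Ω` bounded, converges to zero in `L²`. -/
lemma HsTilde.tendsto_norm_incl (hs0 : 0 < s) {Ω : Set (Rn n)} (hΩ : MeasurableSet Ω)
    (hΩf : volume Ω < ⊤) {w : ℕ → Hs n s} (hw : ∀ k, w k ∈ HsTilde n s Ω) (hw1 : ∀ k, ‖w k‖ ≤ 1)
    (hlim : ∀ ℓ : Hs n s →L[ℂ] ℂ, Tendsto (fun k => ℓ (w k)) atTop (nhds 0)) :
    Tendsto (fun k => ‖Hs.incl n s (w k)‖) atTop (nhds 0) := by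
  choose ℓ hℓn hℓ using fun ξ : Rn n => exists_fourierL hΩ hΩf ξ
  have hae : ∀ k, ∀ᵐ x, x ∉ Ω → (w k).fn x = 0 := fun k => HsTilde.ae_eq_zero hs0.le hΩ (hw k)
  have hint : ∀ k, Integrable (w k).fn volume := by
    intro k
    have h1 : IntegrableOn (w k).fn Ω volume := by
      have : IsFiniteMeasure (volume.restrict Ω) := ⟨by simpa using hΩf⟩
      exact ((w k).memLp.restrict Ω).integrable one_le_two
    refine (integrable_indicator_iff hΩ).2 h1 |>.congr ?_
    filter_upwards [hae k] with x hx
    by_cases hxΩ : x ∈ Ω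
    · rw [Set.indicator_of_mem hxΩ]
    · rw [Set.indicator_of_notMem hxΩ, hx hxΩ]
  have hhat : ∀ k, (w k).hat =ᵐ[volume] fun ξ => ℓ ξ (Hs.incl n s (w k)) := by
    intro k
    have h1 := fourier_toLp_ae_eq (hint k) (w k).memLp
    rw [Hs.toLp_fn] at h1
    filter_upwards [h1] with ξ hξ
    rw [Hs.hat, hξ, hℓ ξ _ _ (Filter.EventuallyEq.refl _ _) (hae k)]
    rfl
  set V : ℝ := Real.sqrt (volume Ω).toReal with hV
  have hbd : ∀ k ξ, ‖ℓ ξ (Hs.incl n s (w k))‖ ≤ V := by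
    intro k ξ
    refine ((ℓ ξ).le_opNorm _).trans ?_
    have := (Hs.norm_incl_le hs0.le (w k)).trans (hw1 k)
    calc ‖ℓ ξ‖ * ‖Hs.incl n s (w k)‖ ≤ V * 1 := by
          exact mul_le_mul (hℓn ξ) this (norm_nonneg _) (Real.sqrt_nonneg _)
      _ = V := mul_one V
  -- Evaluation of the transform at ξ is a bounded functional because Ω has finite measure, so weak
  -- convergence gives pointwise convergence of the transforms. Together with the uniform bound V
  -- this allows dominated convergence on every frequency ball.
  have hpt : ∀ ξ, Tendsto (fun k => ℓ ξ (Hs.incl n s (w k))) atTop (nhds 0) := fun ξ =>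
    hlim ((ℓ ξ).comp (Hs.inclL n hs0.le))
  have hball : ∀ R : ℝ, Tendsto (fun k => ∫⁻ ξ in Metric.closedBall 0 R, ‖(w k).hat ξ‖ₑ ^ 2)
      atTop (nhds 0) := by
    intro R
    have h0 : (0 : ℝ≥0∞) = ∫⁻ ξ in Metric.closedBall (0 : Rn n) R, 0 := by simp
    rw [h0]
    refine tendsto_lintegral_of_dominated_convergence' (fun _ => ENNReal.ofReal (V ^ 2))
      (fun k => (measurable_enorm_Lp_sq _).aemeasurable) (fun k => ?_) ?_ ?_
    · refine ae_restrict_of_ae ?_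
      filter_upwards [hhat k] with ξ hξ
      rw [hξ, ← ofReal_norm, ← ENNReal.ofReal_pow (norm_nonneg _)]
      exact ENNReal.ofReal_le_ofReal (pow_le_pow_left₀ (norm_nonneg _) (hbd k ξ) 2)
    · rw [lintegral_const, Measure.restrict_apply_univ]
      exact ENNReal.mul_ne_top ENNReal.ofReal_ne_top measure_closedBall_lt_top.ne
    · refine ae_restrict_of_ae ?_
      filter_upwards [ae_all_iff.2 hhat] with ξ hξ
      simp only [hξ]
      have := ENNReal.Tendsto.pow (n := 2) (hpt ξ).enorm
      simpa using this
  -- Outside the ball of radius R the weight is at least (1 + (2πR)²)ˢ, so the Hˢ bound makes the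
  -- tail small uniformly in k.
  have htail : ∀ (R : ℝ), 0 ≤ R → ∀ (k : ℕ), ‖Hs.incl n s (w k)‖ₑ ^ 2 ≤
      (∫⁻ ξ in Metric.closedBall 0 R, ‖(w k).hat ξ‖ₑ ^ 2) +
        ENNReal.ofReal ((1 + (2 * Real.pi * R) ^ 2) ^ (-s)) := by
    intro R hR k
    rw [Hs.enorm_incl_sq, ← Hs.lintegral_hat_sq, ← lintegral_add_compl _
      (Metric.isClosed_closedBall (x := (0 : Rn n)) (ε := R)).measurableSet]
    gcongr
    calc ∫⁻ ξ in (Metric.closedBall 0 R)ᶜ, ‖(w k).hat ξ‖ₑ ^ 2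
        ≤ ∫⁻ ξ in (Metric.closedBall 0 R)ᶜ, ENNReal.ofReal ((1 + (2 * Real.pi * R) ^ 2) ^ (-s)) *
          (ENNReal.ofReal ((1 + (2 * Real.pi * ‖ξ‖) ^ 2) ^ s) * ‖(w k).hat ξ‖ₑ ^ 2) := by
          refine setLIntegral_mono' (Metric.isClosed_closedBall.measurableSet.compl)
            fun ξ hξ => ?_
          rw [← mul_assoc, ← ENNReal.ofReal_mul (by positivity)]
          refine le_mul_of_one_le_left' ?_
          rw [← ENNReal.ofReal_one]
          refine ENNReal.ofReal_le_ofReal ?_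
          have hξR : R ≤ ‖ξ‖ := by
            simp only [Set.mem_compl_iff, mem_closedBall_zero_iff, not_le] at hξ
            exact hξ.le
          rw [Real.rpow_neg (by positivity), ← div_eq_inv_mul, le_div_iff₀ (by positivity),
            one_mul]
          refine Real.rpow_le_rpow (by positivity) ?_ hs0.le
          gcongr
      _ ≤ ∫⁻ ξ, ENNReal.ofReal ((1 + (2 * Real.pi * R) ^ 2) ^ (-s)) *
          (ENNReal.ofReal ((1 + (2 * Real.pi * ‖ξ‖) ^ 2) ^ s) * ‖(w k).hat ξ‖ₑ ^ 2) :=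
          setLIntegral_le_lintegral _ _
      _ = ENNReal.ofReal ((1 + (2 * Real.pi * R) ^ 2) ^ (-s)) * ‖w k‖ₑ ^ 2 := by
          rw [lintegral_const_mul' _ _ ENNReal.ofReal_ne_top, Hs.enorm_sq]
      _ ≤ ENNReal.ofReal ((1 + (2 * Real.pi * R) ^ 2) ^ (-s)) := by
          refine mul_le_of_le_one_right' (pow_le_one' ?_ 2)
          rw [← ofReal_norm, ← ENNReal.ofReal_one]
          exact ENNReal.ofReal_le_ofReal (hw1 k)
  have hR0 : Tendsto (fun R : ℝ => ENNReal.ofReal ((1 + (2 * Real.pi * R) ^ 2) ^ (-s))) atTop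
      (nhds 0) := by
    rw [← ENNReal.ofReal_zero]
    refine ENNReal.tendsto_ofReal ((tendsto_rpow_neg_atTop hs0).comp ?_)
    refine tendsto_atTop_add_const_left _ _ ((tendsto_pow_atTop two_ne_zero).comp ?_)
    exact tendsto_id.const_mul_atTop (by positivity)
  have hmain : Tendsto (fun k => ‖Hs.incl n s (w k)‖ₑ) atTop (nhds 0) := by
    rw [ENNReal.tendsto_nhds_zero]
    intro ε hε
    have hε2 : 0 < ε ^ 2 / 2 := ENNReal.half_pos (pow_ne_zero 2 hε.ne')
    obtain ⟨R, hR, hRpos⟩ := ((ENNReal.tendsto_nhds_zero.1 hR0 _ hε2).and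
      (eventually_ge_atTop 0)).exists
    filter_upwards [ENNReal.tendsto_nhds_zero.1 (hball R) _ hε2] with k hk
    have h1 := (htail R hRpos k).trans (add_le_add hk hR)
    rw [ENNReal.add_halves] at h1
    exact (ENNReal.pow_le_pow_left_iff two_ne_zero).1 h1
  have := (ENNReal.tendsto_toReal ENNReal.zero_ne_top).comp hmain
  simpa [Function.comp_def] using this

end Rellich

end

end FracMag

namespace FracMag

noncomputable section

variable {n : ℕ} {s : ℝ}

/-! ### The magnetic form and its Gårding inequality. -/

section Bform

lemma norm_pairL_le {X : Type*} [MeasurableSpace X] {μ : Measure X} (f g : Lp (Cn n) 2 μ) :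
    ‖pairL μ n f g‖ ≤ ‖f‖ * ‖g‖ := by
  have hd : ‖dotL n‖ ≤ 1 := LinearMap.mkContinuous₂_norm_le _ zero_le_one _
  have h1 : pairL μ n f g = ∫ x, (dotL n).holder 1 f g x ∂μ := by
    rw [pairL, ContinuousLinearMap.lpPairing_eq_integral]
    exact integral_congr_ae ((dotL n).coeFn_holder f g).symm
  rw [h1, ← L1.integral_eq_integral]
  refine (L1.norm_integral_le _).trans ?_
  refine ((dotL n).norm_holder_apply_apply_le f g).trans ?_
  rw [mul_assoc]
  exact mul_le_of_le_one_left (by positivity) hd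

lemma exists_magL (hn : 1 ≤ n) (hs0 : 0 < s) (hs1 : s < 1) {A : Rn n × Rn n → Cn n}
    (hA : IsMult s A) : ∃ L : Hs n s →L[ℂ] Lp (Cn n) 2 (volume : Measure (Rn n × Rn n)),
      ∀ u, L u =ᵐ[volume] magGrad n s A u.fn := by
  obtain ⟨L, hL⟩ := hA.exists_mulL₁
  refine ⟨gradL hn hs0 hs1 + L, fun u => ?_⟩
  filter_upwards [Lp.coeFn_add (gradL hn hs0 hs1 u) (L u), gradL_ae hn hs0 hs1 u, hL u]
    with z h1 h2 h3
  rw [_root_.add_apply, h1, Pi.add_apply, h2, h3, magGrad]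

lemma exists_bformL (hn : 1 ≤ n) (hs0 : 0 < s) (hs1 : s < 1) {A : Rn n × Rn n → Cn n}
    (hA : IsMult s A) {q : Rn n → ℝ} (hq : MemLp q (pExp n s) volume) :
    ∃ B : Hs n s →L[ℂ] Hs n s →L[ℂ] ℂ, ∀ u v, B u v = bform A q u v := by
  obtain ⟨L, hL⟩ := exists_magL hn hs0 hs1 hA
  obtain ⟨Q, hQ⟩ := Hs.exists_potL (n := n) hn hs0 (g := fun x => (q x : ℂ)) hq.ofReal
  refine ⟨(pairL volume n).bilinearComp L L + Q, fun u v => ?_⟩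
  rw [_root_.add_apply, _root_.add_apply,
    ContinuousLinearMap.bilinearComp_apply, pairL_eq (hL u) (hL v), hQ, bform]

lemma bform_comm (A : Rn n × Rn n → Cn n) (q : Rn n → ℝ) (u v : Hs n s) :
    bform A q u v = bform A q v u := by
  unfold bform
  congr 1
  · exact integral_congr_ae (Eventually.of_forall fun z => dot_comm _ _)
  · exact integral_congr_ae (Eventually.of_forall fun x => mul_right_comm _ _ _)

end Bform

section Garding

lemma le_of_ofReal_le {E F : Type*} [NormedAddCommGroup E] [NormedAddCommGroup F] {r ε M : ℝ}
    (hε : 0 ≤ ε) (hM : 0 ≤ M) {b : E} {c : F}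
    (h : ENNReal.ofReal r ≤ ENNReal.ofReal ε * ‖b‖ₑ ^ 2 + ENNReal.ofReal M * ‖c‖ₑ ^ 2) :
    r ≤ ε * ‖b‖ ^ 2 + M * ‖c‖ ^ 2 := by
  rw [← ofReal_norm b, ← ofReal_norm c, ← ENNReal.ofReal_pow (norm_nonneg _),
    ← ENNReal.ofReal_pow (norm_nonneg _), ← ENNReal.ofReal_mul hε, ← ENNReal.ofReal_mul hM,
    ← ENNReal.ofReal_add (by positivity) (by positivity)] at h
  exact (ENNReal.ofReal_le_ofReal_iff (by positivity)).1 h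

lemma enorm_sq_eq_ofReal {E : Type*} [NormedAddCommGroup E] (a : E) :
    ‖a‖ₑ ^ 2 = ENNReal.ofReal (‖a‖ ^ 2) := by
  rw [ENNReal.ofReal_pow (norm_nonneg _), ofReal_norm]

lemma fracGrad_conj (u : Rn n → ℂ) (z : Rn n × Rn n) :
    fracGrad n s (fun x => starRingEnd ℂ (u x)) z = conjCn (fracGrad n s u z) := by
  ext j
  simp [fracGrad, conjCn, toCn]

lemma enorm_Lp_two_sq {X E : Type*} [MeasurableSpace X] {μ : Measure X} [NormedAddCommGroup E]
    {f : Lp E 2 μ} {g : X → E} (h : f =ᵐ[μ] g) : ‖f‖ₑ ^ 2 = ∫⁻ x, ‖g x‖ₑ ^ 2 ∂μ := by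
  rw [Lp.enorm_def, eLpNorm_congr_ae h, eLpNorm_two_sq]

/-- Here 2Ga ≤ G²/2 + 2a² absorbs half of G², leaving G²/2 ≤ b + 3a² + q. The four resulting copies
of c/16 use up half of the coefficient c/2 of U². -/
lemma garding_arith {c U I G a b q M M' : ℝ} (h1 : c * U ^ 2 ≤ 1 * I ^ 2 + 1 * G ^ 2)
    (h2 : a ^ 2 ≤ c / 16 * U ^ 2 + M * I ^ 2) (h3 : q ≤ c / 16 * U ^ 2 + M' * I ^ 2)
    (h4 : G ^ 2 ≤ b + G * a + a * G + a * a + q) :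
    c / 4 * U ^ 2 ≤ b + (1 / 2 + 3 * M + M') * I ^ 2 := by
  linarith [sq_nonneg (G - 2 * a)]

-- The form is bilinear, so the conjugate of `u` is the right test function: the pure gradient term
-- becomes ‖∇ˢu‖². All terms containing `A` or `q` are controlled by form bounds with a small
-- multiple of ‖u‖².
set_option maxHeartbeats 1000000 in
lemma exists_garding (hn : 1 ≤ n) (hs0 : 0 < s) (hs1 : s < 1) {A : Rn n × Rn n → Cn n}
    {q : Rn n → ℝ} (hP : IsPotential₀ n s A q) :
    ∃ c K : ℝ, 0 < c ∧ 0 ≤ K ∧ ∀ u : Hs n s,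
      c * ‖u‖ ^ 2 ≤ ‖bform A q u (Hs.conj hn hs0 hs1 u)‖ + K * ‖Hs.incl n s u‖ ^ 2 := by
  obtain ⟨c, hc0, hc⟩ := exists_Hs_enorm_sq_le (n := n) hn hs0 hs1
  have hA : IsMult s A := isMult_of_memLp hn hs0 hP.aesm hP.memJ1 hP.memJ2
  obtain ⟨L, hL⟩ := hA.exists_mulL₁
  have hε : 0 < c / 16 := by positivity
  obtain ⟨M, hM0, hM⟩ := Hs.exists_lintegral_mul_sq_le hn hs0 (memLp_J2_sq hP.memJ2).1
    (memLp_J2_sq hP.memJ2).2 hε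
  obtain ⟨M', hM0', hM'⟩ := Hs.exists_lintegral_mul_sq_le hn hs0 (g := fun x => ‖q x‖ₑ)
    hP.memq.1.enorm (by rw [eLpNorm_enorm]; exact hP.memq.2) hε
  refine ⟨c / 4, 1 / 2 + 3 * M + M', by positivity, by positivity, fun u => ?_⟩
  set u' := Hs.conj hn hs0 hs1 u with hu'
  set g := gradL hn hs0 hs1 u
  set g' := gradL hn hs0 hs1 u'
  have hg : g =ᵐ[volume] fracGrad n s u.fn := gradL_ae hn hs0 hs1 u
  have hg' : g' =ᵐ[volume] fun z => conjCn (fracGrad n s u.fn z) := by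
    filter_upwards [gradL_ae hn hs0 hs1 u', fracGrad_congr (s := s) (Hs.fn_conj hn hs0 hs1 u)]
      with z h1 h2
    rw [h1, h2, fracGrad_conj]
  have ha' : L u' =ᵐ[volume] fun z => starRingEnd ℂ (u.fn z.1) • A z := by
    filter_upwards [hL u', Measure.quasiMeasurePreserving_fst.ae (Hs.fn_conj hn hs0 hs1 u)]
      with z h1 h2
    rw [h1, h2]
  have hgn : ‖g'‖ = ‖g‖ := by
    rw [Lp.norm_def, Lp.norm_def, eLpNorm_congr_ae hg, eLpNorm_congr_ae hg']
    congr 1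
    exact eLpNorm_congr_norm_ae (Eventually.of_forall fun z => norm_conjCn _)
  have han : ‖L u'‖ = ‖L u‖ := by
    rw [Lp.norm_def, Lp.norm_def, eLpNorm_congr_ae (hL u), eLpNorm_congr_ae ha']
    congr 1
    refine eLpNorm_congr_norm_ae (Eventually.of_forall fun z => ?_)
    rw [norm_smul, norm_smul, RCLike.norm_conj]
  have hgg : pairL volume n g g' = ((‖g‖ ^ 2 : ℝ) : ℂ) := by
    rw [pairL_eq hg hg']
    have h1 : inner ℂ g g = ((‖g‖ ^ 2 : ℝ) : ℂ) := by
      rw [inner_self_eq_norm_sq_to_K]; norm_num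
    rw [← h1, L2.inner_def]
    refine integral_congr_ae ?_
    filter_upwards [hg] with z hz
    rw [hz, dot_conjCn_self, inner_self_eq_norm_sq_to_K]
    norm_num
  have hmag : ∀ v : Hs n s, (gradL hn hs0 hs1 v + L v : Lp (Cn n) 2 volume) =ᵐ[volume]
      magGrad n s A v.fn := by
    intro v
    filter_upwards [Lp.coeFn_add (gradL hn hs0 hs1 v) (L v), gradL_ae hn hs0 hs1 v, hL v]
      with z h1 h2 h3
    rw [h1, Pi.add_apply, h2, h3, magGrad]
  set Q : ℂ := ∫ x, (q x : ℂ) * u.fn x * u'.fn x with hQ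
  have hB : bform A q u u' = ((‖g‖ ^ 2 : ℝ) : ℂ) + pairL volume n g (L u') +
      pairL volume n (L u) g' + pairL volume n (L u) (L u') + Q := by
    rw [bform, ← pairL_eq (hmag u) (hmag u'), ← hgg]
    simp only [map_add, _root_.add_apply]
    ring
  have hL2 : ‖L u‖ ^ 2 ≤ c / 16 * ‖u‖ ^ 2 + M * ‖Hs.incl n s u‖ ^ 2 := by
    refine le_of_ofReal_le hε.le hM0 ?_
    rw [← enorm_sq_eq_ofReal, enorm_Lp_two_sq (hL u), lintegral_smul_fst_sq u.memLp.1 hP.aesm]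
    exact hM u
  have hQ2 : ‖Q‖ ≤ c / 16 * ‖u‖ ^ 2 + M' * ‖Hs.incl n s u‖ ^ 2 := by
    refine le_of_ofReal_le hε.le hM0' ?_
    rw [ofReal_norm]
    refine (enorm_integral_le_lintegral_enorm _).trans (le_trans (le_of_eq ?_) (hM' u))
    refine lintegral_congr_ae ?_
    filter_upwards [Hs.fn_conj hn hs0 hs1 u] with x hx
    rw [hx, enorm_mul, enorm_mul, mul_assoc, sq, ← ofReal_norm (starRingEnd ℂ _),
      RCLike.norm_conj, ofReal_norm, ← ofReal_norm (q x : ℂ), Complex.norm_real, ofReal_norm]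
  have hg2 : c * ‖u‖ ^ 2 ≤ 1 * ‖Hs.incl n s u‖ ^ 2 + 1 * ‖g‖ ^ 2 := by
    refine le_of_ofReal_le zero_le_one zero_le_one ?_
    rw [ENNReal.ofReal_mul hc0.le, ← enorm_sq_eq_ofReal, ENNReal.ofReal_one, one_mul, one_mul,
      Hs.enorm_incl_sq, enorm_Lp_two_sq hg]
    exact hc u
  have h1 : ‖pairL volume n g (L u')‖ ≤ ‖g‖ * ‖L u‖ := han ▸ norm_pairL_le g (L u')
  have h2 : ‖pairL volume n (L u) g'‖ ≤ ‖L u‖ * ‖g‖ := hgn ▸ norm_pairL_le (L u) g'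
  have h3 : ‖pairL volume n (L u) (L u')‖ ≤ ‖L u‖ * ‖L u‖ := han ▸ norm_pairL_le (L u) (L u')
  have h4 : ‖g‖ ^ 2 ≤ ‖bform A q u u'‖ + ‖g‖ * ‖L u‖ + ‖L u‖ * ‖g‖ + ‖L u‖ * ‖L u‖ + ‖Q‖ := by
    have h5 : ((‖g‖ ^ 2 : ℝ) : ℂ) = bform A q u u' - pairL volume n g (L u') -
      pairL volume n (L u) g' - pairL volume n (L u) (L u') - Q := by rw [hB]; ring
    have h6 : ‖g‖ ^ 2 = ‖((‖g‖ ^ 2 : ℝ) : ℂ)‖ := by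
      rw [Complex.norm_real, Real.norm_of_nonneg (sq_nonneg _)]
    rw [h6, h5]
    refine (norm_sub_le _ _).trans (add_le_add ?_ le_rfl)
    refine (norm_sub_le _ _).trans (add_le_add ?_ h3)
    refine (norm_sub_le _ _).trans (add_le_add ?_ h2)
    exact (norm_sub_le _ _).trans (add_le_add le_rfl h1)
  exact garding_arith hg2 hL2 hQ2 h4

end Garding

/-! ### Well-posedness and the Dirichlet-to-Neumann map. -/

section WellPosed

/-- Injectivity makes the chosen preimages linear in the functional, and the lower bound makes them
bounded. -/
lemma exists_inverse_form {H : Type*} [NormedAddCommGroup H] [InnerProductSpace ℂ H]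
    [CompleteSpace H] {B : H →L[ℂ] H →L[ℂ] ℂ} (hsymm : ∀ u v, B u v = B v u)
    (hinj : ∀ u, B u = 0 → u = 0) {δ : ℝ} (hδ : 0 < δ) (hB : ∀ u, δ * ‖u‖ ≤ ‖B u‖) :
    ∃ S : (H →L[ℂ] ℂ) →L[ℂ] H, ∀ ℓ, B (S ℓ) = ℓ := by
  choose S₀ hS₀ using surjective_form hsymm hδ hB
  have hBinj : Function.Injective B := (injective_iff_map_eq_zero B).2 hinj
  let S₁ : (H →L[ℂ] ℂ) →ₗ[ℂ] H :=
    { toFun := S₀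
      map_add' := fun ℓ m => hBinj (by rw [map_add, hS₀, hS₀, hS₀])
      map_smul' := fun k ℓ => hBinj (by rw [map_smul, hS₀, hS₀, RingHom.id_apply]) }
  refine ⟨S₁.mkContinuous δ⁻¹ fun ℓ => ?_, hS₀⟩
  have := hB (S₀ ℓ)
  rwa [hS₀, ← le_div_iff₀' hδ, div_eq_inv_mul] at this

/-- Bounded solvability of a weak problem posed in a closed subspace. -/
lemma exists_solver_of_garding {H : Type*} [NormedAddCommGroup H] [InnerProductSpace ℂ H]
    [CompleteSpace H] [SecondCountableTopology H] {T : Submodule ℂ H}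
    (hT : IsClosed (T : Set H)) {B : H →L[ℂ] H →L[ℂ] ℂ} (hsymm : ∀ u v, B u v = B v u)
    (hinj : ∀ w ∈ T, (∀ v ∈ T, B w v = 0) → w = 0) {N : H → ℝ} {c C K : ℝ} (hc : 0 < c)
    (hC : 0 ≤ C) (hK : 0 ≤ K)
    (hG : ∀ u ∈ T, ∃ v ∈ T, ‖v‖ ≤ C * ‖u‖ ∧ c * ‖u‖ ^ 2 ≤ ‖B u v‖ + K * N u ^ 2)
    (hN : ∀ w : ℕ → H, (∀ k, w k ∈ T) → (∀ k, ‖w k‖ ≤ 1) →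
      (∀ ℓ : H →L[ℂ] ℂ, Tendsto (fun k => ℓ (w k)) atTop (nhds 0)) →
      Tendsto (fun k => N (w k)) atTop (nhds 0)) :
    ∃ P : H →L[ℂ] H, ∀ f, f - P f ∈ T ∧ ∀ v ∈ T, B (P f) v = 0 := by
  have : CompleteSpace T := hT.completeSpace_coe
  obtain ⟨b, hbB⟩ : ∃ b : T →L[ℂ] T →L[ℂ] ℂ, ∀ u v : T, b u v = B u v :=
    ⟨B.bilinearComp T.subtypeL T.subtypeL, fun u v => rfl⟩
  have hsymmb : ∀ u v, b u v = b v u := fun u v => by rw [hbB, hbB, hsymm]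
  have hinjb : ∀ u, b u = 0 → u = 0 := by
    intro u hu
    refine Subtype.ext (hinj u u.2 fun v hv => ?_)
    exact (hbB u ⟨v, hv⟩).symm.trans (DFunLike.congr_fun hu (⟨v, hv⟩ : T))
  -- A test vector of norm at most C‖u‖ bounds the form by C‖u‖‖b u‖. The constant C + K serves both
  -- terms of the abstract inequality.
  obtain ⟨δ, hδ, hbelow⟩ := exists_le_norm_form hsymmb hinjb (N := fun u : T => N u) hc
    (K := C + K) (fun u => by
      obtain ⟨v, hv, hv1, hv2⟩ := hG u u.2
      have h1 : ‖B u v‖ ≤ ‖b u‖ * (C * ‖u‖) := by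
        rw [← hbB u ⟨v, hv⟩]
        exact ((b u).le_opNorm ⟨v, hv⟩).trans
          (mul_le_mul_of_nonneg_left hv1 (norm_nonneg (b u)))
      have h2 : 0 ≤ K * ‖u‖ * ‖b u‖ := by positivity
      have h3 : 0 ≤ C * N u ^ 2 := by positivity
      have h4 : c * ‖u‖ ^ 2 ≤ ‖B u v‖ + K * N u ^ 2 := hv2
      linarith)
    (fun w hw1 hlim => hN (fun k => w k) (fun k => (w k).2) hw1 fun ℓ => hlim (ℓ.comp T.subtypeL))
  obtain ⟨S, hS⟩ := exists_inverse_form hsymmb hinjb hδ hbelow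
  obtain ⟨R, hR⟩ : ∃ R : H →L[ℂ] (T →L[ℂ] ℂ), ∀ f (v : T), R f v = B f v :=
    ⟨B.bilinearComp (ContinuousLinearMap.id ℂ H) T.subtypeL, fun f v => rfl⟩
  -- The solution is `f` corrected by the element of `T` that represents the functional B(f, ·)
  -- restricted to `T`.
  obtain ⟨P, hP⟩ : ∃ P : H →L[ℂ] H, ∀ f, P f = f - (S (R f) : H) :=
    ⟨ContinuousLinearMap.id ℂ H - T.subtypeL.comp (S.comp R), fun f => rfl⟩
  refine ⟨P, fun f => ⟨?_, fun v hv => ?_⟩⟩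
  · rw [hP, sub_sub_cancel]
    exact (S (R f)).2
  · rw [hP, map_sub, _root_.sub_apply, ← hR f ⟨v, hv⟩, ← hbB (S (R f)) ⟨v, hv⟩, hS, sub_self]

lemma Hs.secondCountableTopology (hs0 : 0 ≤ s) : SecondCountableTopology (Hs n s) :=
  have : Fact ((2 : ℝ≥0∞) ≠ ⊤) := ⟨ENNReal.ofNat_ne_top⟩
  (Hs.weightedₗᵢ n hs0).toHomeomorph.secondCountableTopology

/-- Bounded solvability of the weak problem with exterior values. -/
lemma exists_solver (hn : 1 ≤ n) (hs0 : 0 < s) (hs1 : s < 1) {Ω : Set (Rn n)} (hΩ : IsOpen Ω)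
    (hΩb : Bornology.IsBounded Ω) {A : Rn n × Rn n → Cn n} {q : Rn n → ℝ}
    (hP : IsPotential₀ n s A q) (h0 : ZeroNotEigenvalue n s Ω A q)
    {B : Hs n s →L[ℂ] Hs n s →L[ℂ] ℂ} (hB : ∀ u v, B u v = bform A q u v) :
    ∃ P : Hs n s →L[ℂ] Hs n s, ∀ f, f - P f ∈ HsTilde n s Ω ∧
      ∀ v ∈ HsTilde n s Ω, B (P f) v = 0 := by
  obtain ⟨c, K, hc, hK, hG⟩ := exists_garding hn hs0 hs1 hP
  obtain ⟨C, hC0, hC⟩ := Hs.exists_norm_conj_le (n := n) hn hs0 hs1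
  let := Hs.innerProductSpace n s
  have := Hs.completeSpace (n := n) hs0.le
  have := Hs.secondCountableTopology (n := n) hs0.le
  exact exists_solver_of_garding (T := HsTilde n s Ω) (Submodule.isClosed_topologicalClosure _)
    (fun u v => by rw [hB, hB, bform_comm])
    (fun w hw hwv => h0 w hw fun v hv => by rw [← hB]; exact hwv v hv)
    (N := fun u => ‖Hs.incl n s u‖) hc hC0.le hK
    (fun u hu => ⟨_, Hs.conj_mem_HsTilde hn hs0 hs1 hu, hC u, by rw [hB]; exact hG u⟩)
    (fun w hw hw1 hlim => HsTilde.tendsto_norm_incl hs0 hΩ.measurableSet hΩb.measure_lt_top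
      hw hw1 hlim)

lemma IsSolution.unique {Ω : Set (Rn n)} {A : Rn n × Rn n → Cn n} {q : Rn n → ℝ}
    (h0 : ZeroNotEigenvalue n s Ω A q) {B : Hs n s →L[ℂ] Hs n s →L[ℂ] ℂ}
    (hB : ∀ u v, B u v = bform A q u v) {f u u' : Hs n s} (h : IsSolution Ω A q f u)
    (h' : IsSolution Ω A q f u') : u = u' := by
  refine sub_eq_zero.1 (h0 _ ?_ fun v hv => ?_)
  · have := (HsTilde n s Ω).sub_mem h.1 h'.1
    simpa using this
  · rw [← hB, map_sub, _root_.sub_apply, hB, hB, h.2 v hv, h'.2 v hv, sub_zero]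

/-- B(Pf, g) vanishes for g in H̃ˢ(Ω) because Pf solves the equation, and P vanishes on H̃ˢ(Ω) by
uniqueness. The form therefore descends to the quotient in each argument, with boundedness inherited
from P. Uniqueness of Λ holds because every class has a representative and every representative a
solution. -/
theorem exists_DNMap (hn : 1 ≤ n) (hs0 : 0 < s) (hs1 : s < 1) {Ω : Set (Rn n)} (hΩ : IsOpen Ω)
    (hΩb : Bornology.IsBounded Ω) {A : Rn n × Rn n → Cn n} {q : Rn n → ℝ}
    (hP : IsPotential₀ n s A q) (h0 : ZeroNotEigenvalue n s Ω A q) :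
    (∀ f : Hs n s, ∃! u : Hs n s, IsSolution Ω A q f u) ∧
      ∃ Λ : Trace n s Ω →L[ℂ] Trace n s Ω →L[ℂ] ℂ, IsDNMap Ω A q Λ ∧
        (∀ Λ' : Trace n s Ω →L[ℂ] Trace n s Ω →L[ℂ] ℂ, IsDNMap Ω A q Λ' → Λ' = Λ) ∧
        ∀ a b : Trace n s Ω, Λ a b = Λ b a := by
  obtain ⟨B, hB⟩ := exists_bformL hn hs0 hs1
    (isMult_of_memLp hn hs0 hP.aesm hP.memJ1 hP.memJ2) hP.memq
  obtain ⟨P, hP'⟩ := exists_solver hn hs0 hs1 hΩ hΩb hP h0 hB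
  have hsol : ∀ f, IsSolution Ω A q f (P f) := fun f => by
    refine ⟨?_, fun v hv => by rw [← hB]; exact (hP' f).2 v hv⟩
    rw [← neg_sub]
    exact (HsTilde n s Ω).neg_mem (hP' f).1
  have hmk : ∀ a : Trace n s Ω, ∃ f, a = Trace.mk Ω f := fun a => by
    obtain ⟨f, rfl⟩ := Submodule.Quotient.mk_surjective _ a
    exact ⟨f, rfl⟩
  have hPz : ∀ f ∈ HsTilde n s Ω, P f = 0 := fun f hf => by
    refine (hsol f).unique h0 hB ⟨?_, fun v _ => ?_⟩
    · rw [zero_sub]; exact (HsTilde n s Ω).neg_mem hf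
    · rw [← hB, map_zero, _root_.zero_apply]
  let Λ₁ : Trace n s Ω →L[ℂ] Hs n s →L[ℂ] ℂ := (HsTilde n s Ω).liftQL (B.comp P) fun f hf => by
    change B (P f) = 0
    rw [hPz f hf, map_zero]
  have hΛ₁ : ∀ f g, Λ₁ (Trace.mk Ω f) g = B (P f) g := fun f g => rfl
  let Λ : Trace n s Ω →L[ℂ] Trace n s Ω →L[ℂ] ℂ :=
    ((HsTilde n s Ω).liftQL Λ₁.flip fun g hg => by
      change Λ₁.flip g = 0
      ext a
      obtain ⟨f, rfl⟩ := hmk a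
      exact (hΛ₁ f g).trans ((hP' f).2 g hg)).flip
  have hΛ : ∀ f g, Λ (Trace.mk Ω f) (Trace.mk Ω g) = B (P f) g := fun f g => rfl
  refine ⟨fun f => ⟨P f, hsol f, fun u hu => hu.unique h0 hB (hsol f)⟩, Λ, ?_, ?_, ?_⟩
  · intro f g u hu
    rw [hΛ, hu.unique h0 hB (hsol f), hB]
  · intro Λ' hΛ'
    ext a b
    obtain ⟨f, rfl⟩ := hmk a
    obtain ⟨g, rfl⟩ := hmk b
    rw [hΛ' f g (P f) (hsol f), hΛ, hB]
  · intro a b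
    obtain ⟨f, rfl⟩ := hmk a
    obtain ⟨g, rfl⟩ := hmk b
    rw [hΛ, hΛ]
    -- The argument g may be replaced by Pg, since they differ by an element of H̃ˢ(Ω). This exposes
    -- the symmetry.
    have key : ∀ f g, B (P f) g = B (P f) (P g) := fun f g => by
      have := (hP' f).2 _ (hP' g).1
      rwa [map_sub, sub_eq_zero] at this
    rw [key f g, key g f, hB, hB, bform_comm]

end WellPosed

end

end FracMag

namespace FracMag

noncomputable section

variable {n : ℕ} {s : ℝ}

/-! ### Fourier transforms of difference fields on ℝ²ⁿ. -/

section DiffField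

/-- The field `ψ(x) a(y - x)`. -/
def pairField (ψ : Rn n → ℂ) (a : Rn n → Cn n) (z : Rn n × Rn n) : Cn n :=
  ψ z.1 • a (z.2 - z.1)

/-- The field `(ψ(x) - ψ(y)) a(y - x)`. -/
def diffField (ψ : Rn n → ℂ) (a : Rn n → Cn n) (z : Rn n × Rn n) : Cn n :=
  (ψ z.1 - ψ z.2) • a (z.2 - z.1)

/-- Oddness of `a` turns the term with ψ(y) into the swap of the term with ψ(x), so one transform
computation serves both. -/
lemma diffField_eq {ψ : Rn n → ℂ} {a : Rn n → Cn n} (ha : ∀ h, a (-h) = -a h)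
    (z : Rn n × Rn n) : diffField ψ a z = pairField ψ a z + pairField ψ a z.swap := by
  have h := ha (z.2 - z.1)
  rw [neg_sub] at h
  simp only [diffField, pairField, Prod.fst_swap, Prod.snd_swap, h, smul_neg, sub_smul]
  abel

lemma measurePreserving_sub_Rn :
    MeasurePreserving (fun z : Rn n × Rn n => (z.1, z.2 - z.1)) volume volume :=
  measurePreserving_prod_sub volume volume

lemma integrable_pairField {ψ : Rn n → ℂ} {a : Rn n → Cn n} (hψ : Integrable ψ volume)
    (ha : Integrable a volume) : Integrable (pairField ψ a) volume := by
  have h : Integrable (fun z : Rn n × Rn n => ψ z.1 • a z.2) volume := hψ.smul_prod ha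
  exact measurePreserving_sub_Rn.integrable_comp_of_integrable h

lemma memLp_pairField {ψ : Rn n → ℂ} {a : Rn n → Cn n} (hψ : MemLp ψ 2 volume)
    (ha : MemLp a 2 volume) : MemLp (pairField ψ a) 2 volume := by
  have hm : AEStronglyMeasurable (fun z : Rn n × Rn n => ψ z.1 • a z.2) volume :=
    AEStronglyMeasurable.smul (𝕜 := ℂ) hψ.1.comp_fst ha.1.comp_snd
  have h : MemLp (fun z : Rn n × Rn n => ψ z.1 • a z.2) 2 volume := by
    rw [memLp_two_iff_lintegral hm]
    simp only [enorm_smul, mul_pow]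
    rw [Measure.volume_eq_prod, lintegral_prod_mul (hψ.1.enorm.pow_const 2)
      (ha.1.enorm.pow_const 2)]
    exact ENNReal.mul_lt_top ((memLp_two_iff_lintegral hψ.1).1 hψ)
      ((memLp_two_iff_lintegral ha.1).1 ha)
  exact h.comp_measurePreserving measurePreserving_sub_Rn

lemma measurePreserving_ofLp :
    MeasurePreserving (WithLp.ofLp : R2n n → Rn n × Rn n) volume volume :=
  WithLp.volume_preserving_ofLp _ _

lemma measurableEmbedding_ofLp : MeasurableEmbedding (WithLp.ofLp : R2n n → Rn n × Rn n) :=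
  (MeasurableEquiv.toLp 2 (Rn n × Rn n)).symm.measurableEmbedding

lemma integral_ofLp {E : Type*} [NormedAddCommGroup E] [NormedSpace ℝ E]
    (K : Rn n × Rn n → E) : ∫ z : R2n n, K z.ofLp = ∫ z, K z :=
  measurePreserving_ofLp.integral_comp measurableEmbedding_ofLp K

lemma lintegral_ofLp (K : Rn n × Rn n → ℝ≥0∞) : ∫⁻ z : R2n n, K z.ofLp = ∫⁻ z, K z :=
  measurePreserving_ofLp.lintegral_comp_emb measurableEmbedding_ofLp K

lemma fourier_R2n {E : Type*} [NormedAddCommGroup E] [NormedSpace ℂ E]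
    (K : Rn n × Rn n → E) (ζ : R2n n) :
    𝓕 (fun z : R2n n => K z.ofLp) ζ = ∫ z : Rn n × Rn n,
      Real.fourierChar (-(inner ℝ z.1 ζ.ofLp.1 + inner ℝ z.2 ζ.ofLp.2)) • K z := by
  rw [Real.fourier_eq]
  exact integral_ofLp fun z : Rn n × Rn n =>
    Real.fourierChar (-(inner ℝ z.1 ζ.ofLp.1 + inner ℝ z.2 ζ.ofLp.2)) • K z

/-- In the variables x and h = y - x the phase is ⟨x, ζ₁ + ζ₂⟩ + ⟨h, ζ₂⟩, and the integral factors.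
-/
lemma fourier_pairField (ψ : Rn n → ℂ) (a : Rn n → Cn n) (ζ : R2n n) :
    𝓕 (fun z : R2n n => pairField ψ a z.ofLp) ζ =
      𝓕 ψ (ζ.ofLp.1 + ζ.ofLp.2) • 𝓕 a ζ.ofLp.2 := by
  rw [fourier_R2n, Real.fourier_eq, Real.fourier_eq, ← integral_prod_smul]
  have h := (measurePreserving_prod_add (volume : Measure (Rn n))
    (volume : Measure (Rn n))).integral_comp
    (MeasurableEquiv.shearAddRight (Rn n)).measurableEmbedding
    (fun z : Rn n × Rn n =>
      Real.fourierChar (-(inner ℝ z.1 ζ.ofLp.1 + inner ℝ z.2 ζ.ofLp.2)) • pairField ψ a z)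
  rw [Measure.volume_eq_prod, ← h]
  refine integral_congr_ae (Eventually.of_forall fun z => ?_)
  simp only [pairField, add_sub_cancel_left, Circle.smul_def, smul_smul, smul_eq_mul]
  congr 1
  rw [mul_right_comm, ← Circle.coe_mul, ← AddChar.map_add_eq_mul, inner_add_left, inner_add_right]
  congr 4
  ring

lemma fourier_pairField_swap (ψ : Rn n → ℂ) (a : Rn n → Cn n) (ζ : R2n n) :
    𝓕 (fun z : R2n n => pairField ψ a z.ofLp.swap) ζ =
      𝓕 ψ (ζ.ofLp.1 + ζ.ofLp.2) • 𝓕 a ζ.ofLp.1 := by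
  have h := fourier_pairField ψ a (WithLp.toLp 2 ζ.ofLp.swap)
  rw [fourier_R2n] at h
  rw [fourier_R2n (fun z => pairField ψ a z.swap), add_comm]
  refine Eq.trans ?_ h
  have h2 := (Measure.measurePreserving_swap (μ := (volume : Measure (Rn n)))
    (ν := (volume : Measure (Rn n)))).integral_comp
    MeasurableEquiv.prodComm.measurableEmbedding
    (fun z : Rn n × Rn n =>
      Real.fourierChar (-(inner ℝ z.1 ζ.ofLp.2 + inner ℝ z.2 ζ.ofLp.1)) • pairField ψ a z)
  refine Eq.trans ?_ h2
  refine integral_congr_ae (Eventually.of_forall fun z => ?_)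
  simp only [Prod.fst_swap, Prod.snd_swap]
  rw [add_comm (inner ℝ z.1 _)]

lemma integrable_diffField {ψ : Rn n → ℂ} {a : Rn n → Cn n} (hodd : ∀ h, a (-h) = -a h)
    (hψ : Integrable ψ volume) (ha : Integrable a volume) :
    Integrable (fun z : R2n n => diffField ψ a z.ofLp) volume := by
  have h1 : Integrable (fun z : Rn n × Rn n => diffField ψ a z) volume := by
    simp only [diffField_eq hodd]
    have h := integrable_pairField hψ ha
    exact h.add (h.swap)
  exact measurePreserving_ofLp.integrable_comp_of_integrable h1

lemma memLp_diffField {ψ : Rn n → ℂ} {a : Rn n → Cn n} (hodd : ∀ h, a (-h) = -a h)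
    (hψ : MemLp ψ 2 volume) (ha : MemLp a 2 volume) :
    MemLp (fun z : R2n n => diffField ψ a z.ofLp) 2 volume := by
  have h1 : MemLp (fun z : Rn n × Rn n => diffField ψ a z) 2 volume := by
    simp only [diffField_eq hodd]
    have h := memLp_pairField hψ ha
    exact h.add (h.comp_measurePreserving (Measure.measurePreserving_swap (μ := volume)
      (ν := volume)))
  exact h1.comp_measurePreserving measurePreserving_ofLp

lemma fourier_diffField {ψ : Rn n → ℂ} {a : Rn n → Cn n} (hodd : ∀ h, a (-h) = -a h)
    (hψ : Integrable ψ volume) (ha : Integrable a volume) (ζ : R2n n) :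
    𝓕 (fun z : R2n n => diffField ψ a z.ofLp) ζ =
      𝓕 ψ (ζ.ofLp.1 + ζ.ofLp.2) • (𝓕 a ζ.ofLp.1 + 𝓕 a ζ.ofLp.2) := by
  have h1 : Integrable (fun z : R2n n => pairField ψ a z.ofLp) volume :=
    measurePreserving_ofLp.integrable_comp_of_integrable (integrable_pairField hψ ha)
  have h2 : Integrable (fun z : R2n n => pairField ψ a z.ofLp.swap) volume :=
    measurePreserving_ofLp.integrable_comp_of_integrable (integrable_pairField hψ ha).swap
  rw [smul_add, ← fourier_pairField, ← fourier_pairField_swap, add_comm]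
  simp only [diffField_eq hodd, Real.fourier_eq, smul_add]
  exact integral_add ((Real.fourierIntegral_convergent_iff ζ).2 h1)
    ((Real.fourierIntegral_convergent_iff ζ).2 h2)

end DiffField

/-! ### The symbol recovered by Plancherel in the frequency variable. -/

section Symbol

lemma lintegral_fourier_sq_of_integrable {V F : Type*} [NormedAddCommGroup V]
    [InnerProductSpace ℝ V] [FiniteDimensional ℝ V] [MeasurableSpace V] [BorelSpace V]
    [NormedAddCommGroup F] [InnerProductSpace ℂ F] [CompleteSpace F] {b : V → F}
    (h1 : Integrable b volume) (h2 : MemLp b 2 volume) :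
    ∫⁻ ξ, ‖𝓕 b ξ‖ₑ ^ 2 = ∫⁻ x, ‖b x‖ₑ ^ 2 := by
  have h := lintegral_fourier_sq (h2.toLp b)
  have e1 : ∫⁻ x, ‖h2.toLp b x‖ₑ ^ 2 = ∫⁻ x, ‖b x‖ₑ ^ 2 := by
    refine lintegral_congr_ae ?_
    filter_upwards [h2.coeFn_toLp] with x hx
    rw [hx]
  rw [← e1, ← h]
  refine lintegral_congr_ae ?_
  filter_upwards [fourier_toLp_ae_eq h1 h2] with x hx
  rw [hx]

lemma fourier_neg_of_odd {a : Rn n → Cn n} (hodd : ∀ h, a (-h) = -a h) (ξ : Rn n) :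
    𝓕 a (-ξ) = -𝓕 a ξ := by
  rw [Real.fourier_eq, Real.fourier_eq, ← integral_neg_eq_self, ← integral_neg]
  refine integral_congr_ae (Eventually.of_forall fun h => ?_)
  simp only [inner_neg_neg, hodd, smul_neg]

/-- Plancherel for `ψ(x) - ψ(y)` in the difference variable. -/
lemma lintegral_fourier_add_sq_le {a : Rn n → Cn n} (hodd : ∀ h, a (-h) = -a h)
    (h1 : Integrable a volume) (h2 : MemLp a 2 volume)
    (hle : ∀ h, ‖a h‖ₑ ≤ ‖alphaV n s h‖ₑ) (ζ : Rn n) :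
    ∫⁻ η, ‖𝓕 a (ζ - η) + 𝓕 a η‖ₑ ^ 2 ≤ gradSymbol n s ζ := by
  set e : Rn n → Cn n := fun h => Real.fourierChar (inner ℝ h ζ) • a h with he
  have hem : Continuous fun h : Rn n => (Real.fourierChar (inner ℝ h ζ) : ℂ) := by fun_prop
  have henorm : ∀ h, ‖e h‖ = ‖a h‖ := fun h => by
    change ‖Real.fourierChar (inner ℝ h ζ) • a h‖ = ‖a h‖
    rw [Circle.smul_def, norm_smul, Circle.norm_coe, one_mul]
  have hes : AEStronglyMeasurable e volume :=
    AEStronglyMeasurable.smul (𝕜 := ℂ) hem.aestronglyMeasurable h1.1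
  have he1 : Integrable e volume := h1.mono hes (Eventually.of_forall fun h => (henorm h).le)
  have he2 : MemLp e 2 volume := h2.of_le hes (Eventually.of_forall fun h => (henorm h).le)
  have hfe : ∀ η, 𝓕 e η = 𝓕 a (η - ζ) := by
    intro η
    rw [Real.fourier_eq, Real.fourier_eq]
    refine integral_congr_ae (Eventually.of_forall fun h => ?_)
    simp only [he, smul_smul, ← AddChar.map_add_eq_mul, inner_sub_right]
    congr 2
    ring
  -- The transform of an odd field is odd, so the sum is the difference of 𝓕 a and its translate by
  -- ζ. That is the transform of (1 - e^{2πi⟨h,ζ⟩})a(h), whose squared L² norm is bounded by the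
  -- symbol at ζ.
  have hsub : ∀ η, 𝓕 a (ζ - η) + 𝓕 a η = 𝓕 (a - e) η := by
    intro η
    have h3 : 𝓕 (a - e) η = 𝓕 a η - 𝓕 e η := by
      simp only [Real.fourier_eq, Pi.sub_apply, smul_sub]
      exact integral_sub ((Real.fourierIntegral_convergent_iff η).2 h1)
        ((Real.fourierIntegral_convergent_iff η).2 he1)
    rw [h3, hfe, ← neg_sub η ζ, fourier_neg_of_odd hodd, neg_add_eq_sub]
  simp only [hsub]
  rw [lintegral_fourier_sq_of_integrable (h1.sub he1) (h2.sub he2)]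
  refine lintegral_mono fun h => ?_
  have h4 : (a - e) h = -(((Real.fourierChar (inner ℝ ζ h) : ℂ) - 1) • a h) := by
    change a h - Real.fourierChar (inner ℝ h ζ) • a h = _
    rw [Circle.smul_def, real_inner_comm, sub_smul, one_smul, neg_sub]
  rw [h4, enorm_neg, enorm_smul, mul_pow, mul_comm]
  gcongr
  exact hle h

end Symbol

end

end FracMag

namespace FracMag

noncomputable section

variable {n : ℕ} {s : ℝ}

/-! ### The truncated gradient in negative Sobolev norms. -/

section WeightedDuality

lemma continuous_fourier {V F : Type*} [NormedAddCommGroup V]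
    [InnerProductSpace ℝ V] [FiniteDimensional ℝ V] [MeasurableSpace V] [BorelSpace V]
    [NormedAddCommGroup F] [NormedSpace ℂ F] {f : V → F}
    (hf : Integrable f volume) : Continuous (𝓕 f) :=
  VectorFourier.fourierIntegral_continuous Real.continuous_fourierChar
    (by exact continuous_inner) hf

/-- Duality of weighted `L²` spaces on the Fourier side. -/
lemma enorm_inner_sq_le {V F : Type*} [NormedAddCommGroup V]
    [InnerProductSpace ℝ V] [FiniteDimensional ℝ V] [MeasurableSpace V] [BorelSpace V]
    [NormedAddCommGroup F] [InnerProductSpace ℂ F] [CompleteSpace F] {G : V → F}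
    (h1 : Integrable G volume) (h2 : MemLp G 2 volume) (t : ℝ)
    (f : Lp F 2 (volume : Measure V)) :
    ‖inner ℂ (h2.toLp G) f‖ₑ ^ 2 ≤
      (∫⁻ ξ, ENNReal.ofReal ((1 + (2 * Real.pi * ‖ξ‖) ^ 2) ^ (-t)) * ‖𝓕 G ξ‖ₑ ^ 2) *
        ∫⁻ ξ, ‖bessel t f ξ‖ₑ ^ 2 := by
  have hfm : AEMeasurable (fun ξ => ‖(𝓕 f : Lp F 2 (volume : Measure V)) ξ‖ₑ) volume :=
    (Lp.aestronglyMeasurable _).enorm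
  have hwm : ∀ r : ℝ, Measurable fun ξ : V =>
      ENNReal.ofReal ((1 + (2 * Real.pi * ‖ξ‖) ^ 2) ^ r) := fun r => by fun_prop
  have hb : ∀ ξ, ‖bessel t f ξ‖ₑ = ENNReal.ofReal ((1 + (2 * Real.pi * ‖ξ‖) ^ 2) ^ (t / 2)) *
      ‖(𝓕 f : Lp F 2 (volume : Measure V)) ξ‖ₑ := by
    intro ξ
    rw [bessel, enorm_smul, ← ofReal_norm (_ : ℂ), Complex.norm_real,
      Real.norm_of_nonneg (by positivity)]
  have key : ‖inner ℂ (h2.toLp G) f‖ₑ ≤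
      ∫⁻ ξ, (ENNReal.ofReal ((1 + (2 * Real.pi * ‖ξ‖) ^ 2) ^ (-(t / 2))) * ‖𝓕 G ξ‖ₑ) *
        ‖bessel t f ξ‖ₑ := by
    rw [← Lp.inner_fourier_eq, L2.inner_def]
    refine (enorm_integral_le_lintegral_enorm _).trans (lintegral_mono_ae ?_)
    filter_upwards [fourier_toLp_ae_eq h1 h2] with ξ hξ
    rw [hξ, hb, mul_mul_mul_comm, ← ENNReal.ofReal_mul (by positivity),
      ← Real.rpow_add (by positivity), neg_add_cancel, Real.rpow_zero, ENNReal.ofReal_one,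
      one_mul, ← ofReal_norm, ← ofReal_norm, ← ofReal_norm,
      ← ENNReal.ofReal_mul (norm_nonneg _)]
    exact ENNReal.ofReal_le_ofReal (norm_inner_le_norm _ _)
  have hCS := ENNReal.lintegral_mul_le_Lp_mul_Lq volume Real.HolderConjugate.two_two
    (f := fun ξ => ENNReal.ofReal ((1 + (2 * Real.pi * ‖ξ‖) ^ 2) ^ (-(t / 2))) * ‖𝓕 G ξ‖ₑ)
    (g := fun ξ => ‖bessel t f ξ‖ₑ)
    ((hwm _).aemeasurable.mul (continuous_fourier h1).enorm.measurable.aemeasurable)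
    (by simp only [hb]; exact (hwm _).aemeasurable.mul hfm)
  have hsq : ∀ x : ℝ≥0∞, (x ^ (1 / (2 : ℝ))) ^ 2 = x := fun x => by
    rw [← ENNReal.rpow_natCast, ← ENNReal.rpow_mul]; norm_num
  refine (ENNReal.pow_le_pow_left (key.trans hCS)).trans (le_of_eq ?_)
  rw [mul_pow, hsq, hsq]
  congr 1
  · refine lintegral_congr fun ξ => ?_
    rw [ENNReal.rpow_two, mul_pow, ← ENNReal.ofReal_pow (by positivity),
      ← Real.rpow_mul_natCast (by positivity)]
    congr 4
    push_cast; ring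
  · simp only [ENNReal.rpow_two]

lemma weight_add_le (ζ : R2n n) :
    1 + (2 * Real.pi * ‖ζ.ofLp.1 + ζ.ofLp.2‖) ^ 2 ≤ 2 * (1 + (2 * Real.pi * ‖ζ‖) ^ 2) := by
  have h1 := WithLp.prod_norm_sq_eq_of_L2 ζ
  have h2 := norm_add_le ζ.ofLp.1 ζ.ofLp.2
  have h3 : ‖ζ.ofLp.1 + ζ.ofLp.2‖ ^ 2 ≤ 2 * ‖ζ‖ ^ 2 := by
    have h4 : ‖ζ‖ ^ 2 = ‖ζ.ofLp.1‖ ^ 2 + ‖ζ.ofLp.2‖ ^ 2 := h1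
    have h5 := pow_le_pow_left₀ (norm_nonneg _) h2 2
    linarith [sq_nonneg (‖ζ.ofLp.1‖ - ‖ζ.ofLp.2‖)]
  have h6 := mul_le_mul_of_nonneg_left h3 (sq_nonneg (2 * Real.pi))
  rw [mul_pow, mul_pow (2 * Real.pi) ‖ζ‖]
  linarith

/-- Since |ζ₁ + ζ₂|² ≤ 2|ζ|², the negative weight at ζ is at most 2ᵗ times the one at ζ₁ + ζ₂. With
the sum as a new variable, both the weight and 𝓕 ψ come out of the remaining integral, which
Plancherel bounds by the symbol. -/
lemma lintegral_weight_diffField_le {t : ℝ} (ht : 0 ≤ t) {ψ : Rn n → ℂ} {a : Rn n → Cn n}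
    (hodd : ∀ h, a (-h) = -a h) (hψ : Integrable ψ volume) (h1 : Integrable a volume)
    (h2 : MemLp a 2 volume) (hle : ∀ h, ‖a h‖ₑ ≤ ‖alphaV n s h‖ₑ) :
    ∫⁻ ζ : R2n n, ENNReal.ofReal ((1 + (2 * Real.pi * ‖ζ‖) ^ 2) ^ (-t)) *
        ‖𝓕 (fun z : R2n n => diffField ψ a z.ofLp) ζ‖ₑ ^ 2 ≤
      ENNReal.ofReal (2 ^ t) * ∫⁻ ζ : Rn n,
        ENNReal.ofReal ((1 + (2 * Real.pi * ‖ζ‖) ^ 2) ^ (-t)) * ‖𝓕 ψ ζ‖ₑ ^ 2 *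
          gradSymbol n s ζ := by
  set W : Rn n → ℝ≥0∞ := fun ζ =>
    ENNReal.ofReal ((1 + (2 * Real.pi * ‖ζ‖) ^ 2) ^ (-t)) * ‖𝓕 ψ ζ‖ₑ ^ 2 with hW
  have hcψ := continuous_fourier hψ
  have hca := continuous_fourier h1
  have hWm : Measurable W := by
    have := hcψ.measurable.enorm.pow_const 2
    exact Measurable.mul (by fun_prop) this
  set Φ : Rn n × Rn n → ℝ≥0∞ := fun z => W (z.1 + z.2) * ‖𝓕 a z.1 + 𝓕 a z.2‖ₑ ^ 2 with hΦ
  have hΦm : Measurable Φ := by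
    refine (hWm.comp (measurable_fst.add measurable_snd)).mul ?_
    have : Continuous fun z : Rn n × Rn n => 𝓕 a z.1 + 𝓕 a z.2 :=
      (hca.comp continuous_fst).add (hca.comp continuous_snd)
    exact this.measurable.enorm.pow_const 2
  have hpt : ∀ ζ : R2n n, ENNReal.ofReal ((1 + (2 * Real.pi * ‖ζ‖) ^ 2) ^ (-t)) *
      ‖𝓕 (fun z : R2n n => diffField ψ a z.ofLp) ζ‖ₑ ^ 2 ≤
        ENNReal.ofReal (2 ^ t) * Φ ζ.ofLp := by
    intro ζ
    rw [fourier_diffField hodd hψ h1, enorm_smul, mul_pow ‖𝓕 ψ (ζ.ofLp.1 + ζ.ofLp.2)‖ₑ, hΦ, hW]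
    simp only [← mul_assoc]
    rw [← ENNReal.ofReal_mul (by positivity)]
    gcongr
    rw [Real.rpow_neg (by positivity), Real.rpow_neg (by positivity), ← div_eq_mul_inv,
      inv_le_comm₀ (by positivity) (by positivity), inv_div, div_le_iff₀ (by positivity),
      ← Real.mul_rpow (by positivity) zero_le_two, mul_comm _ (2 : ℝ)]
    exact Real.rpow_le_rpow (by positivity) (weight_add_le ζ) ht
  refine (lintegral_mono hpt).trans ?_
  rw [lintegral_const_mul' _ _ ENNReal.ofReal_ne_top, lintegral_ofLp]
  gcongr
  rw [Measure.volume_eq_prod, lintegral_prod_symm _ hΦm.aemeasurable]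
  have hsub : ∀ η : Rn n, ∫⁻ ξ : Rn n, Φ (ξ, η) = ∫⁻ ζ : Rn n, Φ (ζ - η, η) := fun η =>
    (lintegral_sub_right_eq_self (fun ξ => Φ (ξ, η)) η).symm
  simp only [hsub]
  have hm2 : Measurable (Function.uncurry fun (η ζ : Rn n) => Φ (ζ - η, η)) := by
    refine hΦm.comp ?_
    exact Measurable.prodMk (measurable_snd.sub measurable_fst) measurable_fst
  rw [lintegral_lintegral_swap hm2.aemeasurable]
  refine lintegral_mono fun ζ => ?_
  simp only [hΦ, sub_add_cancel]
  rw [lintegral_const_mul]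
  · gcongr
    exact lintegral_fourier_add_sq_le hodd h1 h2 hle ζ
  · have : Continuous fun η : Rn n => 𝓕 a (ζ - η) + 𝓕 a η :=
      (hca.comp (continuous_const.sub continuous_id)).add hca
    exact this.measurable.enorm.pow_const 2

end WeightedDuality

/-! ### Removing the singularity of the kernel. -/

section Truncation

/-- The kernel of the fractional gradient, cut off near zero and infinity. -/
def truncAlpha (n : ℕ) (s : ℝ) (k : ℕ) : Rn n → Cn n :=
  {h : Rn n | ((k : ℝ) + 1)⁻¹ ≤ ‖h‖ ∧ ‖h‖ ≤ (k : ℝ) + 1}.indicator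
    fun h => toCn (alphaV n s h)

lemma measurableSet_annulus (k : ℕ) :
    MeasurableSet {h : Rn n | ((k : ℝ) + 1)⁻¹ ≤ ‖h‖ ∧ ‖h‖ ≤ (k : ℝ) + 1} :=
  (measurableSet_le measurable_const measurable_norm).inter
    (measurableSet_le measurable_norm measurable_const)

lemma toCn_neg (x : Rn n) : toCn (-x) = -toCn x := by
  ext j; simp [toCn]

lemma truncAlpha_neg (k : ℕ) (h : Rn n) : truncAlpha n s k (-h) = -truncAlpha n s k h := by
  unfold truncAlpha
  by_cases hh : ((k : ℝ) + 1)⁻¹ ≤ ‖h‖ ∧ ‖h‖ ≤ (k : ℝ) + 1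
  · rw [Set.indicator_of_mem, Set.indicator_of_mem, alphaV_neg, toCn_neg]
    · exact hh
    · simpa using hh
  · rw [Set.indicator_of_notMem, Set.indicator_of_notMem, neg_zero]
    · exact hh
    · simpa using hh

lemma enorm_truncAlpha_le (k : ℕ) (h : Rn n) : ‖truncAlpha n s k h‖ₑ ≤ ‖alphaV n s h‖ₑ := by
  unfold truncAlpha
  refine (enorm_indicator_le_enorm_self _ _).trans ?_
  rw [enorm_toCn]

lemma memLp_truncAlpha (hs0 : 0 < s) (k : ℕ) (q : ℝ≥0∞) :
    MemLp (truncAlpha n s k) q volume := by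
  have hm : AEStronglyMeasurable (fun h : Rn n => toCn (alphaV n s h)) volume :=
    (continuous_toCn.measurable.comp (measurable_alphaV n s)).aestronglyMeasurable
  rw [truncAlpha, memLp_indicator_iff_restrict (measurableSet_annulus k)]
  set S := {h : Rn n | ((k : ℝ) + 1)⁻¹ ≤ ‖h‖ ∧ ‖h‖ ≤ (k : ℝ) + 1} with hS
  have : IsFiniteMeasure (volume.restrict S) := ⟨by
    rw [Measure.restrict_apply_univ]
    refine (measure_mono ?_).trans_lt
      (measure_closedBall_lt_top (x := (0 : Rn n)) (r := (k : ℝ) + 1))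
    intro h hh
    simpa using hh.2⟩
  refine MemLp.of_bound hm.restrict
    (|gradConst n s| * (((k : ℝ) + 1)⁻¹) ^ (-((n : ℝ) / 2 + s))) ?_
  refine (ae_restrict_mem (measurableSet_annulus k)).mono fun h hh => ?_
  have hk : (0 : ℝ) < ((k : ℝ) + 1)⁻¹ := by positivity
  have hpos : 0 < ‖h‖ := hk.trans_le hh.1
  have e : ‖toCn (alphaV n s h)‖ = ‖alphaV n s h‖ := by
    simp [toCn, EuclideanSpace.norm_eq]
  rw [e, norm_alphaV (norm_pos_iff.1 hpos)]
  refine mul_le_mul (le_abs_self _) ?_ (by positivity) (abs_nonneg _)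
  exact Real.rpow_le_rpow_of_nonpos hk hh.1 (by have : (0 : ℝ) ≤ n := n.cast_nonneg; linarith)

/-- Off the diagonal y - x lies in all large annuli; on the diagonal both fields vanish. With
`norm_diffField_le` as domination this allows passage to the limit in the truncation. -/
lemma eventually_diffField_eq (ψ : Rn n → ℂ) (z : Rn n × Rn n) :
    ∀ᶠ k in atTop, diffField ψ (truncAlpha n s k) z = fracGrad n s ψ z := by
  by_cases hz : z.2 - z.1 = 0
  · have h : z.1 = z.2 := (sub_eq_zero.1 hz).symm
    refine Eventually.of_forall fun k => ?_
    simp [diffField, fracGrad, h]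
  · have hpos : 0 < ‖z.2 - z.1‖ := norm_pos_iff.2 hz
    have h1 : Tendsto (fun k : ℕ => (k : ℝ) + 1) atTop atTop :=
      tendsto_atTop_add_const_right _ _ tendsto_natCast_atTop_atTop
    filter_upwards [h1.eventually_ge_atTop ‖z.2 - z.1‖,
      h1.eventually_ge_atTop (‖z.2 - z.1‖⁻¹)] with k hk1 hk2
    have h2 : ((k : ℝ) + 1)⁻¹ ≤ ‖z.2 - z.1‖ := inv_le_of_inv_le₀ hpos hk2
    rw [diffField, truncAlpha, Set.indicator_of_mem (show z.2 - z.1 ∈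
      {h : Rn n | ((k : ℝ) + 1)⁻¹ ≤ ‖h‖ ∧ ‖h‖ ≤ (k : ℝ) + 1} from ⟨h2, hk1⟩), fracGrad, alpha_eq]

lemma norm_diffField_le (ψ : Rn n → ℂ) (k : ℕ) (z : Rn n × Rn n) :
    ‖diffField ψ (truncAlpha n s k) z‖ ≤ ‖fracGrad n s ψ z‖ := by
  have h : ‖diffField ψ (truncAlpha n s k) z‖ₑ ≤ ‖fracGrad n s ψ z‖ₑ := by
    rw [enorm_fracGrad, diffField, enorm_smul]
    gcongr
    exact enorm_truncAlpha_le k _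
  rwa [← ofReal_norm, ← ofReal_norm, ENNReal.ofReal_le_ofReal_iff (norm_nonneg _)] at h

end Truncation

/-! ### The fractional divergence as a functional on test functions. -/

section DivBound

open SchwartzMap

lemma fourier_conj_eq (φ : Rn n → ℂ) (ξ : Rn n) :
    𝓕 (fun x => starRingEnd ℂ (φ x)) ξ = starRingEnd ℂ (𝓕⁻ φ ξ) := by
  rw [Real.fourier_eq, Real.fourierInv_eq, ← integral_conj]
  refine integral_congr_ae (Eventually.of_forall fun x => ?_)
  simp only [Circle.smul_def, smul_eq_mul, map_mul, ← Circle.coe_inv_eq_conj,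
    ← AddChar.map_neg_eq_inv]

lemma conjCn_diffField_truncAlpha (φ : Rn n → ℂ) (k : ℕ) (z : Rn n × Rn n) :
    conjCn (diffField φ (truncAlpha n s k) z) =
      diffField (fun x => starRingEnd ℂ (φ x)) (truncAlpha n s k) z := by
  unfold diffField truncAlpha
  by_cases h : z.2 - z.1 ∈ {h : Rn n | ((k : ℝ) + 1)⁻¹ ≤ ‖h‖ ∧ ‖h‖ ≤ (k : ℝ) + 1}
  · rw [Set.indicator_of_mem h]
    ext j
    simp [conjCn, toCn]
  · rw [Set.indicator_of_notMem h]
    ext j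
    simp [conjCn]

lemma memLp_fracGrad_schwartz (hn : 1 ≤ n) (hs0 : 0 < s) (hs1 : s < 1) (φ : 𝓢(Rn n, ℂ)) :
    MemLp (fracGrad n s φ) 2 volume :=
  (memLp_congr_ae (fracGrad_congr (Hs.fn_ofSchwartz φ))).1
    (memLp_fracGrad hn hs0 hs1 (Hs.ofSchwartz s φ))

/-- The fractional divergence of an `Hᵗ` field acts boundedly on `Hˢ⁻ᵗ`. -/
lemma exists_enorm_integral_dot_sq_le (hn : 1 ≤ n) (hs0 : 0 < s) (hs1 : s < 1) {t : ℝ}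
    (ht : 0 ≤ t) {F : Rn n × Rn n → Cn n} (hF : MemH t fun z : R2n n => F z.ofLp) :
    MemLp F 2 volume ∧ ∃ C : ℝ, 0 ≤ C ∧ ∀ φ : 𝓢(Rn n, ℂ),
      ‖∫ z, dot (F z) (fracGrad n s φ z)‖ₑ ^ 2 ≤ ENNReal.ofReal C *
        ∫⁻ ξ, ENNReal.ofReal ((1 + (2 * Real.pi * ‖ξ‖) ^ 2) ^ (s - t)) *
          ‖𝓕⁻ (φ : Rn n → ℂ) ξ‖ₑ ^ 2 := by
  obtain ⟨hF2, hFb⟩ := hF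
  have hFL : MemLp F 2 volume := by
    have h := hF2.comp_measurePreserving
      (WithLp.volume_preserving_toLp (Rn n) (Rn n))
    exact h
  refine ⟨hFL, ?_⟩
  obtain ⟨C₀, hC₀, hsym⟩ := exists_gradSymbol_le (n := n) hn hs0 hs1
  set β : ℝ≥0∞ := ∫⁻ ξ, ‖bessel t (hF2.toLp _) ξ‖ₑ ^ 2 with hβ
  have hβt : β ≠ ⊤ := ((memLp_two_iff_lintegral hFb.1).1 hFb).ne
  -- 2ᵗ comes from comparing weights on ℝ²ⁿ and ℝⁿ, C₀ from the upper symbol bound, and β is the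
  -- squared Hᵗ norm of `F`.
  refine ⟨2 ^ t * C₀ * β.toReal, by positivity, fun φ => ?_⟩
  set I : ℝ≥0∞ := ∫⁻ ξ, ENNReal.ofReal ((1 + (2 * Real.pi * ‖ξ‖) ^ 2) ^ (s - t)) *
          ‖𝓕⁻ (φ : Rn n → ℂ) ξ‖ₑ ^ 2 with hI
  -- The dot product is bilinear and the L² inner product is conjugate-linear in its first argument;
  -- conjugating the test function turns one into the other.
  set ψ : Rn n → ℂ := fun x => starRingEnd ℂ (φ x) with hψ
  have hψ1 : Integrable ψ volume := memLp_one_iff_integrable.1 (φ.memLp 1 volume).star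
  have hψ2 : MemLp ψ 2 volume := (φ.memLp 2 volume).star
  have htr : ∀ k, ‖∫ z, dot (F z) (diffField φ (truncAlpha n s k) z)‖ₑ ^ 2 ≤
      ENNReal.ofReal (2 ^ t * C₀ * β.toReal) * I := by
    intro k
    have ha1 : Integrable (truncAlpha n s k) volume :=
      memLp_one_iff_integrable.1 (memLp_truncAlpha hs0 k 1)
    have ha2 := memLp_truncAlpha (n := n) hs0 k 2
    have hG1 := integrable_diffField (truncAlpha_neg k) hψ1 ha1
    have hG2 := memLp_diffField (truncAlpha_neg k) hψ2 ha2
    have e1 : ∫ z, dot (F z) (diffField φ (truncAlpha n s k) z) =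
        inner ℂ (hG2.toLp _) (hF2.toLp _) := by
      rw [L2.inner_def, ← integral_ofLp]
      refine integral_congr_ae ?_
      filter_upwards [hG2.coeFn_toLp, hF2.coeFn_toLp] with z h1 h2
      rw [h1, h2, dot_comm, dot_eq_inner, conjCn_diffField_truncAlpha]
    rw [e1]
    refine (enorm_inner_sq_le hG1 hG2 t _).trans ?_
    have h2 := lintegral_weight_diffField_le ht (truncAlpha_neg k) hψ1 ha1 ha2
      (enorm_truncAlpha_le k)
    have h3 : ∫⁻ ζ : Rn n, ENNReal.ofReal ((1 + (2 * Real.pi * ‖ζ‖) ^ 2) ^ (-t)) *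
        ‖𝓕 ψ ζ‖ₑ ^ 2 * gradSymbol n s ζ ≤ ENNReal.ofReal C₀ * I := by
      rw [hI, ← lintegral_const_mul' _ _ ENNReal.ofReal_ne_top]
      refine lintegral_mono fun ζ => ?_
      refine (mul_le_mul_right (hsym ζ) _).trans (le_of_eq ?_)
      rw [hψ, fourier_conj_eq, ← ofReal_norm (starRingEnd ℂ _), RCLike.norm_conj, ofReal_norm,
        mul_right_comm, ← mul_assoc, ← ENNReal.ofReal_mul (by positivity),
        ← ENNReal.ofReal_mul hC₀.le, mul_left_comm, ← Real.rpow_add (by positivity)]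
      congr 4
      ring
    calc _ ≤ (ENNReal.ofReal (2 ^ t) * (ENNReal.ofReal C₀ * I)) * β := by
          gcongr
          exact h2.trans (mul_le_mul_right h3 _)
      _ = _ := by
          rw [ENNReal.ofReal_mul (by positivity), ENNReal.ofReal_mul (by positivity),
            ENNReal.ofReal_toReal hβt]
          ring
  have hgrad := memLp_fracGrad_schwartz hn hs0 hs1 φ
  -- The bound is uniform in the truncation, which is removed by dominated convergence with majorant
  -- |F||∇ˢφ|.
  have hlim : Tendsto (fun k => ∫ z, dot (F z) (diffField φ (truncAlpha n s k) z)) atTop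
      (nhds (∫ z, dot (F z) (fracGrad n s φ z))) := by
    refine tendsto_integral_of_dominated_convergence
      (fun z => ‖F z‖ * ‖fracGrad n s φ z‖) (fun k => ?_)
      (hFL.norm.integrable_mul hgrad.norm) (fun k => ?_) ?_
    · have hm : AEStronglyMeasurable (diffField φ (truncAlpha n s k)) volume := by
        have ha2 := memLp_truncAlpha (n := n) hs0 k 2
        have h1 : MemLp (fun z : R2n n => diffField φ (truncAlpha n s k) z.ofLp) 2 volume :=
          memLp_diffField (truncAlpha_neg k) (φ.memLp 2 volume) ha2
        exact (h1.comp_measurePreserving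
          (WithLp.volume_preserving_toLp (Rn n) (Rn n))).1
      exact continuous_dot.comp_aestronglyMeasurable (g := fun p : Cn n × Cn n => dot p.1 p.2)
        (f := fun z => (F z, diffField φ (truncAlpha n s k) z)) (hFL.1.prodMk hm)
    · refine Eventually.of_forall fun z => (norm_dot_le _ _).trans ?_
      exact mul_le_mul_of_nonneg_left (norm_diffField_le _ _ _) (norm_nonneg _)
    · refine Eventually.of_forall fun z => tendsto_const_nhds.congr' ?_
      filter_upwards [eventually_diffField_eq (s := s) (φ : Rn n → ℂ) z] with k hk
      rw [hk]
  have h5 := ENNReal.Tendsto.pow (n := 2) hlim.enorm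
  exact le_of_tendsto' h5 htr

end DivBound

end

end FracMag

namespace FracMag

noncomputable section

variable {n : ℕ} {s : ℝ}

/-! ### The fractional divergence as an L^p function. -/

section Divergence

open SchwartzMap

/-- `φ ↦ (1 + |2πξ|²)^{t/2} 𝓕⁻φ`, as a map into `L²`. -/
def weightedInv (t : ℝ) : 𝓢(Rn n, ℂ) →ₗ[ℂ] Lp ℂ 2 (volume : Measure (Rn n)) where
  toFun φ := (weightS (t / 2) (𝓕⁻ φ)).toLp 2 volume
  map_add' φ ψ := by
    rw [FourierTransform.fourierInv_add, map_add]
    exact (SchwartzMap.toLpCLM ℂ (E := Rn n) ℂ 2 volume).map_add _ _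
  map_smul' c φ := by
    rw [FourierTransform.fourierInv_smul, map_smul]
    exact (SchwartzMap.toLpCLM ℂ (E := Rn n) ℂ 2 volume).map_smul _ _

lemma weightedInv_ae (t : ℝ) (φ : 𝓢(Rn n, ℂ)) : weightedInv t φ =ᵐ[volume] fun ξ =>
    (((1 + (2 * Real.pi * ‖ξ‖) ^ 2) ^ (t / 2) : ℝ) : ℂ) * 𝓕⁻ (φ : Rn n → ℂ) ξ := by
  filter_upwards [(weightS (t / 2) (𝓕⁻ φ)).coeFn_toLp 2 volume] with ξ hξ
  change ((weightS (t / 2) (𝓕⁻ φ)).toLp 2 volume) ξ = _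
  rw [hξ, weightS_apply, SchwartzMap.fourierInv_coe]

lemma enorm_weightedInv_sq (t : ℝ) (φ : 𝓢(Rn n, ℂ)) : ‖weightedInv t φ‖ₑ ^ 2 =
    ∫⁻ ξ, ENNReal.ofReal ((1 + (2 * Real.pi * ‖ξ‖) ^ 2) ^ t) *
      ‖𝓕⁻ (φ : Rn n → ℂ) ξ‖ₑ ^ 2 := by
  rw [enorm_Lp_two_sq (weightedInv_ae t φ)]
  refine lintegral_congr fun ξ => ?_
  rw [enorm_mul, mul_pow, ← ofReal_norm (_ : ℂ), Complex.norm_real,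
    Real.norm_of_nonneg (by positivity), ← ENNReal.ofReal_pow (by positivity),
    ← Real.rpow_mul_natCast (by positivity)]
  norm_num

lemma denseRange_weightedInv (t : ℝ) : DenseRange (weightedInv (n := n) t) := by
  have h1 : DenseRange (SchwartzMap.toLpCLM ℂ (E := Rn n) ℂ 2 volume) :=
    SchwartzMap.denseRange_toLpCLM ENNReal.ofNat_ne_top
  refine h1.mono ?_
  rintro _ ⟨φ, rfl⟩
  refine ⟨𝓕 (weightS (-(t / 2)) φ), ?_⟩
  change (weightS (t / 2) (𝓕⁻ (𝓕 (weightS (-(t / 2)) φ)))).toLp 2 volume = φ.toLp 2 volume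
  rw [FourierTransform.fourierInv_fourier_eq, weightS_weightS_neg]

lemma ofReal_rpow_mul_enorm_sq {w : ℝ} (hw : 0 < w) (r : ℝ) (z : ℂ) :
    ENNReal.ofReal (w ^ r) * ‖((w ^ (-r / 2) : ℝ) : ℂ) * starRingEnd ℂ z‖ₑ ^ 2 = ‖z‖ₑ ^ 2 := by
  have h1 : 0 < w ^ (-r / 2) := Real.rpow_pos_of_pos hw _
  have h2 : (w ^ (-r / 2)) ^ 2 = w ^ (-r) := by
    rw [← Real.rpow_mul_natCast hw.le]; norm_num
  rw [enorm_sq_eq_ofReal, enorm_sq_eq_ofReal, norm_mul, RCLike.norm_conj, Complex.norm_real,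
    Real.norm_of_nonneg h1.le, mul_pow, h2, ← ENNReal.ofReal_mul (Real.rpow_nonneg hw.le _),
    ← mul_assoc, ← Real.rpow_add hw, add_neg_cancel, Real.rpow_zero, one_mul]

/-- Riesz representation in a Sobolev space of nonpositive order on the dual side. -/
lemma exists_repr_of_enorm_sq_le {r : ℝ} (hr : 0 ≤ r) {T : 𝓢(Rn n, ℂ) →ₗ[ℂ] ℂ} {C : ℝ}
    (hC : 0 ≤ C) (hT : ∀ φ, ‖T φ‖ₑ ^ 2 ≤ ENNReal.ofReal C *
      ∫⁻ ξ, ENNReal.ofReal ((1 + (2 * Real.pi * ‖ξ‖) ^ 2) ^ (-r)) *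
        ‖𝓕⁻ (φ : Rn n → ℂ) ξ‖ₑ ^ 2) :
    ∃ d : Lp ℂ 2 (volume : Measure (Rn n)), (∀ φ : 𝓢(Rn n, ℂ), ∫ x, d x * φ x = T φ) ∧
      ∫⁻ ξ, ENNReal.ofReal ((1 + (2 * Real.pi * ‖ξ‖) ^ 2) ^ r) *
        ‖(𝓕 d : Lp ℂ 2 (volume : Measure (Rn n))) ξ‖ₑ ^ 2 < ⊤ := by
  set e := weightedInv (n := n) (-r)
  have hTe : ∀ φ, ‖T φ‖ ≤ Real.sqrt C * ‖e φ‖ := by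
    intro φ
    have h := hT φ
    rw [← enorm_weightedInv_sq, enorm_sq_eq_ofReal, enorm_sq_eq_ofReal,
      ← ENNReal.ofReal_mul hC, ENNReal.ofReal_le_ofReal_iff (by positivity)] at h
    rw [← Real.sqrt_sq (norm_nonneg (e φ)), ← Real.sqrt_mul hC]
    exact Real.le_sqrt_of_sq_le h
  -- The functional is bounded with respect to the norm of `e φ`, and `e` has dense range, so it
  -- extends to L² and is represented there by some D.
  set D := (InnerProductSpace.toDual ℂ (Lp ℂ 2 (volume : Measure (Rn n)))).symm
    (T.extendOfNorm e) with hD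
  have hDe : ∀ φ, inner ℂ D (e φ) = T φ := fun φ => by
    rw [hD, InnerProductSpace.toDual_symm_apply]
    exact LinearMap.extendOfNorm_eq (denseRange_weightedInv _) ⟨_, hTe⟩ φ
  -- Since ∫ dφ = ∫ (𝓕 d)(𝓕⁻φ), the transform of `d` must be the conjugate of D times the weight to
  -- the power -r/2. It is in L² because r ≥ 0, and multiplying |k|² by the r-th power of the weight
  -- gives back |D|².
  set k : Rn n → ℂ := fun ξ =>
    (((1 + (2 * Real.pi * ‖ξ‖) ^ 2) ^ (-r / 2) : ℝ) : ℂ) * starRingEnd ℂ (D ξ) with hk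
  have hk2 : MemLp k 2 volume := by
    have hstar : MemLp (fun ξ => starRingEnd ℂ (D ξ)) 2 volume := (Lp.memLp D).star
    refine hstar.of_le ((Measurable.aestronglyMeasurable (by fun_prop)).mul hstar.1)
      (Eventually.of_forall fun ξ => ?_)
    rw [hk, norm_mul, Complex.norm_real, Real.norm_of_nonneg (by positivity)]
    refine mul_le_of_le_one_left (norm_nonneg _) ?_
    exact Real.rpow_le_one_of_one_le_of_nonpos
      (by linarith [sq_nonneg (2 * Real.pi * ‖ξ‖)]) (by linarith)
  set d : Lp ℂ 2 (volume : Measure (Rn n)) := 𝓕⁻ (hk2.toLp k) with hd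
  have hfd : (𝓕 d : Lp ℂ 2 (volume : Measure (Rn n))) = hk2.toLp k :=
    (Lp.fourierTransformₗᵢ (Rn n) ℂ).apply_symm_apply _
  refine ⟨d, fun φ => ?_, ?_⟩
  · have h1 := integral_smul_fourierInv_Lp (hk2.toLp k) φ
    rw [← hDe, L2.inner_def]
    simp only [smul_eq_mul] at h1
    simp only [mul_comm (d _)]
    rw [hd, h1]
    refine integral_congr_ae ?_
    filter_upwards [hk2.coeFn_toLp, weightedInv_ae (-r) φ] with ξ h2 h3
    rw [h2, h3, RCLike.inner_apply, hk]
    ring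
  · have h2 : ∫⁻ ξ, ‖D ξ‖ₑ ^ 2 < ⊤ :=
      (memLp_two_iff_lintegral (Lp.aestronglyMeasurable D)).1 (Lp.memLp D)
    refine lt_of_eq_of_lt (lintegral_congr_ae ?_) h2
    filter_upwards [hk2.coeFn_toLp] with ξ hξ
    rw [hfd, hξ]
    exact ofReal_rpow_mul_enorm_sq (by positivity) r (D ξ)

/-- The Sobolev embedding `H^{s(p-2)} ⊆ L^p`. -/
lemma memLp_pExp_of_lintegral (hn : 1 ≤ n) (hs0 : 0 < s) {d : Lp ℂ 2 (volume : Measure (Rn n))}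
    (hd : ∫⁻ ξ, ENNReal.ofReal ((1 + (2 * Real.pi * ‖ξ‖) ^ 2) ^ (s * (pReal n s - 2))) *
        ‖(𝓕 d : Lp ℂ 2 (volume : Measure (Rn n))) ξ‖ₑ ^ 2 < ⊤) :
    MemLp d (pExp n s) volume := by
  -- For p = 2 nothing is needed beyond L². For p > 2 one has p = n/(2s), and with r = s(p - 2) the
  -- critical exponent is 2n/(n - 2r) = 2n/(4s) = p.
  rcases eq_or_lt_of_le (two_le_pReal (n := n) (s := s)) with h2 | h2
  · rw [pExp, ← h2, ENNReal.ofReal_ofNat]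
    exact Lp.memLp d
  have hn0 : (0 : ℝ) < n := by exact_mod_cast hn
  have hp : pReal n s = n / (2 * s) := by
    rw [pReal] at h2 ⊢
    exact max_eq_right (le_of_lt ((lt_max_iff.1 h2).resolve_left (lt_irrefl _)))
  set p := pReal n s with hpdef
  have hp0 : 0 < p := pReal_pos
  have hsp : 2 * s * p = n := by
    rw [hp]; field_simp
  set r := s * (p - 2) with hr
  have hr0 : 0 < r := mul_pos hs0 (by linarith)
  have hrn : 2 * r < n := by
    rw [hr, ← hsp]; nlinarith
  obtain ⟨C, hC0, hC⟩ := exists_eLpNorm_le_fourier hn hr0 hrn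
  set I := ∫⁻ ξ, ENNReal.ofReal ((1 + (2 * Real.pi * ‖ξ‖) ^ 2) ^ r) *
        ‖(𝓕 d : Lp ℂ 2 (volume : Measure (Rn n))) ξ‖ₑ ^ 2 with hI
  have hexp : 2 * (n : ℝ) / (n - 2 * r) = p := by
    have h3 : (n : ℝ) - 2 * r = 4 * s := by rw [hr, ← hsp]; ring
    rw [h3, ← hsp]; field_simp; norm_num
  refine ⟨Lp.aestronglyMeasurable d, ?_⟩
  have h4 := hC d (Real.sqrt (I.toReal + 1)) (by positivity) ?_
  · rw [hexp] at h4
    exact h4.trans_lt ENNReal.ofReal_lt_top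
  · rw [Real.sq_sqrt (by positivity)]
    refine le_trans ?_ (ENNReal.ofReal_le_ofReal (le_add_of_nonneg_right zero_le_one))
    rw [ENNReal.ofReal_toReal hd.ne, hI]
    refine lintegral_mono fun ξ => mul_le_mul_left (ENNReal.ofReal_le_ofReal ?_) _
    have h5 : (1 : ℝ) ≤ 2 * Real.pi := by linarith [Real.pi_gt_three]
    have h6 : ‖ξ‖ ≤ 2 * Real.pi * ‖ξ‖ := le_mul_of_one_le_left (norm_nonneg _) h5
    calc ‖ξ‖ ^ (2 * r) = (‖ξ‖ ^ 2) ^ r := by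
          rw [← Real.rpow_natCast, ← Real.rpow_mul (norm_nonneg _)]; norm_num
      _ ≤ (1 + (2 * Real.pi * ‖ξ‖) ^ 2) ^ r := by
          refine Real.rpow_le_rpow (by positivity) ?_ hr0.le
          have := pow_le_pow_left₀ (norm_nonneg _) h6 2
          linarith

/-- The fractional divergence of a field in `H^{sp-s}` is an `L^p` function. -/
lemma exists_divergence (hn : 1 ≤ n) (hs0 : 0 < s) (hs1 : s < 1) {F : Rn n × Rn n → Cn n}
    (hF : MemH (s * pReal n s - s) fun z : R2n n => F z.ofLp) :
    ∃ d : Rn n → ℂ, MemLp d 2 volume ∧ MemLp d (pExp n s) volume ∧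
      ∀ φ : 𝓢(Rn n, ℂ), ∫ x, d x * φ x = ∫ z, dot (F z) (fracGrad n s φ z) := by
  have hp2 : 2 ≤ pReal n s := two_le_pReal
  obtain ⟨hF2, C, hC0, hC⟩ := exists_enorm_integral_dot_sq_le hn hs0 hs1
    (t := s * pReal n s - s) (by nlinarith) hF
  have hi : ∀ φ : 𝓢(Rn n, ℂ), Integrable (fun z => dot (F z) (fracGrad n s φ z)) volume :=
    fun φ => integrable_dot hF2 (memLp_fracGrad_schwartz hn hs0 hs1 φ)
  let T : 𝓢(Rn n, ℂ) →ₗ[ℂ] ℂ :=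
    { toFun := fun φ => ∫ z, dot (F z) (fracGrad n s φ z)
      map_add' := fun φ ψ => by
        rw [← integral_add (hi φ) (hi ψ)]
        refine integral_congr_ae (Eventually.of_forall fun z => ?_)
        have h := congrFun (fracGrad_add (s := s) (φ : Rn n → ℂ) ψ) z
        rw [Pi.add_apply] at h
        exact (congrArg (dot (F z)) h).trans (dot_add_right _ _ _)
      map_smul' := fun c φ => by
        rw [RingHom.id_apply, smul_eq_mul, ← integral_const_mul]
        refine integral_congr_ae (Eventually.of_forall fun z => ?_)
        have h := congrFun (fracGrad_smul (s := s) c (φ : Rn n → ℂ)) z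
        rw [Pi.smul_apply] at h
        exact (congrArg (dot (F z)) h).trans (dot_smul_right _ _ _) }
  -- The order H^{sp-s} in the hypothesis is the one for which the divergence gains s(p - 2)
  -- derivatives over L², exactly enough for L^p.
  have he : s - (s * pReal n s - s) = -(s * (pReal n s - 2)) := by ring
  rw [he] at hC
  obtain ⟨d, hd1, hd2⟩ := exists_repr_of_enorm_sq_le (r := s * (pReal n s - 2))
    (mul_nonneg hs0.le (by linarith)) (T := T) hC0 hC
  exact ⟨d, Lp.memLp d, memLp_pExp_of_lintegral hn hs0 hd2, hd1⟩

/-- Makes the function chosen in `fracDiv` unique almost everywhere, so that it inherits the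
properties of any constructed representative. -/
lemma IsFracDiv.ae_eq {v : Rn n × Rn n → Cn n} {d d' : Rn n → ℂ} (h : IsFracDiv n s v d)
    (h' : IsFracDiv n s v d') : d =ᵐ[volume] d' := by
  refine ae_eq_of_integral_contDiff_smul_eq h.1 h'.1 fun g hg hgc => ?_
  have hgt : IsTest Set.univ fun x => (g x : ℂ) :=
    ⟨Complex.ofRealCLM.contDiff.comp hg, hgc.comp_left Complex.ofReal_zero, Set.subset_univ _⟩
  have h1 := (h.2 _ hgt).trans (h'.2 _ hgt).symm
  simpa only [Complex.real_smul, mul_comm] using h1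

/-- The fractional divergence of a field in `H^{sp-s}`. -/
lemma fracDiv_spec (hn : 1 ≤ n) (hs0 : 0 < s) (hs1 : s < 1) {F : Rn n × Rn n → Cn n}
    (hF : MemH (s * pReal n s - s) fun z : R2n n => F z.ofLp) :
    IsFracDiv n s F (fracDiv n s F) ∧ MemLp (fracDiv n s F) (pExp n s) volume ∧
      ∀ φ : 𝓢(Rn n, ℂ), ∫ x, fracDiv n s F x * φ x = ∫ z, dot (F z) (fracGrad n s φ z) := by
  obtain ⟨d, hd2, hdp, hd⟩ := exists_divergence hn hs0 hs1 hF
  have hdiv : IsFracDiv n s F d := by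
    refine ⟨hd2.locallyIntegrable one_le_two, fun φ hφ => ?_⟩
    exact hd (hφ.2.1.toSchwartzMap hφ.1)
  have hex : ∃ d, IsFracDiv n s F d := ⟨d, hdiv⟩
  have hspec : IsFracDiv n s F (fracDiv n s F) := by
    rw [fracDiv, dif_pos hex]
    exact hex.choose_spec
  have hae := hspec.ae_eq hdiv
  refine ⟨hspec, (memLp_congr_ae hae).2 hdp, fun φ => ?_⟩
  rw [← hd]
  refine integral_congr_ae ?_
  filter_upwards [hae] with x hx
  rw [hx]

end Divergence

end

end FracMag

namespace FracMag

noncomputable section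

variable {n : ℕ} {s : ℝ}

/-! ### Parallel, symmetric and antisymmetric parts. -/

section Parts

lemma norm_toCn (x : Rn n) : ‖toCn x‖ = ‖x‖ := by
  simp [toCn, EuclideanSpace.norm_eq]

lemma toCn_smul (c : ℝ) (x : Rn n) : toCn (c • x) = (c : ℂ) • toCn x := by
  ext j; simp [toCn]

lemma dot_toCn_self (x : Rn n) : dot (toCn x) (toCn x) = ((‖x‖ ^ 2 : ℝ) : ℂ) := by
  have h : conjCn (toCn x) = toCn x := by ext j; simp [conjCn, toCn]
  rw [← norm_toCn, ← dot_conjCn_self, h]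

/-- The fractional gradient is a scalar multiple of x - y, so it sees only the parallel part. -/
lemma dot_parPart_fracGrad (A : Rn n × Rn n → Cn n) (u : Rn n → ℂ) (z : Rn n × Rn n) :
    dot (parPart A z) (fracGrad n s u z) = dot (A z) (fracGrad n s u z) := by
  unfold parPart
  split_ifs with h
  · rfl
  · have hne : ((‖z.1 - z.2‖ ^ 2 : ℝ) : ℂ) ≠ 0 := by
      have hpos : 0 < ‖z.1 - z.2‖ := norm_pos_iff.2 (sub_ne_zero.2 h)
      exact Complex.ofReal_ne_zero.2 (by positivity)
    have hα : toCn (alpha n s z) = (-((Real.sqrt (fracConst n s) / Real.sqrt 2 /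
        ‖z.2 - z.1‖ ^ ((n : ℝ) / 2 + s + 1) : ℝ) : ℂ)) • toCn (z.1 - z.2) := by
      rw [alpha, toCn_smul, ← neg_sub z.1 z.2, toCn_neg, smul_neg, neg_smul, norm_neg]
    rw [fracGrad, hα]
    simp only [dot_smul_right, dot_smul_left, dot_toCn_self]
    rw [div_mul_cancel₀ _ hne]

lemma symPart_swap (A : Rn n × Rn n → Cn n) (z : Rn n × Rn n) :
    symPart A z.swap = symPart A z := by
  simp only [symPart, Prod.swap_swap, add_comm]

lemma antiPart_swap (A : Rn n × Rn n → Cn n) (z : Rn n × Rn n) :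
    antiPart A z.swap = -antiPart A z := by
  simp only [antiPart, symPart_swap]
  simp only [symPart]
  module

lemma norm_symPart_le (A : Rn n × Rn n → Cn n) (z : Rn n × Rn n) :
    ‖symPart A z‖ ≤ ‖A z‖ + ‖A z.swap‖ := by
  rw [symPart, norm_smul]
  have h1 := norm_add_le (A z) (A z.swap)
  have h2 : ‖(1 / 2 : ℂ)‖ = 1 / 2 := by norm_num
  rw [h2]
  linarith [norm_nonneg (A z), norm_nonneg (A z.swap)]

lemma norm_antiPart_le (A : Rn n × Rn n → Cn n) (z : Rn n × Rn n) :
    ‖antiPart A z‖ ≤ ‖A z‖ + ‖A z.swap‖ := by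
  have h : antiPart A z = (1 / 2 : ℂ) • (A z - A z.swap) := by
    simp only [antiPart, symPart]
    module
  rw [h, norm_smul]
  have h1 := norm_sub_le (A z) (A z.swap)
  have h2 : ‖(1 / 2 : ℂ)‖ = 1 / 2 := by norm_num
  rw [h2]
  linarith [norm_nonneg (A z), norm_nonneg (A z.swap)]

lemma aestronglyMeasurable_symPart {A : Rn n × Rn n → Cn n}
    (hA : AEStronglyMeasurable A volume) : AEStronglyMeasurable (symPart A) volume :=
  (hA.add (aestronglyMeasurable_comp_swap hA)).const_smul (1 / 2 : ℂ)

lemma aestronglyMeasurable_antiPart {A : Rn n × Rn n → Cn n}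
    (hA : AEStronglyMeasurable A volume) : AEStronglyMeasurable (antiPart A) volume :=
  hA.sub (aestronglyMeasurable_symPart hA)

lemma IsMult.symPart {A : Rn n × Rn n → Cn n} (hA : IsMult s A) : IsMult s (symPart A) :=
  hA.mono hA.swap (aestronglyMeasurable_symPart hA.aesm) (norm_symPart_le A)

lemma IsMult.antiPart {A : Rn n × Rn n → Cn n} (hA : IsMult s A) : IsMult s (antiPart A) :=
  hA.mono hA.swap (aestronglyMeasurable_antiPart hA.aesm) (norm_antiPart_le A)

lemma fracGrad_swap (u : Rn n → ℂ) (z : Rn n × Rn n) :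
    fracGrad n s u z.swap = fracGrad n s u z := by
  simp only [fracGrad, alpha_eq, Prod.fst_swap, Prod.snd_swap]
  rw [← neg_sub z.2 z.1, alphaV_neg, toCn_neg, smul_neg, ← neg_smul, neg_sub]

end Parts

/-! ### The product rule and the decomposition of the magnetic form. -/

section Identity

lemma integral_comp_swap {E : Type*} [NormedAddCommGroup E] [NormedSpace ℝ E]
    (K : Rn n × Rn n → E) : ∫ z : Rn n × Rn n, K z.swap = ∫ z, K z :=
  (Measure.measurePreserving_swap (μ := (volume : Measure (Rn n)))
    (ν := (volume : Measure (Rn n)))).integral_comp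
    MeasurableEquiv.prodComm.measurableEmbedding K

lemma IsMult.integrable_fst (hn : 1 ≤ n) (hs0 : 0 < s) (hs1 : s < 1) {A : Rn n × Rn n → Cn n}
    (hA : IsMult s A) (u v : Hs n s) :
    Integrable (fun z => dot (A z) (fracGrad n s u.fn z) * v.fn z.1) volume := by
  refine (integrable_dot (hA.memLp₁ v) (memLp_fracGrad hn hs0 hs1 u)).congr
    (Eventually.of_forall fun z => ?_)
  simp only [dot_smul_left, mul_comm]

lemma IsMult.integrable_snd (hn : 1 ≤ n) (hs0 : 0 < s) (hs1 : s < 1) {A : Rn n × Rn n → Cn n}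
    (hA : IsMult s A) (u v : Hs n s) :
    Integrable (fun z => dot (A z) (fracGrad n s u.fn z) * v.fn z.2) volume := by
  refine (integrable_dot (hA.memLp₂ v) (memLp_fracGrad hn hs0 hs1 u)).congr
    (Eventually.of_forall fun z => ?_)
  simp only [dot_smul_left, mul_comm]

/-- The left side of the product rule as a continuous form, which lets the rule be checked on
Schwartz functions. The factor u(y) is where the second bound of `IsMult` enters. -/
lemma IsMult.exists_form (hn : 1 ≤ n) (hs0 : 0 < s) (hs1 : s < 1) {A : Rn n × Rn n → Cn n}
    (hA : IsMult s A) : ∃ B : Hs n s →L[ℂ] Hs n s →L[ℂ] ℂ, ∀ u v,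
      B u v = (∫ z, dot (A z) (fracGrad n s u.fn z) * v.fn z.1) +
        ∫ z, dot (A z) (fracGrad n s v.fn z) * u.fn z.2 := by
  obtain ⟨L₁, hL₁⟩ := hA.exists_mulL₁
  obtain ⟨L₂, hL₂⟩ := hA.exists_mulL₂
  have hg := gradL_ae (n := n) hn hs0 hs1
  refine ⟨((pairL volume n).bilinearComp L₁ (gradL hn hs0 hs1)).flip +
    (pairL volume n).bilinearComp L₂ (gradL hn hs0 hs1), fun u v => ?_⟩
  rw [_root_.add_apply, _root_.add_apply, ContinuousLinearMap.flip_apply,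
    ContinuousLinearMap.bilinearComp_apply, ContinuousLinearMap.bilinearComp_apply,
    pairL_eq (hL₁ v) (hg u), pairL_eq (hL₂ u) (hg v)]
  simp only [dot_smul_left, mul_comm]

open SchwartzMap in
/-- The product rule for the fractional divergence, tested with products of `Hˢ` functions. -/
lemma integral_fracDiv_mul (hn : 1 ≤ n) (hs0 : 0 < s) (hs1 : s < 1) {A : Rn n × Rn n → Cn n}
    (hA : IsMult s A) (hF : MemH (s * pReal n s - s) fun z : R2n n => parPart A z.ofLp)
    (u v : Hs n s) :
    (∫ z, dot (A z) (fracGrad n s u.fn z) * v.fn z.1) +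
        (∫ z, dot (A z) (fracGrad n s v.fn z) * u.fn z.2) =
      ∫ x, fracDiv n s (parPart A) x * u.fn x * v.fn x := by
  obtain ⟨-, hdp, hd⟩ := fracDiv_spec hn hs0 hs1 hF
  obtain ⟨B, hB⟩ := hA.exists_form hn hs0 hs1
  obtain ⟨D, hD⟩ := Hs.exists_potL hn hs0 hdp
  rw [← hB, ← hD]
  -- Both sides are continuous on Hˢ × Hˢ, the right side because the divergence is in L^p. For
  -- Schwartz functions the product is an admissible test function for the divergence.
  refine (Hs.denseRange_ofSchwartz (n := n) hs0.le).induction_on₂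
    (p := fun u v => B u v = D u v) (isClosed_eq (by fun_prop) (by fun_prop)) (fun φ ψ => ?_) u v
  rw [hB, hD]
  have hφ := Hs.fn_ofSchwartz (s := s) φ
  have hψ := Hs.fn_ofSchwartz (s := s) ψ
  have hχ : ∃ χ : 𝓢(Rn n, ℂ), ∀ x, χ x = φ x * ψ x :=
    ⟨SchwartzMap.smulLeftCLM ℂ φ ψ, fun x =>
      SchwartzMap.smulLeftCLM_apply_apply φ.hasTemperateGrowth ψ x⟩
  obtain ⟨χ, hχ⟩ := hχ
  have e1 : ∫ x, fracDiv n s (parPart A) x * (Hs.ofSchwartz s φ).fn x *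
      (Hs.ofSchwartz s ψ).fn x = ∫ x, fracDiv n s (parPart A) x * χ x := by
    refine integral_congr_ae ?_
    filter_upwards [hφ, hψ] with x h1 h2
    rw [h1, h2, hχ, mul_assoc]
  rw [e1, hd, ← integral_add (hA.integrable_fst hn hs0 hs1 _ _)
    (hA.integrable_snd hn hs0 hs1 _ _)]
  refine integral_congr_ae ?_
  filter_upwards [Measure.quasiMeasurePreserving_fst.ae hψ,
    Measure.quasiMeasurePreserving_snd.ae hφ, fracGrad_congr (s := s) hφ,
    fracGrad_congr (s := s) hψ] with z h1 h2 h3 h4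
  rw [h1, h2, h3, h4, dot_parPart_fracGrad]
  -- This is φ(x)ψ(x) - φ(y)ψ(y) = (φ(x) - φ(y))ψ(x) + (ψ(x) - ψ(y))φ(y).
  simp only [fracGrad, dot_smul_right, hχ]
  ring

/-- The function `x ↦ ∫ A(x,y)·A(x,y) dy`. -/
def sqDensity (A : Rn n × Rn n → Cn n) (x : Rn n) : ℂ := ∫ y, dot (A (x, y)) (A (x, y))

/-- The density is dominated by (𝒥₂A)². -/
lemma memLp_sqDensity {A : Rn n × Rn n → Cn n} (hA : AEStronglyMeasurable A volume)
    (h : MemLp (J2 A) (2 * pExp n s) volume) : MemLp (sqDensity A) (pExp n s) volume := by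
  have hm : AEStronglyMeasurable (fun z => dot (A z) (A z)) volume :=
    continuous_dot.comp_aestronglyMeasurable (g := fun p : Cn n × Cn n => dot p.1 p.2)
      (f := fun z => (A z, A z)) (hA.prodMk hA)
  refine ⟨AEStronglyMeasurable.integral_prod_right' (f := fun z => dot (A z) (A z)) hm, ?_⟩
  refine lt_of_le_of_lt (eLpNorm_mono_enorm fun x => ?_) (memLp_J2_sq h).2
  rw [enorm_eq_self, J2, eLpNorm_two_sq]
  refine (enorm_integral_le_lintegral_enorm _).trans (lintegral_mono fun y => ?_)
  rw [enorm_sq_eq_ofReal, ← ofReal_norm, sq]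
  exact ENNReal.ofReal_le_ofReal (norm_dot_le _ _)

lemma integral_sqDensity_mul {A : Rn n × Rn n → Cn n} (hA : IsMult s A) (u v : Hs n s) :
    ∫ z : Rn n × Rn n, dot (u.fn z.1 • A z) (v.fn z.1 • A z) =
      ∫ x, sqDensity A x * u.fn x * v.fn x := by
  rw [Measure.volume_eq_prod, integral_prod _ (integrable_dot (hA.memLp₁ u) (hA.memLp₁ v))]
  refine integral_congr_ae (Eventually.of_forall fun x => ?_)
  simp only [dot_smul_left, dot_smul_right, sqDensity]
  rw [integral_const_mul, integral_const_mul]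
  ring

lemma bigQ_eq (A : Rn n × Rn n → Cn n) (q : Rn n → ℝ) :
    bigQ n s A q = fun x =>
      (q x : ℂ) + sqDensity A x + fracDiv n s (parPart (symPart A)) x := rfl

lemma memLp_bigQ (hn : 1 ≤ n) (hs0 : 0 < s) (hs1 : s < 1) {A : Rn n × Rn n → Cn n}
    {q : Rn n → ℝ} (hP : IsPotential₀ n s A q) : MemLp (bigQ n s A q) (pExp n s) volume := by
  have h1 : MemLp (fun x => (q x : ℂ)) (pExp n s) volume := hP.memq.ofReal
  have h2 := (h1.add (memLp_sqDensity hP.aesm hP.memJ2)).add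
    (fracDiv_spec hn hs0 hs1 hP.sympar).2.1
  refine h2.ae_eq (Eventually.of_forall fun x => ?_)
  rw [bigQ_eq, Pi.add_apply, Pi.add_apply]

/-- The symmetric part of the field enters the form only through its divergence. -/
theorem bform_eq (hn : 1 ≤ n) (hs0 : 0 < s) (hs1 : s < 1) {A : Rn n × Rn n → Cn n}
    {q : Rn n → ℝ} (hP : IsPotential₀ n s A q) (u v : Hs n s) :
    bform A q u v = (∫ z, dot (fracGrad n s u.fn z) (fracGrad n s v.fn z)) +
      2 * (∫ z, dot (parPart (antiPart A) z) (fracGrad n s u.fn z) * v.fn z.1) +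
        ∫ x, bigQ n s A q x * u.fn x * v.fn x := by
  have hA : IsMult s A := isMult_of_memLp hn hs0 hP.aesm hP.memJ1 hP.memJ2
  have hS := hA.symPart
  have hE := hA.antiPart
  have hgu := memLp_fracGrad hn hs0 hs1 u
  have hgv := memLp_fracGrad hn hs0 hs1 v
  have i0 := integrable_dot hgu hgv
  have i1 := hS.integrable_fst hn hs0 hs1 u v
  have i2 := hS.integrable_fst hn hs0 hs1 v u
  have i3 := hE.integrable_fst hn hs0 hs1 u v
  have i4 := hE.integrable_fst hn hs0 hs1 v u
  have i5 := integrable_dot (hA.memLp₁ u) (hA.memLp₁ v)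
  have hdec : ∫ z : Rn n × Rn n, dot (magGrad n s A u.fn z) (magGrad n s A v.fn z) =
      (∫ z, dot (fracGrad n s u.fn z) (fracGrad n s v.fn z)) +
      ((∫ z, dot (symPart A z) (fracGrad n s u.fn z) * v.fn z.1) +
        ∫ z, dot (symPart A z) (fracGrad n s v.fn z) * u.fn z.1) +
      ((∫ z, dot (antiPart A z) (fracGrad n s u.fn z) * v.fn z.1) +
        ∫ z, dot (antiPart A z) (fracGrad n s v.fn z) * u.fn z.1) +
      ∫ z : Rn n × Rn n, dot (u.fn z.1 • A z) (v.fn z.1 • A z) := by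
    rw [← integral_add i1 i2, ← integral_add i3 i4, ← integral_add i0 (i1.fun_add i2),
      ← integral_add (i0.fun_add (i1.fun_add i2)) (i3.fun_add i4),
      ← integral_add ((i0.fun_add (i1.fun_add i2)).fun_add (i3.fun_add i4)) i5]
    refine integral_congr_ae (Eventually.of_forall fun z => ?_)
    have hsplit : A z = symPart A z + antiPart A z := by
      rw [antiPart, add_sub_cancel]
    have h1 : ∀ w, dot (A z) w = dot (symPart A z) w + dot (antiPart A z) w := fun w => by
      rw [← dot_add_left, ← hsplit]
    simp only [magGrad, dot_add_left, dot_add_right, dot_smul_left, dot_smul_right,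
      dot_comm _ (A z)]
    rw [h1 (fracGrad n s u.fn z), h1 (fracGrad n s v.fn z)]
    ring
  -- The symmetric part and ∇ˢv are invariant under swapping x and y, so u(x) may be replaced by
  -- u(y), as the product rule requires.
  have hswapS : ∫ z, dot (symPart A z) (fracGrad n s v.fn z) * u.fn z.1 =
      ∫ z, dot (symPart A z) (fracGrad n s v.fn z) * u.fn z.2 := by
    rw [← integral_comp_swap]
    simp only [symPart_swap, fracGrad_swap, Prod.fst_swap]
  have hswapE : ∫ z, dot (antiPart A z) (fracGrad n s v.fn z) * u.fn z.1 =
      ∫ z, dot (antiPart A z) (fracGrad n s u.fn z) * v.fn z.1 := by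
    have hneg : ∀ (f g : Hs n s), ∫ z, dot (antiPart A z) (fracGrad n s f.fn z) * g.fn z.2 =
        -∫ z, dot (antiPart A z) (fracGrad n s f.fn z) * g.fn z.1 := by
      intro f g
      rw [← integral_comp_swap, ← integral_neg]
      refine integral_congr_ae (Eventually.of_forall fun z => ?_)
      simp only [antiPart_swap, fracGrad_swap, Prod.snd_swap]
      rw [← neg_one_smul ℂ, dot_smul_left]
      ring
    -- Both sides integrate (u(x) - u(y))(v(x) - v(y)) against the antisymmetric part dotted with α.
    -- As the swap changes the sign of that part, each side is twice its first integral.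
    have hdiff : (∫ z, dot (antiPart A z) (fracGrad n s v.fn z) * u.fn z.1) -
        (∫ z, dot (antiPart A z) (fracGrad n s v.fn z) * u.fn z.2) =
        (∫ z, dot (antiPart A z) (fracGrad n s u.fn z) * v.fn z.1) -
        ∫ z, dot (antiPart A z) (fracGrad n s u.fn z) * v.fn z.2 := by
      rw [← integral_sub i4 (hE.integrable_snd hn hs0 hs1 v u),
        ← integral_sub i3 (hE.integrable_snd hn hs0 hs1 u v)]
      refine integral_congr_ae (Eventually.of_forall fun z => ?_)
      simp only [fracGrad, dot_smul_right]
      ring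
    rw [hneg, hneg, sub_neg_eq_add, sub_neg_eq_add, ← two_mul, ← two_mul] at hdiff
    exact mul_left_cancel₀ two_ne_zero hdiff
  have hQ : ∫ x, bigQ n s A q x * u.fn x * v.fn x = (∫ x, (q x : ℂ) * u.fn x * v.fn x) +
      (∫ x, sqDensity A x * u.fn x * v.fn x) +
      ∫ x, fracDiv n s (parPart (symPart A)) x * u.fn x * v.fn x := by
    have j1 := Hs.integrable_mul_mul hn hs0 (g := fun x => (q x : ℂ)) hP.memq.ofReal u v
    have j2 := Hs.integrable_mul_mul hn hs0 (memLp_sqDensity hP.aesm hP.memJ2) u v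
    have j3 := Hs.integrable_mul_mul hn hs0 (fracDiv_spec hn hs0 hs1 hP.sympar).2.1 u v
    rw [← integral_add j1 j2, ← integral_add (j1.fun_add j2) j3]
    refine integral_congr_ae (Eventually.of_forall fun x => ?_)
    simp only [bigQ_eq]
    ring
  simp only [dot_parPart_fracGrad]
  rw [bform, hdec, hswapS, hswapE, integral_fracDiv_mul hn hs0 hs1 hS hP.sympar,
    integral_sqDensity_mul hA, hQ]
  ring

end Identity

/-! ### The integral identity. -/

section Alessandrini

/-- Against a solution, the form depends on the second argument only through its class in the trace
space. -/
lemma bform_eq_of_sub_mem (hn : 1 ≤ n) (hs0 : 0 < s) (hs1 : s < 1) {Ω : Set (Rn n)}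
    {A : Rn n × Rn n → Cn n} {q : Rn n → ℝ} (hP : IsPotential₀ n s A q) {f u v w : Hs n s}
    (hu : IsSolution Ω A q f u) (h : v - w ∈ HsTilde n s Ω) :
    bform A q u v = bform A q u w := by
  obtain ⟨B, hB⟩ := exists_bformL hn hs0 hs1
    (isMult_of_memLp hn hs0 hP.aesm hP.memJ1 hP.memJ2) hP.memq
  have h1 := hu.2 _ h
  rw [← hB, map_sub, hB, hB] at h1
  exact sub_eq_zero.1 h1

/-- Both Λ₁ and Λ₂ at ([f₁], [f₂]) are values of their forms at the same pair (u₁, u₂). Subtracting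
the decompositions from `bform_eq` cancels the pure gradient term. -/
theorem alessandrini (hn : 1 ≤ n) (hs0 : 0 < s) (hs1 : s < 1) {Ω : Set (Rn n)}
    {A₁ A₂ : Rn n × Rn n → Cn n} {q₁ q₂ : Rn n → ℝ} (hP₁ : IsPotential₀ n s A₁ q₁)
    (hP₂ : IsPotential₀ n s A₂ q₂) (hex : ∀ f : Hs n s, ∃ u, IsSolution Ω A₂ q₂ f u)
    {Λ₁ Λ₂ : Trace n s Ω →L[ℂ] Trace n s Ω →L[ℂ] ℂ} (hΛ₁ : IsDNMap Ω A₁ q₁ Λ₁)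
    (hΛ₂ : IsDNMap Ω A₂ q₂ Λ₂) {f₁ f₂ u₁ u₂ : Hs n s} (hu₁ : IsSolution Ω A₁ q₁ f₁ u₁)
    (hu₂ : IsSolution Ω A₂ q₂ f₂ u₂) :
    Integrable (fun z : Rn n × Rn n =>
        dot (parPart (antiPart A₁) z - parPart (antiPart A₂) z) (fracGrad n s u₁.fn z) *
          u₂.fn z.1) volume ∧
      Integrable (fun x => (bigQ n s A₁ q₁ x - bigQ n s A₂ q₂ x) * u₁.fn x * u₂.fn x) volume ∧
      (Λ₁ - Λ₂) (Trace.mk Ω f₁) (Trace.mk Ω f₂) =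
        2 * (∫ x, (∫ y, dot (parPart (antiPart A₁) (x, y) - parPart (antiPart A₂) (x, y))
            (fracGrad n s u₁.fn (x, y))) * u₂.fn x) +
          ∫ x, (bigQ n s A₁ q₁ x - bigQ n s A₂ q₂ x) * u₁.fn x * u₂.fn x := by
  have hsub : ∀ a b c : Cn n, dot (a - b) c = dot a c - dot b c := fun a b c => by
    have h := dot_add_left (a - b) b c
    rw [sub_add_cancel] at h
    rw [h, add_sub_cancel_right]
  have hE : ∀ {A : Rn n × Rn n → Cn n} {q : Rn n → ℝ}, IsPotential₀ n s A q →
      Integrable (fun z : Rn n × Rn n =>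
        dot (parPart (antiPart A) z) (fracGrad n s u₁.fn z) * u₂.fn z.1) volume := by
    intro A q hP
    simp only [dot_parPart_fracGrad]
    exact (isMult_of_memLp hn hs0 hP.aesm hP.memJ1 hP.memJ2).antiPart.integrable_fst
      hn hs0 hs1 u₁ u₂
  have hQ : ∀ {A : Rn n × Rn n → Cn n} {q : Rn n → ℝ}, IsPotential₀ n s A q →
      Integrable (fun x => bigQ n s A q x * u₁.fn x * u₂.fn x) volume := fun hP =>
    Hs.integrable_mul_mul hn hs0 (memLp_bigQ hn hs0 hs1 hP) u₁ u₂
  have iE : Integrable (fun z : Rn n × Rn n =>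
      dot (parPart (antiPart A₁) z - parPart (antiPart A₂) z) (fracGrad n s u₁.fn z) *
        u₂.fn z.1) volume := by
    simp only [hsub, sub_mul]
    exact (hE hP₁).sub (hE hP₂)
  have iQ : Integrable (fun x => (bigQ n s A₁ q₁ x - bigQ n s A₂ q₂ x) * u₁.fn x * u₂.fn x)
      volume := by
    simp only [sub_mul]
    exact (hQ hP₁).sub (hQ hP₂)
  refine ⟨iE, iQ, ?_⟩
  -- Since u₁ solves the wrong equation for Λ₂, the second problem is solved with exterior value f₁.
  -- Symmetry of the form lets u₂ act as the solution, after which u' is exchanged for f₁ and f₁ for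
  -- u₁, all of the same class.
  obtain ⟨u', hu'⟩ := hex f₁
  have h1 : Λ₁ (Trace.mk Ω f₁) (Trace.mk Ω f₂) = bform A₁ q₁ u₁ u₂ := by
    rw [hΛ₁ f₁ f₂ u₁ hu₁]
    exact (bform_eq_of_sub_mem hn hs0 hs1 hP₁ hu₁ hu₂.1).symm
  have h2 : Λ₂ (Trace.mk Ω f₁) (Trace.mk Ω f₂) = bform A₂ q₂ u₁ u₂ := by
    rw [hΛ₂ f₁ f₂ u' hu', ← bform_eq_of_sub_mem hn hs0 hs1 hP₂ hu' hu₂.1, bform_comm,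
      bform_eq_of_sub_mem hn hs0 hs1 hP₂ hu₂ hu'.1,
      ← bform_eq_of_sub_mem hn hs0 hs1 hP₂ hu₂ hu₁.1, bform_comm]
  have h3 : ∫ x, (∫ y, dot (parPart (antiPart A₁) (x, y) - parPart (antiPart A₂) (x, y))
      (fracGrad n s u₁.fn (x, y))) * u₂.fn x =
      (∫ z, dot (parPart (antiPart A₁) z) (fracGrad n s u₁.fn z) * u₂.fn z.1) -
        ∫ z, dot (parPart (antiPart A₂) z) (fracGrad n s u₁.fn z) * u₂.fn z.1 := by
    rw [← integral_sub (hE hP₁) (hE hP₂)]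
    simp only [← sub_mul, ← hsub]
    rw [Measure.volume_eq_prod, integral_prod _ iE]
    simp only [integral_mul_const]
  have h4 : ∫ x, (bigQ n s A₁ q₁ x - bigQ n s A₂ q₂ x) * u₁.fn x * u₂.fn x =
      (∫ x, bigQ n s A₁ q₁ x * u₁.fn x * u₂.fn x) -
        ∫ x, bigQ n s A₂ q₂ x * u₁.fn x * u₂.fn x := by
    rw [← integral_sub (hQ hP₁) (hQ hP₂)]
    simp only [sub_mul]
  rw [_root_.sub_apply, _root_.sub_apply, h1, h2, bform_eq hn hs0 hs1 hP₁,
    bform_eq hn hs0 hs1 hP₂, h3, h4]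
  ring

end Alessandrini

end

end FracMag

open FracMag MeasureTheory in
theorem mainTheorem9 (n : ℕ) (hn : 1 ≤ n) (s : ℝ) (hs0 : 0 < s) (hs1 : s < 1)
    (Ω : Set (EuclideanSpace ℝ (Fin n))) (hΩ : IsOpen Ω) (hΩb : Bornology.IsBounded Ω) :
    (∀ (A : Rn n × Rn n → Cn n) (q : Rn n → ℝ),
      IsPotential₀ n s A q → ZeroNotEigenvalue n s Ω A q →
        (∀ f : Hs n s, ∃! u : Hs n s, IsSolution Ω A q f u) ∧
        ∃ Λ : Trace n s Ω →L[ℂ] Trace n s Ω →L[ℂ] ℂ,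
          IsDNMap Ω A q Λ ∧
          (∀ Λ' : Trace n s Ω →L[ℂ] Trace n s Ω →L[ℂ] ℂ, IsDNMap Ω A q Λ' → Λ' = Λ) ∧
          ∀ a b : Trace n s Ω, Λ a b = Λ b a) ∧
    (∀ (A₁ A₂ : Rn n × Rn n → Cn n) (q₁ q₂ : Rn n → ℝ),
      IsPotential n s Ω A₁ q₁ → IsPotential n s Ω A₂ q₂ →
      ZeroNotEigenvalue n s Ω A₁ q₁ → ZeroNotEigenvalue n s Ω A₂ q₂ →
        (IsFracDiv n s (parPart (symPart A₁)) (fracDiv n s (parPart (symPart A₁))) ∧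
          MemLp (bigQ n s A₁ q₁) (pExp n s) volume) ∧
        (IsFracDiv n s (parPart (symPart A₂)) (fracDiv n s (parPart (symPart A₂))) ∧
          MemLp (bigQ n s A₂ q₂) (pExp n s) volume) ∧
        ∀ Λ₁ Λ₂ : Trace n s Ω →L[ℂ] Trace n s Ω →L[ℂ] ℂ,
          IsDNMap Ω A₁ q₁ Λ₁ → IsDNMap Ω A₂ q₂ Λ₂ →
          ∀ f₁ f₂ u₁ u₂ : Hs n s, IsSolution Ω A₁ q₁ f₁ u₁ → IsSolution Ω A₂ q₂ f₂ u₂ →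
            Integrable (fun z : Rn n × Rn n =>
              dot (parPart (antiPart A₁) z - parPart (antiPart A₂) z) (fracGrad n s u₁.fn z) *
                u₂.fn z.1) volume ∧
            Integrable (fun x => (bigQ n s A₁ q₁ x - bigQ n s A₂ q₂ x) * u₁.fn x * u₂.fn x)
              volume ∧
            (Λ₁ - Λ₂) (Trace.mk Ω f₁) (Trace.mk Ω f₂) =
              2 * (∫ x, (∫ y, dot (parPart (antiPart A₁) (x, y) - parPart (antiPart A₂) (x, y))
                  (fracGrad n s u₁.fn (x, y))) * u₂.fn x) +
                ∫ x, (bigQ n s A₁ q₁ x - bigQ n s A₂ q₂ x) * u₁.fn x * u₂.fn x) := by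
  refine ⟨fun A q hP h0 => exists_DNMap hn hs0 hs1 hΩ hΩb hP h0,
    fun A₁ A₂ q₁ q₂ hP₁ hP₂ h₁ h₂ => ⟨?_, ?_, fun Λ₁ Λ₂ hΛ₁ hΛ₂ f₁ f₂ u₁ u₂ hu₁ hu₂ => ?_⟩⟩
  · exact ⟨(fracDiv_spec hn hs0 hs1 hP₁.sympar).1, memLp_bigQ hn hs0 hs1 hP₁.toIsPotential₀⟩
  · exact ⟨(fracDiv_spec hn hs0 hs1 hP₂.sympar).1, memLp_bigQ hn hs0 hs1 hP₂.toIsPotential₀⟩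
  · exact alessandrini hn hs0 hs1 hP₁.toIsPotential₀ hP₂.toIsPotential₀
      (fun f => ((exists_DNMap hn hs0 hs1 hΩ hΩb hP₂.toIsPotential₀ h₂).1 f).exists)
      hΛ₁ hΛ₂ hu₁ hu₂
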